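/- Let $K$ be a field, let $S=K[x_1,\dots,x_n,y_1,\dots,y_m]$ be bigraded by $\deg x_i=(1,0)$ and $\deg y_j=(0,1)$, let $J\subset S$ be a bihomogeneous ideal and $R=S/J$. Let $M$ be a finitely generated bigraded $R$-module that lives in nonnegative bidegrees, i.e. $M=\bigoplus_{i,j\ge 0}M_{(i,j)}$. For a graded $K$-algebra $A$ with irrelevant ideal $A_+$ (so that $A/A_+=K$) and a finitely generated graded $A$-module $N$ let $\operatorname{reg}_A N=\sup\{\,j-i : i\ge 0,\ \operatorname{Tor}^A_i(N,K)_j\neq 0\,\}$, where $\sup\emptyset=-\infty$; bigraded algebras and modules are graded by total degree. Assume that $R$ is Koszul, i.e. $\operatorname{reg}_R K=0$. For integers $a,b\ge 0$ with $(a,b)\ne(0,0)$ let $R_\Delta=\bigoplus_{i\ge 0}R_{(ia,ib)}$, with $(R_\Delta)_i=R_{(ia,ib)}$, and $M_\Delta=\bigoplus_i M_{(ia,ib)}$, with $(M_\Delta)_i=M_{(ia,ib)}$. For $a,b\ge 1$ let $R_{\tilde\Delta}=\bigoplus_{i,j\ge 0}R_{(ia,jb)}$ and $M_{\tilde\Delta}=\bigoplus_{i,j}M_{(ia,jb)}$,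 with components $R_{(ia,jb)}$ and $M_{(ia,jb)}$ in bidegree $(i,j)$. The module $M$ itself is a bigraded $R_{\tilde\Delta}$-module whose component of bidegree $(i,j)$ is $\bigoplus_{0\le c<a,\ 0\le d<b}M_{(ia+c,jb+d)}$. (a) Suppose that each of the numbers $a,b$ that is nonzero is at least $\operatorname{reg}_R M$ (that is, $\min\{a,b\}\ge\operatorname{reg}_R M$ if $a,b\ge1$, and $\max\{a,b\}\ge\operatorname{reg}_R M$ if $a=0$ or $b=0$). Then $\operatorname{reg}_{R_\Delta}M_\Delta\le\min\{1,\operatorname{reg}_R M\}$. (b) If $a,b\ge 1$ and $\min\{a,b\}\ge\operatorname{reg}_R M$, then $\operatorname{reg}_{R_{\tilde\Delta}}M_{\tilde\Delta}\le\min\{2,\operatorname{reg}_R M\}$ and $\operatorname{reg}_{R_{\tilde\Delta}}M\le\min\{2,\operatorname{reg}_R M\}$. -/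

import Mathlib

namespace DiagReg

/-! ### Graded modules, graded free resolutions, Tor and regularity

A graded ring is a commutative `K`-algebra `A` with a family `𝒜 : ℤ → Submodule K A` of homogeneous
components, a graded module an `A`-module `N` with a family `𝒩 : ℤ → Submodule K N`. -/

/-- The irrelevant ideal `A₊`, generated by the homogeneous elements of positive degree. -/
def irrelevant {K A : Type*} [Field K] [CommRing A] [Algebra K A] (𝒜 : ℤ → Submodule K A) :
    Ideal A :=
  Ideal.span {x | ∃ j : ℤ, 0 < j ∧ x ∈ 𝒜 j}

/-- The component of degree `j` of the graded free module `⨁ b, A(-deg b)`, whose elements are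
written as coordinate vectors; here `A(-p)_j = A_{j-p}`. -/
def freeComp {K A : Type*} [Field K] [CommRing A] [Algebra K A] (𝒜 : ℤ → Submodule K A) {r : ℕ}
    (deg : Fin r → ℤ) (j : ℤ) : Submodule K (Fin r → A) :=
  Submodule.pi Set.univ fun b => 𝒜 (j - deg b)

/-- A graded free resolution `⋯ → F₁ → F₀ → N → 0` with `F i = ⨁ b, A(-deg i b)` of finite rank
and with homogeneous maps of degree `0`. -/
structure GradedFreeResolution {K A N : Type*} [Field K] [CommRing A] [Algebra K A]
    [AddCommGroup N] [Module K N] [Module A N]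
    (𝒜 : ℤ → Submodule K A) (𝒩 : ℤ → Submodule K N) where
  rank : ℕ → ℕ
  deg : ∀ i, Fin (rank i) → ℤ
  d : ∀ i, (Fin (rank (i + 1)) → A) →ₗ[A] (Fin (rank i) → A)
  aug : (Fin (rank 0) → A) →ₗ[A] N
  d_mem : ∀ i j, ∀ x ∈ freeComp 𝒜 (deg (i + 1)) j, d i x ∈ freeComp 𝒜 (deg i) j
  aug_mem : ∀ j, ∀ x ∈ freeComp 𝒜 (deg 0) j, aug x ∈ 𝒩 j
  aug_surjective : Function.Surjective aug
  exact_zero : Function.Exact (d 0) aug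
  exact_succ : ∀ i, Function.Exact (d (i + 1)) (d i)

section
variable {K A N : Type*} [Field K] [CommRing A] [Algebra K A]
  [AddCommGroup N] [Module K N] [Module A N]

/-- The elements of `F i` whose class in `F i ⊗ A/A₊ = F i / A₊ F i` is a cycle of the complex
`F ⊗ A/A₊`. -/
def GradedFreeResolution.cycles {𝒜 : ℤ → Submodule K A} {𝒩 : ℤ → Submodule K N}
    (F : GradedFreeResolution 𝒜 𝒩) : ∀ i, Submodule A (Fin (F.rank i) → A)
  | 0 => ⊤
  | i + 1 => (irrelevant 𝒜 • (⊤ : Submodule A (Fin (F.rank i) → A))).comap (F.d i)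

/-- The elements of `F i` whose class in `F i ⊗ A/A₊ = F i / A₊ F i` is a boundary of the complex
`F ⊗ A/A₊`. -/
def GradedFreeResolution.boundaries {𝒜 : ℤ → Submodule K A} {𝒩 : ℤ → Submodule K N}
    (F : GradedFreeResolution 𝒜 𝒩) (i : ℕ) : Submodule A (Fin (F.rank i) → A) :=
  irrelevant 𝒜 • ⊤ ⊔ LinearMap.range (F.d i)

/-- `Tor_i^A(N, A/A₊)_j ≠ 0`, where `Tor` is the homology of `F ⊗ A/A₊` for a graded free
resolution `F` of `N`: some homogeneous element of degree `j` is a cycle and not a boundary.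
(Tor does not depend on the resolution; a finitely generated graded module over a finitely
generated algebra has one.) -/
def TorNeZero (𝒜 : ℤ → Submodule K A) (𝒩 : ℤ → Submodule K N) (i : ℕ) (j : ℤ) : Prop :=
  ∃ F : GradedFreeResolution 𝒜 𝒩, ∃ z ∈ freeComp 𝒜 (F.deg i) j,
    z ∈ F.cycles i ∧ z ∉ F.boundaries i

/-- `t_i(N) = sup {j : Tor_i^A(N, K)_j ≠ 0}`, which is `-∞` if the Tor group vanishes. -/
noncomputable def topDegree (𝒜 : ℤ → Submodule K A) (𝒩 : ℤ → Submodule K N) (i : ℕ) : EReal :=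
  sSup {t : EReal | ∃ j : ℤ, TorNeZero 𝒜 𝒩 i j ∧ t = ((j : ℝ) : EReal)}

/-- The Castelnuovo-Mumford regularity `reg_A N = sup {t_i(N) - i : i ≥ 0}`. -/
noncomputable def reg (𝒜 : ℤ → Submodule K A) (𝒩 : ℤ → Submodule K N) : EReal :=
  ⨆ i : ℕ, (topDegree 𝒜 𝒩 i - (i : EReal))

/-- The residue class ring `A/A₊` as a graded module, concentrated in degree `0`. -/
def residueGrading (𝒜 : ℤ → Submodule K A) (j : ℤ) : Submodule K (A ⧸ irrelevant 𝒜) :=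
  if j = 0 then ⊤ else ⊥

/-- `A` is Koszul: the residue class field has regularity `0` over `A`. -/
def IsKoszul (𝒜 : ℤ → Submodule K A) : Prop :=
  reg 𝒜 (residueGrading 𝒜) = 0

end

/-! ### Standard bigraded algebras -/

/-- `K[x_1,…,x_n,y_1,…,y_m]`; the `x` are the left variables, the `y` the right ones. -/
abbrev BiPoly (K : Type*) [Field K] (n m : ℕ) := MvPolynomial (Fin n ⊕ Fin m) K

/-- The bidegrees of the variables, `deg x_i = (1,0)` and `deg y_j = (0,1)`. -/
def bidegree (n m : ℕ) : Fin n ⊕ Fin m → ℤ × ℤ :=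
  Sum.elim (fun _ => (1, 0)) (fun _ => (0, 1))

/-- The components of the bigraded polynomial ring (zero unless both indices are nonnegative). -/
abbrev polyComp (K : Type*) [Field K] (n m : ℕ) (d : ℤ × ℤ) : Submodule K (BiPoly K n m) :=
  MvPolynomial.weightedHomogeneousSubmodule K (bidegree n m) d

/-- `J` is bihomogeneous: it contains the bihomogeneous components of its elements. -/
def IsBihomogeneous {K : Type*} [Field K] {n m : ℕ} (J : Ideal (BiPoly K n m)) : Prop :=
  ∀ f ∈ J, ∀ d : ℤ × ℤ, MvPolynomial.weightedHomogeneousComponent (bidegree n m) d f ∈ J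

/-- The bigraded components of `R = S/J`: the images of the components of `S`. -/
noncomputable def quotComp {K : Type*} [Field K] {n m : ℕ} (J : Ideal (BiPoly K n m)) (d : ℤ × ℤ) :
    Submodule K (BiPoly K n m ⧸ J) :=
  (polyComp K n m d).map (Ideal.Quotient.mkₐ K J).toLinearMap

instance quotComp_gradedMonoid {K : Type*} [Field K] {n m : ℕ} (J : Ideal (BiPoly K n m)) :
    SetLike.GradedMonoid (quotComp J) where
  one_mem := ⟨1, MvPolynomial.isWeightedHomogeneous_one K _, map_one (Ideal.Quotient.mkₐ K J)⟩
  mul_mem := by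
    rintro i j _ _ ⟨x, hx, rfl⟩ ⟨y, hy, rfl⟩
    exact ⟨x * y, MvPolynomial.IsWeightedHomogeneous.mul hx hy,
      map_mul (Ideal.Quotient.mkₐ K J) x y⟩

/-- The `ℤ`-grading by total degree of a bigraded object: `X_k = ⨁_{i+j=k} X_(i,j)`. -/
def totalComp {K X : Type*} [Field K] [AddCommGroup X] [Module K X]
    (𝒳 : ℤ × ℤ → Submodule K X) (k : ℤ) : Submodule K X :=
  ⨆ i : ℤ, 𝒳 (i, k - i)

/-! ### Diagonals and Veronese subrings -/

/-- The `(a,b)`-diagonal `Δ = {(sa, sb) : s ∈ ℤ}`. -/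
def diagonal (a b : ℕ) : AddSubmonoid (ℤ × ℤ) where
  carrier := {d | ∃ s : ℤ, d = (s * a, s * b)}
  zero_mem' := ⟨0, by ext <;> simp⟩
  add_mem' := by
    rintro _ _ ⟨s, rfl⟩ ⟨t, rfl⟩
    exact ⟨s + t, by simp [add_mul]⟩

/-- The set `Δ̃ = {(sa, tb) : s, t ∈ ℤ}`. -/
def veronese (a b : ℕ) : AddSubmonoid (ℤ × ℤ) where
  carrier := {d | ∃ s t : ℤ, d = (s * a, t * b)}
  zero_mem' := ⟨0, 0, by ext <;> simp⟩
  add_mem' := by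
    rintro _ _ ⟨s, s', rfl⟩ ⟨t, t', rfl⟩
    exact ⟨s + t, s' + t', by simp [add_mul]⟩

section
variable {K R M : Type*} [Field K] [CommRing R] [Algebra K R] [AddCommGroup M] [Module K M]
  [Module R M]

/-- The subalgebra `⨁_{d ∈ D} R_d` of a bigraded algebra. -/
def subring (𝓡 : ℤ × ℤ → Submodule K R) [SetLike.GradedMonoid 𝓡] (D : AddSubmonoid (ℤ × ℤ)) :
    Subalgebra K R :=
  (⨆ d : D, 𝓡 d).toSubalgebra
    (Submodule.mem_iSup_of_mem (0 : D) SetLike.GradedOne.one_mem)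
    (by
      intro x y hx hy
      have h : (⨆ d : D, 𝓡 d) * (⨆ d : D, 𝓡 d) ≤ ⨆ d : D, 𝓡 d := by
        rw [Submodule.iSup_mul]
        refine iSup_le fun d => ?_
        rw [Submodule.mul_iSup]
        refine iSup_le fun e => Submodule.mul_le.2 fun u hu v hv => ?_
        exact Submodule.mem_iSup_of_mem (d + e) (SetLike.GradedMul.mul_mem hu hv)
      exact h (Submodule.mul_mem_mul hx hy))

/-- The `⨁_{d ∈ D} R_d`-submodule `⨁_{d ∈ D} M_d` of a bigraded `R`-module. -/
def submod (𝓡 : ℤ × ℤ → Submodule K R) [SetLike.GradedMonoid 𝓡]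
    (𝓜 : ℤ × ℤ → Submodule K M) [SetLike.GradedSMul 𝓡 𝓜] (D : AddSubmonoid (ℤ × ℤ)) :
    Submodule (subring 𝓡 D) M :=
  { (⨆ d : D, 𝓜 d).toAddSubmonoid with
    smul_mem' := by
      rintro ⟨r, hr⟩ x hx
      change r ∈ ⨆ d : D, 𝓡 d at hr
      change x ∈ ⨆ d : D, 𝓜 d at hx
      change r • x ∈ ⨆ d : D, 𝓜 d
      induction hr using Submodule.iSup_induction' with
      | mem d r hr =>
        induction hx using Submodule.iSup_induction' with
        | mem e x hx => exact Submodule.mem_iSup_of_mem (d + e) (SetLike.GradedSMul.smul_mem hr hx)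
        | zero => simp
        | add x y _ _ hx hy => rw [smul_add]; exact add_mem hx hy
      | zero => simp
      | add r s _ _ hr hs => rw [add_smul]; exact add_mem hr hs }

/-- The grading of the diagonal subalgebra: `(R_Δ)_i = R_(ia,ib)`. -/
def diagRingComp (𝓡 : ℤ × ℤ → Submodule K R) [SetLike.GradedMonoid 𝓡] (a b : ℕ) (i : ℤ) :
    Submodule K (subring 𝓡 (diagonal a b)) :=
  (𝓡 (i * a, i * b)).comap (subring 𝓡 (diagonal a b)).val.toLinearMap

/-- The bigrading of the generalized Veronese subring: `(R_Δ̃)_(i,j) = R_(ia,jb)`. -/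
def verRingComp (𝓡 : ℤ × ℤ → Submodule K R) [SetLike.GradedMonoid 𝓡] (a b : ℕ) (d : ℤ × ℤ) :
    Submodule K (subring 𝓡 (veronese a b)) :=
  (𝓡 (d.1 * a, d.2 * b)).comap (subring 𝓡 (veronese a b)).val.toLinearMap

/-- The grading of the module `M_Δ`: `(M_Δ)_i = M_(ia,ib)`. -/
def diagModComp [IsScalarTower K R M] (𝓡 : ℤ × ℤ → Submodule K R) [SetLike.GradedMonoid 𝓡]
    (𝓜 : ℤ × ℤ → Submodule K M) [SetLike.GradedSMul 𝓡 𝓜] (a b : ℕ) (i : ℤ) :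
    Submodule K (submod 𝓡 𝓜 (diagonal a b)) :=
  (𝓜 (i * a, i * b)).comap ((submod 𝓡 𝓜 (diagonal a b)).subtype.restrictScalars K)

/-- The bigrading of the module `M_Δ̃`: `(M_Δ̃)_(i,j) = M_(ia,jb)`. -/
def verModComp [IsScalarTower K R M] (𝓡 : ℤ × ℤ → Submodule K R) [SetLike.GradedMonoid 𝓡]
    (𝓜 : ℤ × ℤ → Submodule K M) [SetLike.GradedSMul 𝓡 𝓜] (a b : ℕ) (d : ℤ × ℤ) :
    Submodule K (submod 𝓡 𝓜 (veronese a b)) :=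
  (𝓜 (d.1 * a, d.2 * b)).comap ((submod 𝓡 𝓜 (veronese a b)).subtype.restrictScalars K)

/-- The bigrading of the whole of `M` as an `R_Δ̃`-module, coming from the decomposition of `M` into
the relative Veronese modules `M^(c,d)` with `0 ≤ c < a`, `0 ≤ d < b` and components
`(M^(c,d))_(i,j) = M_(ia+c,jb+d)`. -/
def fullModComp (𝓜 : ℤ × ℤ → Submodule K M) (a b : ℕ) (d : ℤ × ℤ) : Submodule K M :=
  ⨆ (p : Fin a) (q : Fin b), 𝓜 (d.1 * a + (p : ℕ), d.2 * b + (q : ℕ))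

end

end DiagReg

/-! Let `A` be `R_Δ` or `R_Δ̃`. Both gradings cut a bigraded module into strands, the sums of the
components in the bidegrees reached from a start `(u,v)` by nonnegative steps. A strand of the free
module `R(-p,-q)` is zero or again a strand of `R`, with another start and with degrees raised by
some `s`: the number of steps needed to get past `(p,q)`. Always `s ≤ max(p-u,0) + max(q-v,0)`.

The core is that every strand of `R` has a linear resolution over `A` (`Weights.van_strand`). The
strand starting at `(0,0)` is `A` itself. If `u > 0` or `v > 0`, the strand lies in the ideal `I` of
elements of positive `x`-degree or positive `y`-degree. Since `R` is Koszul, `R/I` has a linear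
resolution over `R`; its strand resolves the given strand by strands to which induction on the
homological degree and on `u + v` applies.

Linearity for `R/I` comes from a tensor product. Let `X` and `G` be the minimal resolutions of `R/I`
and of `K`, and let `Y` be spanned by the basis elements of `G` of `x`-degree (or `y`-degree) zero.
Modulo `I` the complex `Y` resolves `K` over the retract `R/I` of `R`, so `X ⊗ Y` is a minimal
resolution of `K` over `R`. As `Y₀ = R`, it contains the basis of `X`, and the degrees in `X` are
bounded by those in `Tor^R(K,K)`.

For a module `M`, the strand of its minimal `R`-resolution is an exact complex of `A`-modules with
linear resolutions up to the shifts `s`. Hence the regularity of a strand of `M` is at most the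
supremum of `s - i` over basis elements `(p,q)` in homological degree `i`. Here `p + q - i ≤ reg M`.
From `s ≤ p + q` comes the bound `reg M`. From `reg M ≤ a, b` comes `s ≤ i + 1` for diagonals, where
`s` is a maximum of two rounded-up quotients, and `s ≤ i + 2` for Veronese subrings, where it is a
sum of two (`diagWeights_le`, `verWeights_le`).

To work over `A` without finiteness assumptions, vanishing of Tor (`Van`) is expressed through one
huge free resolution of `A/A₊`. `GradedFreeResolution.mem_boundaries` transfers the vanishing to any
finite rank resolution of the module. -/

namespace DiagReg

set_option linter.unusedSectionVars false

universe u

/-! ### A graded free resolution of the residue class field of possibly infinite rank -/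

section Stage
variable {K : Type*} {A : Type u} [Field K] [CommRing A] [Algebra K A]
  {N C : Type*} [AddCommGroup N] [Module A N] [AddCommGroup C] [Module A C]

/-- A family of subgroups of an `A`-module that is compatible with the grading of `A`. -/
def Stable (𝒜 : ℤ → Submodule K A) (𝒩 : ℤ → AddSubgroup N) : Prop :=
  ∀ i j a x, a ∈ 𝒜 i → x ∈ 𝒩 j → a • x ∈ 𝒩 (i + j)

/-- The vector `(p c • x)_c`. -/
noncomputable def smulVec {κ : Type*} (p : κ →₀ A) : N →ₗ[A] (κ →₀ N) :=
  p.sum fun c a => a • Finsupp.lsingle c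

theorem smulVec_apply {κ : Type*} (p : κ →₀ A) (x : N) (c : κ) :
    smulVec p x c = p c • x := by
  classical
  simp only [smulVec, Finsupp.sum, LinearMap.sum_apply, LinearMap.smul_apply,
    Finsupp.lsingle_apply, Finsupp.finsetSum_apply, Finsupp.smul_apply, Finsupp.single_apply]
  simp only [smul_ite, smul_zero, Finset.sum_ite_eq', Finsupp.mem_support_iff, ite_not]
  split_ifs with h
  · simp [h]
  · rfl

/-- Homogeneous elements of degree `e` of `⨁_κ N(-deg)`. -/
def IsHom {κ : Type*} (deg : κ → ℤ) (𝒩 : ℤ → AddSubgroup N) (e : ℤ) (n : κ →₀ N) : Prop :=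
  ∀ c, n c ∈ 𝒩 (e - deg c)

/-- The map `⨁_ι A → ⨁_κ A` with matrix `m`, tensored with a module. -/
noncomputable def matMap {ι κ : Type*} (m : ι → κ →₀ A) : (ι →₀ N) →ₗ[A] (κ →₀ N) :=
  Finsupp.lsum ℕ fun b => smulVec (m b)

theorem matMap_apply {ι κ : Type*} (m : ι → κ →₀ A) (n : ι →₀ N) (c : κ) :
    matMap m n c = n.sum fun b x => m b c • x := by
  simp [matMap, Finsupp.sum, Finsupp.finsetSum_apply, smulVec_apply]

theorem matMap_single {ι κ : Type*} (m : ι → κ →₀ A) (b : ι) :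
    matMap m (Finsupp.single b (1 : A)) = m b := by
  ext c
  rw [matMap_apply, Finsupp.sum_single_index] <;> simp

theorem matMap_map {ι κ : Type*} (m : ι → κ →₀ A) (f : C →ₗ[A] N) (n : ι →₀ C) :
    matMap m (Finsupp.mapRange.linearMap f n) = Finsupp.mapRange.linearMap f (matMap m n) := by
  have : matMap m ∘ₗ Finsupp.mapRange.linearMap f =
      Finsupp.mapRange.linearMap f ∘ₗ matMap m := by
    refine Finsupp.lhom_ext fun b x => ?_
    ext c
    simp [matMap, smulVec_apply]
  exact LinearMap.congr_fun this n

/-- Every `single b x` is the image of `single b 1` under `a ↦ a • x`, so naturality reduces the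
claim to coefficients in `A`. -/
theorem matMap_matMap {ι κ μ : Type*} {m : ι → κ →₀ A} {m' : μ → ι →₀ A}
    (h : ∀ b, matMap m (m' b) = 0) (n : μ →₀ N) : matMap m (matMap m' n) = 0 := by
  have : (matMap m ∘ₗ (matMap m' : _ →ₗ[A] (ι →₀ N))) = 0 := by
    refine Finsupp.lhom_ext fun b x => ?_
    have h1 : (Finsupp.single b x : μ →₀ N) =
        Finsupp.mapRange.linearMap (LinearMap.toSpanSingleton A N x) (Finsupp.single b 1) := by
      simp
    rw [LinearMap.comp_apply, h1, matMap_map, matMap_map, matMap_single, h]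
    simp
  exact LinearMap.congr_fun this n

/-- A graded free resolution of `A/A₊`, of possibly infinite rank, such that all homogeneous
cycles are boundaries of basis elements. -/
structure BigResolution (𝒜 : ℤ → Submodule K A) where
  ι : ℕ → Type u
  deg : ∀ i, ι i → ℤ
  m : ∀ i, ι (i + 1) → ι i →₀ A
  m_mem : ∀ i b c, m i b c ∈ 𝒜 (deg (i + 1) b - deg i c)
  comp : ∀ i b, matMap (m i) (m (i + 1) b) = 0
  exact_succ : ∀ i z k, IsHom (deg (i + 1)) (fun k => (𝒜 k).toAddSubgroup) k z →
    matMap (m i) z = 0 → ∃ b, m (i + 1) b = z ∧ deg (i + 2) b = k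
  pt : ι 0
  eq_pt : ∀ c, c = pt
  deg_pt : deg 0 pt = 0
  exact_zero : ∀ k x, 0 < k → x ∈ 𝒜 k → ∃ b, m 0 b = Finsupp.single pt x ∧ deg 1 b = k
  pos : ∀ b, 0 < deg 1 b

/-- A homogeneous map `⨁_ι A(-deg) → ⨁_κ A(-deg)` of graded free modules. -/
structure Stage (𝒜 : ℤ → Submodule K A) where
  κ : Type u
  ι : Type u
  degκ : κ → ℤ
  degι : ι → ℤ
  m : ι → κ →₀ A
  m_mem : ∀ b c, m b c ∈ 𝒜 (degι b - degκ c)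

variable {𝒜 : ℤ → Submodule K A}

/-- The map from the free module on all homogeneous cycles. -/
noncomputable def Stage.next (s : Stage 𝒜) : Stage 𝒜 where
  κ := s.ι
  ι := {z : (s.ι →₀ A) × ℤ //
    IsHom s.degι (fun k => (𝒜 k).toAddSubgroup) z.2 z.1 ∧ matMap s.m z.1 = 0}
  degκ := s.degι
  degι z := z.1.2
  m z := z.1.1
  m_mem z b := z.2.1 b

variable (𝒜) in
/-- The map `⨁ A(-deg x) → A`, where `x` runs through the homogeneous elements of positive
degree. -/
noncomputable def Stage.first : Stage 𝒜 where
  κ := PUnit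
  ι := {x : A × ℤ // 0 < x.2 ∧ x.1 ∈ 𝒜 x.2}
  degκ _ := 0
  degι x := x.1.2
  m x := Finsupp.single PUnit.unit x.1.1
  m_mem x c := by simpa using x.2.2

variable (𝒜) in
/-- The differentials of a graded free resolution of `A/A₊`. -/
noncomputable def stage : ℕ → Stage 𝒜
  | 0 => Stage.first 𝒜
  | i + 1 => (stage i).next

variable (𝒜) in
/-- The resolution of `A/A₊` on all homogeneous cycles. -/
noncomputable def bigResolution : BigResolution 𝒜 where
  ι i := (stage 𝒜 i).κ
  deg i := (stage 𝒜 i).degκ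
  m i := (stage 𝒜 i).m
  m_mem i := (stage 𝒜 i).m_mem
  comp _ b := b.2.2
  exact_succ _ z k h1 h2 := ⟨⟨(z, k), h1, h2⟩, rfl, rfl⟩
  pt := PUnit.unit
  eq_pt _ := rfl
  deg_pt := rfl
  exact_zero k x h1 h2 := ⟨⟨(x, k), h1, h2⟩, rfl, rfl⟩
  pos b := b.2.1

/-- The differential of the resolution, tensored with a module. -/
noncomputable def BigResolution.bd (P : BigResolution 𝒜) (i : ℕ) :
    (P.ι (i + 1) →₀ N) →ₗ[A] (P.ι i →₀ N) :=
  matMap (P.m i)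

variable {P : BigResolution 𝒜}

theorem BigResolution.bd_map (i : ℕ) (f : C →ₗ[A] N) (n : P.ι (i + 1) →₀ C) :
    P.bd i (Finsupp.mapRange.linearMap f n) = Finsupp.mapRange.linearMap f (P.bd i n) :=
  matMap_map _ _ _

theorem BigResolution.bd_bd (i : ℕ) (n : P.ι (i + 2) →₀ N) : P.bd i (P.bd (i + 1) n) = 0 :=
  matMap_matMap (P.comp i) n

theorem IsHom.bd {𝒩 : ℤ → AddSubgroup N} (h𝒩 : Stable 𝒜 𝒩) {i : ℕ} {e : ℤ}
    {n : P.ι (i + 1) →₀ N} (hn : IsHom (P.deg (i + 1)) 𝒩 e n) :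
    IsHom (P.deg i) 𝒩 e (P.bd i n) := by
  intro c
  rw [BigResolution.bd, matMap_apply]
  refine sum_mem fun b _ => ?_
  have := h𝒩 _ _ _ _ (P.m_mem i b c) (hn b)
  convert! this using 2
  ring

theorem IsHom.sub {κ : Type*} {deg : κ → ℤ} {𝒩 : ℤ → AddSubgroup N} {e : ℤ} {n n' : κ →₀ N}
    (hn : IsHom deg 𝒩 e n) (hn' : IsHom deg 𝒩 e n') : IsHom deg 𝒩 e (n - n') := fun c => by
  rw [Finsupp.sub_apply]
  exact sub_mem (hn c) (hn' c)

theorem IsHom.map {κ : Type*} {deg : κ → ℤ} {𝒞 : ℤ → AddSubgroup C} {𝒩 : ℤ → AddSubgroup N}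
    {f : C →ₗ[A] N} {e : ℤ} (hf : ∀ k, ∀ x ∈ 𝒞 k, f x ∈ 𝒩 k) {n : κ →₀ C}
    (hn : IsHom deg 𝒞 e n) : IsHom deg 𝒩 e (Finsupp.mapRange.linearMap f n) := fun c => by
  simpa using hf _ _ (hn c)

theorem IsHom.lift {κ : Type*} {deg : κ → ℤ} {𝒞 : ℤ → AddSubgroup C} {𝒩 : ℤ → AddSubgroup N}
    {f : C →ₗ[A] N} {e : ℤ} (hf : ∀ k, ∀ x ∈ 𝒩 k, ∃ y ∈ 𝒞 k, f y = x) {n : κ →₀ N}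
    (hn : IsHom deg 𝒩 e n) :
    ∃ c : κ →₀ C, IsHom deg 𝒞 e c ∧ Finsupp.mapRange.linearMap f c = n := by
  classical
  -- A zero coordinate is lifted to zero, which keeps the support finite.
  have h : ∀ b, ∃ y ∈ 𝒞 (e - deg b), f y = n b ∧ (y ≠ 0 → n b ≠ 0) := fun b => by
    by_cases h0 : n b = 0
    · exact ⟨0, zero_mem _, by simp [h0], by simp⟩
    · obtain ⟨y, hy, hy'⟩ := hf _ _ (hn b)
      exact ⟨y, hy, hy', fun _ => h0⟩
  choose g hg hgn hg0 using h
  refine ⟨Finsupp.onFinset n.support g fun b hb => by simpa using hg0 b hb, fun b => hg b, ?_⟩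
  ext b
  simp [hgn]

/-! ### Vanishing of Tor and its long exact sequences -/

variable (P) in
/-- The vanishing of `Tor_j(N, A/A₊)_e`, computed by resolving `A/A₊`. -/
def Van (𝒩 : ℤ → AddSubgroup N) (e : ℤ) : ℕ → Prop
  | 0 => ∀ n : P.ι 0 →₀ N, IsHom (P.deg 0) 𝒩 e n →
      ∃ n' : P.ι (1) →₀ N, IsHom (P.deg (1)) 𝒩 e n' ∧ P.bd 0 n' = n
  | i + 1 => ∀ n : P.ι (i + 1) →₀ N, IsHom (P.deg (i + 1)) 𝒩 e n →
      P.bd i n = 0 → ∃ n' : P.ι (i + 2) →₀ N,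
        IsHom (P.deg (i + 2)) 𝒩 e n' ∧ P.bd (i + 1) n' = n

/-- The kernel of a map of graded modules, as a family of subgroups. -/
def kerFam (𝒞 : ℤ → AddSubgroup C) (f : C →ₗ[A] N) (k : ℤ) : AddSubgroup C :=
  𝒞 k ⊓ f.toAddMonoidHom.ker

theorem mem_kerFam {𝒞 : ℤ → AddSubgroup C} {f : C →ₗ[A] N} {k : ℤ} {x : C} :
    x ∈ kerFam 𝒞 f k ↔ x ∈ 𝒞 k ∧ f x = 0 := Iff.rfl

theorem isHom_kerFam {κ : Type*} {deg : κ → ℤ} {𝒞 : ℤ → AddSubgroup C} {f : C →ₗ[A] N} {e : ℤ}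
    {n : κ →₀ C} : IsHom deg (kerFam 𝒞 f) e n ↔
      IsHom deg 𝒞 e n ∧ Finsupp.mapRange.linearMap f n = 0 := by
  refine ⟨fun h => ⟨fun c => (h c).1, ?_⟩, fun h c => ⟨h.1 c, ?_⟩⟩
  · ext c
    simpa using (mem_kerFam.1 (h c)).2
  · simpa using DFunLike.congr_fun h.2 c

theorem Van.of_surjective_zero {𝒞 : ℤ → AddSubgroup C} {𝒩 : ℤ → AddSubgroup N}
    {f : C →ₗ[A] N} (hf : ∀ k, ∀ x ∈ 𝒞 k, f x ∈ 𝒩 k)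
    (hf' : ∀ k, ∀ x ∈ 𝒩 k, ∃ y ∈ 𝒞 k, f y = x) {e : ℤ} (h : Van P 𝒞 e 0) :
    Van P 𝒩 e 0 := by
  intro n hn
  obtain ⟨c, hc, rfl⟩ := hn.lift hf'
  obtain ⟨c', hc', rfl⟩ := h c hc
  exact ⟨_, hc'.map hf, BigResolution.bd_map _ _ _⟩

/-- This is the piece `Tor_{j+1}(C) → Tor_{j+1}(N) → Tor_j(ker f)` of the long exact sequence. A
cycle over `N` is lifted to `C`; the boundary of the lift lies over the kernel, and a correction
taken there turns the lift into a cycle. -/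
theorem Van.of_surjective_succ {𝒞 : ℤ → AddSubgroup C} {𝒩 : ℤ → AddSubgroup N}
    (h𝒞 : Stable 𝒜 𝒞)
    {f : C →ₗ[A] N} (hf : ∀ k, ∀ x ∈ 𝒞 k, f x ∈ 𝒩 k)
    (hf' : ∀ k, ∀ x ∈ 𝒩 k, ∃ y ∈ 𝒞 k, f y = x) {e : ℤ} {j : ℕ} (h : Van P 𝒞 e (j + 1))
    (hz : Van P (kerFam 𝒞 f) e j) :
    Van P 𝒩 e (j + 1) := by
  intro n hn hn0
  obtain ⟨c, hc, rfl⟩ := IsHom.lift hf' hn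
  have hz' : ∃ z : P.ι (j + 1) →₀ C, IsHom (P.deg (j + 1)) (kerFam 𝒞 f) e z ∧
      P.bd j z = P.bd j c := by
    have h1 : IsHom (P.deg j) (kerFam 𝒞 f) e (P.bd j c) :=
      isHom_kerFam.2 ⟨IsHom.bd h𝒞 hc, by rw [← BigResolution.bd_map]; exact hn0⟩
    cases j with
    | zero => exact hz _ h1
    | succ j => exact hz _ h1 (BigResolution.bd_bd j c)
  obtain ⟨z, hz1, hz2⟩ := hz'
  obtain ⟨c', hc', hcz⟩ := h (c - z) (hc.sub (isHom_kerFam.1 hz1).1)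
    ((P.bd j).map_sub c z |>.trans (by rw [hz2, sub_self]))
  refine ⟨_, hc'.map hf, ?_⟩
  rw [BigResolution.bd_map, hcz]
  exact (map_sub (Finsupp.mapRange.linearMap (α := P.ι (j + 1)) f) c z).trans
    (by rw [(isHom_kerFam.1 hz1).2, sub_zero])

/-- Dimension shifting towards the syzygies. -/
theorem Van.kerFam_succ {𝒞 : ℤ → AddSubgroup C} {𝒩 : ℤ → AddSubgroup N}
    {f : C →ₗ[A] N} (hf : ∀ k, ∀ x ∈ 𝒞 k, f x ∈ 𝒩 k) (h𝒞 : Stable 𝒜 𝒞)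
    (hf' : ∀ k, ∀ x ∈ 𝒩 k, ∃ y ∈ 𝒞 k, f y = x) {e : ℤ} {j : ℕ} (h : Van P 𝒩 e (j + 2))
    (hz : Van P 𝒞 e (j + 1)) :
    Van P (kerFam 𝒞 f) e (j + 1) := by
  intro z hz1 hz0
  obtain ⟨hz1, hz2⟩ := isHom_kerFam.1 hz1
  obtain ⟨c, hc, rfl⟩ := hz z hz1 hz0
  obtain ⟨n, hn, hnc⟩ := h _ (hc.map hf) (by rw [← hz2]; exact BigResolution.bd_map _ _ _)
  obtain ⟨c', hc', rfl⟩ := IsHom.lift hf' hn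
  rw [BigResolution.bd_map] at hnc
  refine ⟨c - P.bd (j + 2) c', isHom_kerFam.2 ⟨hc.sub (IsHom.bd h𝒞 hc'), ?_⟩, ?_⟩
  · refine (map_sub (Finsupp.mapRange.linearMap (α := P.ι (j + 2)) f) c _).trans ?_
    exact sub_eq_zero.2 hnc.symm
  · rw [map_sub, BigResolution.bd_bd, sub_zero]

/-- Because `Tor_1(N)` vanishes, `Tor_0(ker f) → Tor_0(C)` is injective in degree `e`; the statement
is this injectivity on representatives. -/
theorem Van.exists_bd_eq {𝒞 : ℤ → AddSubgroup C} {𝒩 : ℤ → AddSubgroup N}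
    {f : C →ₗ[A] N} (hf : ∀ k, ∀ x ∈ 𝒞 k, f x ∈ 𝒩 k) (h𝒞 : Stable 𝒜 𝒞)
    (hf' : ∀ k, ∀ x ∈ 𝒩 k, ∃ y ∈ 𝒞 k, f y = x) {e : ℤ} (h : Van P 𝒩 e 1)
    {c : P.ι (1) →₀ C} (hc : IsHom (P.deg (1)) 𝒞 e c)
    (hc0 : Finsupp.mapRange.linearMap f (P.bd 0 c) = 0) :
    ∃ z : P.ι (1) →₀ C, IsHom (P.deg (1)) (kerFam 𝒞 f) e z ∧
      P.bd 0 z = P.bd 0 c := by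
  obtain ⟨n, hn, hnc⟩ := h _ (hc.map hf) (by rw [← hc0]; exact BigResolution.bd_map _ _ _)
  obtain ⟨c', hc', rfl⟩ := IsHom.lift hf' hn
  rw [BigResolution.bd_map] at hnc
  refine ⟨c - P.bd 1 c', isHom_kerFam.2 ⟨hc.sub (IsHom.bd h𝒞 hc'), ?_⟩, ?_⟩
  · refine (map_sub (Finsupp.mapRange.linearMap (α := P.ι (1)) f) c _).trans ?_
    exact sub_eq_zero.2 hnc.symm
  · rw [map_sub, BigResolution.bd_bd, sub_zero]

/-- `Tor` vanishes on a graded module if it does so on a resolution. -/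
theorem Van.of_resolution {X : ℕ → Type*} [∀ i, AddCommGroup (X i)] [∀ i, Module A (X i)]
    (𝒳 : ∀ i, ℤ → AddSubgroup (X i)) (h𝒳 : ∀ i, Stable 𝒜 (𝒳 i))
    (d : ∀ i, X (i + 1) →ₗ[A] X i) (hd : ∀ i k, ∀ x ∈ 𝒳 (i + 1) k, d i x ∈ 𝒳 i k)
    (hdd : ∀ i x, d i (d (i + 1) x) = 0)
    (hex : ∀ i k, ∀ x ∈ 𝒳 (i + 1) k, d i x = 0 → ∃ y ∈ 𝒳 (i + 2) k, d (i + 1) y = x)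
    {e : ℤ} (j i : ℕ) (h : ∀ l ≤ j, Van P (𝒳 (i + 2 + l)) e (j - l)) :
    Van P (kerFam (𝒳 (i + 1)) (d i)) e j := by
  have h1 : ∀ i k, ∀ x ∈ 𝒳 (i + 2) k, d (i + 1) x ∈ kerFam (𝒳 (i + 1)) (d i) k :=
    fun i k x hx => mem_kerFam.2 ⟨hd _ k x hx, hdd i x⟩
  have h2 : ∀ i k, ∀ x ∈ kerFam (𝒳 (i + 1)) (d i) k, ∃ y ∈ 𝒳 (i + 2) k, d (i + 1) y = x :=
    fun i k x hx => hex i k x (mem_kerFam.1 hx).1 (mem_kerFam.1 hx).2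
  induction j generalizing i with
  | zero => exact Van.of_surjective_zero (h1 i) (h2 i) (h 0 le_rfl)
  | succ j ih =>
    -- The cycles are covered by the next term, and the kernel of this covering is the next module
    -- of cycles: one degree of Tor is traded for one step along the complex.
    refine Van.of_surjective_succ (h𝒳 _) (h1 i) (h2 i) (h 0 (Nat.zero_le _))
      (ih (i + 1) fun l hl => ?_)
    have := h (l + 1) (by omega)
    rw [show j + 1 - (l + 1) = j - l by omega,
      show i + 2 + (l + 1) = i + 1 + 2 + l by omega] at this
    exact this

/-- Dimension shifting again, now from the augmentation. The first two coverings are treated by hand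
because the kernel of `aug` is not the kernel of one of the maps `d i`. -/
theorem Van.of_augmented {X : ℕ → Type*} [∀ i, AddCommGroup (X i)] [∀ i, Module A (X i)]
    (𝒳 : ∀ i, ℤ → AddSubgroup (X i)) (h𝒳 : ∀ i, Stable 𝒜 (𝒳 i))
    (d : ∀ i, X (i + 1) →ₗ[A] X i) (hd : ∀ i k, ∀ x ∈ 𝒳 (i + 1) k, d i x ∈ 𝒳 i k)
    (hdd : ∀ i x, d i (d (i + 1) x) = 0)
    (hex : ∀ i k, ∀ x ∈ 𝒳 (i + 1) k, d i x = 0 → ∃ y ∈ 𝒳 (i + 2) k, d (i + 1) y = x)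
    {𝒩 : ℤ → AddSubgroup N} (aug : X 0 →ₗ[A] N) (haug : ∀ k, ∀ x ∈ 𝒳 0 k, aug x ∈ 𝒩 k)
    (hsurj : ∀ k, ∀ x ∈ 𝒩 k, ∃ y ∈ 𝒳 0 k, aug y = x) (hcomp : ∀ x, aug (d 0 x) = 0)
    (hex₀ : ∀ k, ∀ x ∈ 𝒳 0 k, aug x = 0 → ∃ y ∈ 𝒳 1 k, d 0 y = x)
    {e : ℤ} (j : ℕ) (h : ∀ i ≤ j, Van P (𝒳 i) e (j - i)) : Van P 𝒩 e j := by
  have h1 : ∀ k, ∀ x ∈ 𝒳 1 k, d 0 x ∈ kerFam (𝒳 0) aug k :=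
    fun k x hx => mem_kerFam.2 ⟨hd _ k x hx, hcomp x⟩
  have h2 : ∀ k, ∀ x ∈ kerFam (𝒳 0) aug k, ∃ y ∈ 𝒳 1 k, d 0 y = x :=
    fun k x hx => hex₀ k x (mem_kerFam.1 hx).1 (mem_kerFam.1 hx).2
  match j with
  | 0 => exact Van.of_surjective_zero haug hsurj (h 0 le_rfl)
  | 1 =>
    exact Van.of_surjective_succ (h𝒳 0) haug hsurj (h 0 (Nat.zero_le _))
      (Van.of_surjective_zero h1 h2 (h 1 le_rfl))
  | j + 2 =>
    refine Van.of_surjective_succ (h𝒳 0) haug hsurj (h 0 (Nat.zero_le _))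
      (Van.of_surjective_succ (h𝒳 1) h1 h2 (h 1 (by omega))
        (Van.of_resolution 𝒳 h𝒳 d hd hdd hex j 0 fun l hl => ?_))
    have := h (2 + l) (by omega)
    rwa [show j + 2 - (2 + l) = j - l by omega] at this

/-- This allows `M_Δ` to be treated as a family of subgroups of `M`. -/
theorem Van.of_injective {𝒞 : ℤ → AddSubgroup C} {𝒩 : ℤ → AddSubgroup N}
    {f : C →ₗ[A] N} (hf : Function.Injective f) (hm : ∀ k, 𝒩 k = (𝒞 k).map f.toAddMonoidHom)
    {e : ℤ} {j : ℕ} (h : Van P 𝒩 e j) : Van P 𝒞 e j := by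
  have h1 : ∀ k, ∀ x ∈ 𝒞 k, f x ∈ 𝒩 k := fun k x hx => by
    rw [hm]; exact ⟨x, hx, rfl⟩
  have h2 : ∀ k, ∀ x ∈ 𝒩 k, ∃ y ∈ 𝒞 k, f y = x := fun k x hx => by
    rw [hm] at hx; exact hx
  have hi : ∀ κ : Type u, Function.Injective (Finsupp.mapRange.linearMap (α := κ) f) := fun κ =>
    Finsupp.mapRange_injective _ (map_zero f) hf
  cases j with
  | zero =>
    intro n hn
    obtain ⟨n', hn', he⟩ := h _ (hn.map h1)
    obtain ⟨c, hc, rfl⟩ := IsHom.lift h2 hn'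
    rw [BigResolution.bd_map] at he
    exact ⟨c, hc, hi _ he⟩
  | succ j =>
    intro n hn hn0
    obtain ⟨n', hn', he⟩ := h _ (hn.map h1) (by
      refine (BigResolution.bd_map _ _ _).trans ?_
      rw [hn0, map_zero])
    obtain ⟨c, hc, rfl⟩ := IsHom.lift h2 hn'
    rw [BigResolution.bd_map] at he
    exact ⟨c, hc, hi _ he⟩

theorem Van.congr_shift {𝒞 𝒩 : ℤ → AddSubgroup N} {s : ℤ} (hs : ∀ k, 𝒩 k = 𝒞 (k - s))
    {e : ℤ} {j : ℕ} (h : Van P 𝒞 (e - s) j) : Van P 𝒩 e j := by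
  have key : ∀ {κ : Type u} (deg : κ → ℤ) (n : κ →₀ N), IsHom deg 𝒩 e n ↔
      IsHom deg 𝒞 (e - s) n := fun deg n => by
    refine forall_congr' fun c => ?_
    rw [hs, sub_right_comm]
  cases j with
  | zero => simpa only [Van, key] using h
  | succ j => simpa only [Van, key] using h

theorem Van.of_eq_bot {𝒩 : ℤ → AddSubgroup N} (hs : ∀ k, 𝒩 k = ⊥) {e : ℤ} {j : ℕ} :
    Van P 𝒩 e j := by
  have key : ∀ {κ : Type u} (deg : κ → ℤ) (n : κ →₀ N), IsHom deg 𝒩 e n → n = 0 :=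
    fun deg n hn => by
      ext c
      simpa [hs] using hn c
  cases j with
  | zero =>
    intro n hn
    exact ⟨0, fun c => zero_mem _, by rw [map_zero, key _ _ hn]⟩
  | succ j =>
    intro n hn _
    exact ⟨0, fun c => zero_mem _, by rw [map_zero, key _ _ hn]⟩

/-- The product of finitely many families of subgroups. -/
def piFam {β : Type*} {M : β → Type*} [∀ b, AddCommGroup (M b)]
    (𝒩 : ∀ b, ℤ → AddSubgroup (M b)) (k : ℤ) : AddSubgroup (∀ b, M b) :=
  AddSubgroup.pi Set.univ fun b => 𝒩 b k

theorem mem_piFam {β : Type*} {M : β → Type*} [∀ b, AddCommGroup (M b)]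
    {𝒩 : ∀ b, ℤ → AddSubgroup (M b)} {k : ℤ} {x : ∀ b, M b} :
    x ∈ piFam 𝒩 k ↔ ∀ b, x b ∈ 𝒩 b k := by
  simp [piFam, AddSubgroup.mem_pi]

theorem Van.pi {β : Type*} [Fintype β] {𝒩 : β → ℤ → AddSubgroup N} {e : ℤ} {j : ℕ}
    (h : ∀ b, Van P (𝒩 b) e j) : Van P (piFam 𝒩) e j := by
  classical
  have h1 : ∀ {κ : Type u} {deg : κ → ℤ} {n : κ →₀ (β → N)} (b : β), IsHom deg (piFam 𝒩) e n →
      IsHom deg (𝒩 b) e (Finsupp.mapRange.linearMap (LinearMap.proj (R := A) b) n) :=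
    fun b hn c => by simpa using mem_piFam.1 (hn c) b
  have h2 : ∀ {κ : Type u} {deg : κ → ℤ} {n : β → κ →₀ N},
      (∀ b, IsHom deg (𝒩 b) e (n b)) → IsHom deg (piFam 𝒩) e
        (∑ b, Finsupp.mapRange.linearMap (LinearMap.single A (fun _ => N) b) (n b)) :=
    fun hn c => by
      rw [mem_piFam]
      intro b
      have := hn b c
      simpa [Finsupp.finsetSum_apply, Finset.sum_apply, Pi.single_apply] using this
  have h3 : ∀ {κ : Type u} (n : κ →₀ (β → N)),
      ∑ b, Finsupp.mapRange.linearMap (LinearMap.single A (fun _ => N) b)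
        (Finsupp.mapRange.linearMap (LinearMap.proj (R := A) b) n) = n := fun n => by
    ext c b
    simp [Finsupp.finsetSum_apply, Finset.sum_apply, Pi.single_apply]
  cases j with
  | zero =>
    intro n hn
    choose g hg hgn using fun b => h b _ (h1 b hn)
    refine ⟨_, h2 hg, ?_⟩
    rw [map_sum]
    simp only [BigResolution.bd_map, hgn]
    exact h3 n
  | succ j =>
    intro n hn hn0
    choose g hg hgn using fun b => h b _ (h1 b hn) (by
      refine (BigResolution.bd_map _ _ _).trans ?_
      rw [hn0, map_zero])
    refine ⟨_, h2 hg, ?_⟩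
    rw [map_sum]
    simp only [BigResolution.bd_map, hgn]
    exact h3 n

/-- The resolution is exact: `Tor_j(A, A/A₊) = 0` for `j > 0`, and `Tor_0(A, A/A₊)` vanishes in
positive degrees. -/
theorem Van.ring [hone : SetLike.GradedOne 𝒜] {e : ℤ} {j : ℕ} (h : j = 0 → 0 < e) :
    Van P (fun k => (𝒜 k).toAddSubgroup) e j := by
  have h1 : (1 : A) ∈ 𝒜 0 := hone.one_mem
  have key : ∀ i (b : P.ι i), IsHom (P.deg i) (fun k => (𝒜 k).toAddSubgroup) (P.deg i b)
      (Finsupp.single b (1 : A)) := fun i b c => by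
    classical
    rw [Finsupp.single_apply]
    split_ifs with hbc
    · subst hbc
      simpa using h1
    · exact zero_mem _
  cases j with
  | zero =>
    intro n hn
    obtain ⟨b, hb, rfl⟩ := P.exact_zero e (n P.pt) (h rfl) (by
      simpa [P.deg_pt] using hn P.pt)
    refine ⟨Finsupp.single b 1, key _ _, ?_⟩
    rw [BigResolution.bd, matMap_single, hb]
    ext c
    simp [P.eq_pt c]
  | succ j =>
    intro n hn hn0
    -- Every homogeneous cycle is by construction a column of the next matrix, so a basis vector is
    -- the required preimage.
    obtain ⟨b, hb, rfl⟩ := P.exact_succ j n e hn hn0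
    exact ⟨Finsupp.single b 1, key _ _, by rw [BigResolution.bd, matMap_single, hb]⟩

end Stage

/-! ### Independent families of subspaces -/

section Families
variable {K : Type*} [Field K] {γ : Type*} {W X : Type*} [AddCommGroup W] [Module K W]
  [AddCommGroup X] [Module K X]

/-- Split `w` into a part over `S` and a part over the complement. The image of the second part lies
in the sums over both sets, so it is zero by independence. This is what turns exactness into
exactness of each strand. -/
theorem exists_mem_biSup_of_graded (f : W →ₗ[K] X) {𝒲 : γ → Submodule K W}
    {𝒳 : γ → Submodule K X} (hf : ∀ d, ∀ x ∈ 𝒲 d, f x ∈ 𝒳 d) (htop : ⨆ d, 𝒲 d = ⊤)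
    (hind : iSupIndep 𝒳) (S : Set γ) (w : W) (hw : f w ∈ ⨆ d ∈ S, 𝒳 d) :
    ∃ v ∈ ⨆ d ∈ S, 𝒲 d, f v = f w := by
  have hmap : ∀ T : Set γ, ∀ x ∈ ⨆ d ∈ T, 𝒲 d, f x ∈ ⨆ d ∈ T, 𝒳 d := fun T => by
    change (⨆ d ∈ T, 𝒲 d) ≤ (⨆ d ∈ T, 𝒳 d).comap f
    exact iSup₂_le fun d hd x hx => Submodule.mem_iSup_of_mem d
      (Submodule.mem_iSup_of_mem hd (hf d x hx))
  have hle : (⊤ : Submodule K W) ≤ (⨆ d ∈ S, 𝒲 d) ⊔ ⨆ d ∈ Sᶜ, 𝒲 d := by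
    rw [← htop]
    refine iSup_le fun d => ?_
    by_cases hd : d ∈ S
    · exact le_sup_of_le_left (le_biSup 𝒲 hd)
    · exact le_sup_of_le_right (le_biSup 𝒲 (show d ∈ Sᶜ from hd))
  obtain ⟨v, hv, v', hv', rfl⟩ := Submodule.mem_sup.1 (hle (Submodule.mem_top (x := w)))
  refine ⟨v, hv, ?_⟩
  have h1 : f v' ∈ ⨆ d ∈ S, 𝒳 d := by
    have := sub_mem hw (hmap S v hv)
    rwa [map_add, add_sub_cancel_left] at this
  have h2 := hmap Sᶜ v' hv'
  have h3 := Submodule.disjoint_def.1 (hind.disjoint_biSup_biSup (disjoint_compl_right (a := S)))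
    _ h1 h2
  rw [map_add, h3, add_zero]

theorem exists_mem_of_graded (f : W →ₗ[K] X) {𝒲 : γ → Submodule K W}
    {𝒳 : γ → Submodule K X} (hf : ∀ d, ∀ x ∈ 𝒲 d, f x ∈ 𝒳 d) (htop : ⨆ d, 𝒲 d = ⊤)
    (hind : iSupIndep 𝒳) (d : γ) (w : W) (hw : f w ∈ 𝒳 d) :
    ∃ v ∈ 𝒲 d, f v = f w := by
  have := exists_mem_biSup_of_graded f hf htop hind {d} w (by simpa using hw)
  simpa using this

theorem iSupIndep_pi {β : Type*} {𝒩 : β → γ → Submodule K X} (h : ∀ b, iSupIndep (𝒩 b)) :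
    iSupIndep fun d => Submodule.pi Set.univ (fun b => 𝒩 b d) := by
  intro d
  rw [Submodule.disjoint_def]
  intro x hx hx'
  ext b
  refine Submodule.disjoint_def.1 (h b d) _ (hx b trivial) ?_
  have : (⨆ d', ⨆ (_ : d' ≠ d), Submodule.pi Set.univ (fun b => 𝒩 b d')) ≤
      (⨆ d', ⨆ (_ : d' ≠ d), 𝒩 b d').comap (LinearMap.proj b) :=
    iSup₂_le fun d hd y hy => Submodule.mem_iSup_of_mem d
      (Submodule.mem_iSup_of_mem hd (hy b trivial))
  exact this hx'

variable {β : Type*} [Fintype β] {𝒩 : β → γ → Submodule K X}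

theorem mem_biSup_pi (S : Set γ) (x : β → X) :
    x ∈ ⨆ d ∈ S, Submodule.pi Set.univ (fun b => 𝒩 b d) ↔ ∀ b, x b ∈ ⨆ d ∈ S, 𝒩 b d := by
  classical
  constructor
  · intro hx b
    have : (⨆ d ∈ S, Submodule.pi Set.univ (fun b => 𝒩 b d)) ≤
        (⨆ d ∈ S, 𝒩 b d).comap (LinearMap.proj b) :=
      iSup₂_le fun d hd y hy => Submodule.mem_iSup_of_mem d
        (Submodule.mem_iSup_of_mem hd (hy b trivial))
    exact this hx
  · intro hx
    rw [← Finset.univ_sum_single x]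
    refine sum_mem fun b _ => ?_
    have : (⨆ d ∈ S, 𝒩 b d) ≤ (⨆ d ∈ S, Submodule.pi Set.univ (fun b => 𝒩 b d)).comap
        (LinearMap.single K (fun _ : β => X) b) :=
      iSup₂_le fun d hd y hy => Submodule.mem_iSup_of_mem d
        (Submodule.mem_iSup_of_mem hd fun c _ => by
          by_cases hc : c = b
          · subst hc
            simpa using hy
          · simp [hc])
    exact this (hx b)

theorem iSup_pi_eq_top (h : ∀ b, ⨆ d, 𝒩 b d = ⊤) :
    ⨆ d, Submodule.pi Set.univ (fun b => 𝒩 b d) = ⊤ := by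
  refine eq_top_iff.2 fun x _ => ?_
  have := (mem_biSup_pi (𝒩 := 𝒩) Set.univ x).2 (by simp [h])
  simpa using this

end Families

/-! ### Vanishing of `Tor` and graded free resolutions -/

section Balance
variable {K : Type*} {A : Type u} {N : Type*} [Field K] [CommRing A] [Algebra K A]
  [AddCommGroup N] [Module K N] [Module A N]

/-- `A = ⨁_{k ≥ 0} 𝒜 k` is a graded algebra whose component of degree `0` meets `A₊` trivially. -/
structure IsPosGraded (𝒜 : ℤ → Submodule K A) : Prop where
  one_mem : 1 ∈ 𝒜 0
  mul_mem : ∀ i j x y, x ∈ 𝒜 i → y ∈ 𝒜 j → x * y ∈ 𝒜 (i + j)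
  indep : iSupIndep 𝒜
  iSup_eq_top : ⨆ k, 𝒜 k = ⊤
  neg : ∀ k < 0, 𝒜 k = ⊥
  zero : ∀ x ∈ 𝒜 0, x ∈ irrelevant 𝒜 → x = 0

variable {𝒜 : ℤ → Submodule K A} {𝒩 : ℤ → Submodule K N}

/-- The grading of a graded free module. -/
def freeFam (𝒜 : ℤ → Submodule K A) {r : ℕ} (deg : Fin r → ℤ) (k : ℤ) :
    AddSubgroup (Fin r → A) :=
  (freeComp 𝒜 deg k).toAddSubgroup

theorem mem_freeFam {r : ℕ} {deg : Fin r → ℤ} {k : ℤ} {x : Fin r → A} :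
    x ∈ freeFam 𝒜 deg k ↔ ∀ b, x b ∈ 𝒜 (k - deg b) := by
  simp [freeFam, freeComp]

theorem IsPosGraded.stable_freeFam (h : IsPosGraded 𝒜) {r : ℕ} (deg : Fin r → ℤ) :
    Stable 𝒜 (freeFam 𝒜 deg) := fun i j a x ha hx => mem_freeFam.2 fun b => by
  have := h.mul_mem _ _ _ _ ha (mem_freeFam.1 hx b)
  rwa [← add_sub_assoc] at this

variable {P : BigResolution 𝒜}

theorem IsPosGraded.van_freeFam (h : IsPosGraded 𝒜) {r : ℕ} (deg : Fin r → ℤ) (e : ℤ) (j : ℕ) :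
    Van P (freeFam 𝒜 deg) e (j + 1) := by
  have : freeFam 𝒜 deg = piFam fun b k => (𝒜 (k - deg b)).toAddSubgroup := by
    ext k x
    simp [mem_freeFam, mem_piFam]
  rw [this]
  have : SetLike.GradedOne 𝒜 := ⟨h.one_mem⟩
  exact Van.pi fun b => Van.congr_shift (s := deg b) (fun k => rfl) (Van.ring (by simp))

theorem IsPosGraded.eq_zero_of_mem_irrelevant (h : IsPosGraded 𝒜) {k : ℤ} (hk : k ≤ 0) {x : A}
    (hx : x ∈ 𝒜 k) (hx' : x ∈ irrelevant 𝒜) : x = 0 := by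
  rcases hk.lt_or_eq with hk | rfl
  · simpa [h.neg k hk] using hx
  · exact h.zero x hx hx'

/-- The vanishing of `Tor_0(A, A/A₊)` in positive degrees, applied to each coordinate, exhibits
elements of `A₊F` as images of the first differential. -/
theorem IsPosGraded.exists_bd_eq (h : IsPosGraded 𝒜) {r : ℕ} (deg : Fin r → ℤ) {e : ℤ}
    {x : Fin r → A} (hx : x ∈ freeComp 𝒜 deg e) (hx' : ∀ b, x b ∈ irrelevant 𝒜) :
    ∃ c : P.ι 1 →₀ (Fin r → A), IsHom (P.deg 1) (freeFam 𝒜 deg) e c ∧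
      P.bd 0 c = Finsupp.single P.pt x := by
  have hx := fun b => mem_freeFam.1 hx b
  -- Coordinates of degree at most `0` are suppressed: there `Tor_0(A, A/A₊)` need not vanish, but
  -- an element of `A₊` of such a degree is zero.
  let 𝒩 : Fin r → ℤ → AddSubgroup A := fun b k =>
    if 0 < e - deg b then (𝒜 (k - deg b)).toAddSubgroup else ⊥
  have hle : ∀ k, ∀ y ∈ piFam 𝒩 k, y ∈ freeFam 𝒜 deg k := fun k y hy => mem_freeFam.2 fun b => by
    have := mem_piFam.1 hy b
    simp only [𝒩] at this
    split_ifs at this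
    · exact this
    · simp [(AddSubgroup.mem_bot.1 this)]
  have : SetLike.GradedOne 𝒜 := ⟨h.one_mem⟩
  have hv : Van P (piFam 𝒩) e 0 := Van.pi fun b => by
    by_cases hb : 0 < e - deg b
    · exact Van.congr_shift (s := deg b) (𝒞 := fun k => (𝒜 k).toAddSubgroup)
        (fun k => by simp only [𝒩, if_pos hb]) (Van.ring fun _ => hb)
    · exact Van.of_eq_bot fun k => by simp only [𝒩, if_neg hb]
  obtain ⟨c, hc, hc'⟩ := hv (Finsupp.single P.pt x) (fun c => by
    rw [P.eq_pt c, Finsupp.single_eq_same, P.deg_pt, sub_zero, mem_piFam]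
    intro b
    by_cases hb : 0 < e - deg b
    · simp only [𝒩, if_pos hb]
      exact hx b
    · simp only [𝒩, if_neg hb]
      exact AddSubgroup.mem_bot.2 (h.eq_zero_of_mem_irrelevant (not_lt.1 hb) (hx b) (hx' b)))
  exact ⟨c, fun b => hle _ _ (hc b), hc'⟩

theorem BigResolution.bd_mem {C : Type*} [AddCommGroup C] [Module A C] (Z : Submodule A C)
    {c : P.ι 1 →₀ C} (hc : ∀ b, c b ∈ Z) : P.bd 0 c P.pt ∈ irrelevant 𝒜 • Z := by
  rw [BigResolution.bd, matMap_apply]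
  refine sum_mem fun b _ => Submodule.smul_mem_smul (Ideal.subset_span ⟨P.deg 1 b, P.pos b, ?_⟩)
    (hc b)
  simpa [P.deg_pt] using P.m_mem 0 b P.pt

theorem mem_of_mem_irrelevant_smul {r : ℕ} {x : Fin r → A}
    (hx : x ∈ irrelevant 𝒜 • (⊤ : Submodule A (Fin r → A))) (b : Fin r) : x b ∈ irrelevant 𝒜 := by
  have : irrelevant 𝒜 • (⊤ : Submodule A (Fin r → A)) ≤
      Submodule.comap (LinearMap.proj b) (irrelevant 𝒜 : Submodule A A) :=
    Submodule.smul_le.2 fun a ha y _ => Ideal.mul_mem_right _ _ ha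
  exact this hx

namespace GradedFreeResolution

variable (F : GradedFreeResolution 𝒜 𝒩)

theorem exists_d_eq (h : IsPosGraded 𝒜) (i : ℕ) (k : ℤ) (x : Fin (F.rank (i + 1)) → A)
    (hx : x ∈ freeFam 𝒜 (F.deg (i + 1)) k) (hx' : F.d i x = 0) :
    ∃ y ∈ freeFam 𝒜 (F.deg (i + 2)) k, F.d (i + 1) y = x := by
  obtain ⟨w, rfl⟩ := (F.exact_succ i x).1 hx'
  exact exists_mem_of_graded ((F.d (i + 1)).restrictScalars K) (F.d_mem _)
    (iSup_pi_eq_top fun b => (Equiv.subRight (F.deg _ b)).iSup_comp.trans h.iSup_eq_top)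
    (iSupIndep_pi fun b => h.indep.comp (sub_left_injective)) k w hx

theorem exists_d_zero_eq (h : IsPosGraded 𝒜) (k : ℤ) (x : Fin (F.rank 0) → A)
    (hx : x ∈ freeFam 𝒜 (F.deg 0) k) (hx' : F.aug x = 0) :
    ∃ y ∈ freeFam 𝒜 (F.deg 1) k, F.d 0 y = x := by
  obtain ⟨w, rfl⟩ := (F.exact_zero x).1 hx'
  exact exists_mem_of_graded ((F.d 0).restrictScalars K) (F.d_mem _)
    (iSup_pi_eq_top fun b => (Equiv.subRight (F.deg _ b)).iSup_comp.trans h.iSup_eq_top)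
    (iSupIndep_pi fun b => h.indep.comp (sub_left_injective)) k w hx

theorem exists_aug_eq [IsScalarTower K A N] (h : IsPosGraded 𝒜) (hN : iSupIndep 𝒩) (k : ℤ) (x : N)
    (hx : x ∈ (𝒩 k).toAddSubgroup) :
    ∃ y ∈ freeFam 𝒜 (F.deg 0) k, F.aug y = x := by
  obtain ⟨w, rfl⟩ := F.aug_surjective x
  exact exists_mem_of_graded (F.aug.restrictScalars K) F.aug_mem
    (iSup_pi_eq_top fun b => (Equiv.subRight (F.deg _ b)).iSup_comp.trans h.iSup_eq_top) hN k w hx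

/-- The syzygy modules of a resolution. -/
def syz : ∀ i, ℤ → AddSubgroup (Fin (F.rank i) → A)
  | 0 => kerFam (freeFam 𝒜 (F.deg 0)) F.aug
  | i + 1 => kerFam (freeFam 𝒜 (F.deg (i + 1))) (F.d i)

theorem d_mem_syz (i : ℕ) (k : ℤ) (x : Fin (F.rank (i + 1)) → A)
    (hx : x ∈ freeFam 𝒜 (F.deg (i + 1)) k) : F.d i x ∈ F.syz i k := by
  cases i with
  | zero => exact mem_kerFam.2 ⟨F.d_mem _ _ _ hx, F.exact_zero.apply_apply_eq_zero x⟩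
  | succ i => exact mem_kerFam.2 ⟨F.d_mem _ _ _ hx, (F.exact_succ i).apply_apply_eq_zero x⟩

theorem exists_of_mem_syz (h : IsPosGraded 𝒜) (i : ℕ) (k : ℤ) (x : Fin (F.rank i) → A)
    (hx : x ∈ F.syz i k) : ∃ y ∈ freeFam 𝒜 (F.deg (i + 1)) k, F.d i y = x := by
  cases i with
  | zero => exact F.exists_d_zero_eq h k x (mem_kerFam.1 hx).1 (mem_kerFam.1 hx).2
  | succ i => exact F.exists_d_eq h i k x (mem_kerFam.1 hx).1 (mem_kerFam.1 hx).2

/-- Iterated dimension shifting. `F.syz i` is the kernel on `F i`, that is, the syzygy module of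
order `i + 1`, which accounts for the index `i + m + 2`. -/
theorem van_syz [IsScalarTower K A N] (h : IsPosGraded 𝒜) (hN : iSupIndep 𝒩) {e : ℤ} (i m : ℕ)
    (hv : Van P (fun k => (𝒩 k).toAddSubgroup) e (i + m + 2)) : Van P (F.syz i) e (m + 1) := by
  induction i generalizing m with
  | zero =>
    rw [zero_add] at hv
    exact Van.kerFam_succ F.aug_mem (h.stable_freeFam _) (F.exists_aug_eq h hN) hv
      (h.van_freeFam _ _ _)
  | succ i ih =>
    refine Van.kerFam_succ (F.d_mem_syz i) (h.stable_freeFam _) (F.exists_of_mem_syz h i)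
      (ih (m + 1) ?_) (h.van_freeFam _ _ _)
    rwa [show i + (m + 1) + 2 = i + 1 + m + 2 by ring]

/-- Since `A₊ · im f = f(A₊F)`, the element `z` differs from an element of `A₊F` by an element of
`ker f`, which is a boundary. -/
theorem mem_boundaries_of_smul_ker {X : Type*} [AddCommGroup X] [Module A X] (i : ℕ)
    (f : (Fin (F.rank i) → A) →ₗ[A] X) (hf : Function.Exact (F.d i) f)
    {z : Fin (F.rank i) → A} (hz : f z ∈ irrelevant 𝒜 • LinearMap.range f) :
    z ∈ F.boundaries i := by
  rw [← Submodule.map_top, ← Submodule.map_smul''] at hz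
  obtain ⟨w, hw, hwz⟩ := hz
  have h1 : f (z - w) = 0 := by rw [map_sub, hwz, sub_self]
  obtain ⟨v, hv⟩ := (hf _).1 h1
  rw [boundaries, Submodule.mem_sup]
  exact ⟨w, hw, _, ⟨v, rfl⟩, by rw [hv, add_sub_cancel]⟩

/-- Vanishing of `Tor_1` on the image of `f` gives, in degree `e`, that elements of `A₊F_j` lying in
`im d` belong to `A₊ · im d`. For a cycle `z` modulo `A₊` this applies to `d z`. -/
theorem mem_boundaries_succ (h : IsPosGraded 𝒜) {X : Type*} [AddCommGroup X] [Module A X] (j : ℕ)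
    (𝒳 : ℤ → AddSubgroup X) (f : (Fin (F.rank j) → A) →ₗ[A] X)
    (h1 : ∀ k, ∀ x ∈ freeFam 𝒜 (F.deg j) k, f x ∈ 𝒳 k)
    (h2 : ∀ k, ∀ x ∈ 𝒳 k, ∃ y ∈ freeFam 𝒜 (F.deg j) k, f y = x)
    (h3 : Function.Exact (F.d j) f) {e : ℤ} (h4 : Van P 𝒳 e 1) {z : Fin (F.rank (j + 1)) → A}
    (hz : z ∈ freeComp 𝒜 (F.deg (j + 1)) e) (hz' : z ∈ F.cycles (j + 1)) :
    z ∈ F.boundaries (j + 1) := by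
  obtain ⟨c, hc, hcz⟩ := h.exists_bd_eq (P := P) _ (F.d_mem _ _ _ hz)
    (mem_of_mem_irrelevant_smul hz')
  obtain ⟨c', hc', hcc⟩ := Van.exists_bd_eq h1 (h.stable_freeFam _) h2 h4 hc (by
    rw [hcz]
    simp [h3.apply_apply_eq_zero])
  refine F.mem_boundaries_of_smul_ker (j + 1) (F.d j) (F.exact_succ j) ?_
  have := BigResolution.bd_mem (LinearMap.range (F.d j)) (c := c') fun b =>
    (h3 _).1 (mem_kerFam.1 (hc' b)).2
  rwa [hcc, hcz, Finsupp.single_eq_same] at this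

/-- If `Tor_i(N, A/A₊)_e`, computed by a resolution of `A/A₊`, vanishes, then so does the module
computed by a graded free resolution of `N`. -/
theorem mem_boundaries [IsScalarTower K A N] (h : IsPosGraded 𝒜) (hN : iSupIndep 𝒩) {e : ℤ} {i : ℕ}
    (hv : Van P (fun k => (𝒩 k).toAddSubgroup) e i) {z : Fin (F.rank i) → A}
    (hz : z ∈ freeComp 𝒜 (F.deg i) e) (hz' : z ∈ F.cycles i) : z ∈ F.boundaries i := by
  match i with
  | 0 =>
    refine F.mem_boundaries_of_smul_ker 0 F.aug F.exact_zero ?_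
    obtain ⟨n, hn, hnz⟩ := hv (Finsupp.single P.pt (F.aug z)) fun c => by
      rw [P.eq_pt c, Finsupp.single_eq_same, P.deg_pt, sub_zero]
      exact F.aug_mem _ _ hz
    rw [LinearMap.range_eq_top.2 F.aug_surjective]
    have := BigResolution.bd_mem (P := P) ⊤ (c := n) (by simp)
    rwa [show P.bd 0 n = _ from hnz, Finsupp.single_eq_same] at this
  | 1 => exact F.mem_boundaries_succ h 0 (fun k => (𝒩 k).toAddSubgroup) F.aug F.aug_mem (F.exists_aug_eq h hN) F.exact_zero hv hz hz'
  | i + 2 =>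
    exact F.mem_boundaries_succ h (i + 1) _ (F.d i) (F.d_mem_syz i) (F.exists_of_mem_syz h i) (F.exact_succ i)
      (F.van_syz h hN i 0 hv) hz hz'

end GradedFreeResolution

/-- Only this half of the balance of Tor is needed, because only upper bounds for regularity over
`A` are claimed. -/
theorem not_torNeZero_of_van [IsScalarTower K A N] (h : IsPosGraded 𝒜) (hN : iSupIndep 𝒩)
    {e : ℤ} {i : ℕ} (hv : Van P (fun k => (𝒩 k).toAddSubgroup) e i) : ¬ TorNeZero 𝒜 𝒩 i e := by
  rintro ⟨F, z, hz, hz', hz''⟩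
  exact hz'' (F.mem_boundaries h hN hv hz hz')

end Balance

/-! ### Minimal resolutions over bigraded algebras -/

section Bigraded
variable {K : Type*} {R : Type u} [Field K] [CommRing R] [Algebra K R]

/-- A bigraded algebra `R = ⨁_{i,j ≥ 0} R_(i,j)` with `R_(0,0) = K`. -/
structure IsBigraded (𝓡 : ℤ × ℤ → Submodule K R) : Prop where
  one_mem : 1 ∈ 𝓡 0
  mul_mem : ∀ i j x y, x ∈ 𝓡 i → y ∈ 𝓡 j → x * y ∈ 𝓡 (i + j)
  indep : iSupIndep 𝓡
  iSup_eq_top : ⨆ d, 𝓡 d = ⊤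
  nonneg : ∀ d x, x ∈ 𝓡 d → x ≠ 0 → 0 ≤ d
  zero : ∀ x ∈ 𝓡 0, ∃ c : K, algebraMap K R c = x

/-- A family of subspaces of a module that is compatible with the bigrading of the ring. -/
def BiStable {M : Type*} [AddCommGroup M] [Module K M] [Module R M] (𝓡 : ℤ × ℤ → Submodule K R)
    (𝓜 : ℤ × ℤ → Submodule K M) : Prop :=
  ∀ i j a x, a ∈ 𝓡 i → x ∈ 𝓜 j → a • x ∈ 𝓜 (i + j)

/-- The total degree. -/
def tdeg : ℤ × ℤ →+ ℤ := AddMonoidHom.fst ℤ ℤ + AddMonoidHom.snd ℤ ℤ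

theorem tdeg_apply (d : ℤ × ℤ) : tdeg d = d.1 + d.2 := rfl

theorem totalComp_eq {X : Type*} [AddCommGroup X] [Module K X] (𝒳 : ℤ × ℤ → Submodule K X)
    (k : ℤ) : totalComp 𝒳 k = ⨆ d ∈ {d | tdeg d = k}, 𝒳 d := by
  refine le_antisymm (iSup_le fun i => ?_) (iSup₂_le fun d hd => ?_)
  · exact le_biSup 𝒳 (show (i, k - i) ∈ {d | tdeg d = k} by simp [tdeg_apply])
  · have hd : d.1 + d.2 = k := hd
    have : d = (d.1, k - d.1) := by ext <;> simp [← hd]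
    rw [this]
    exact le_iSup (fun i => 𝒳 (i, k - i)) d.1

theorem mem_totalComp {X : Type*} [AddCommGroup X] [Module K X] {𝒳 : ℤ × ℤ → Submodule K X}
    {d : ℤ × ℤ} {x : X} (hx : x ∈ 𝒳 d) : x ∈ totalComp 𝒳 (tdeg d) := by
  rw [totalComp_eq]
  exact Submodule.mem_iSup_of_mem d (Submodule.mem_iSup_of_mem (by simp) hx)

variable {𝓡 : ℤ × ℤ → Submodule K R}

theorem BiStable.biSup {M : Type*} [AddCommGroup M] [Module K M] [Module R M]
    {𝓜 : ℤ × ℤ → Submodule K M} (h : BiStable 𝓡 𝓜) {S T U : Set (ℤ × ℤ)}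
    (hS : ∀ s ∈ S, ∀ t ∈ T, s + t ∈ U) {a : R} {x : M} (ha : a ∈ ⨆ d ∈ S, 𝓡 d)
    (hx : x ∈ ⨆ d ∈ T, 𝓜 d) : a • x ∈ ⨆ d ∈ U, 𝓜 d := by
  have h1 : ∀ s ∈ S, ∀ a ∈ 𝓡 s, a • x ∈ ⨆ d ∈ U, 𝓜 d := fun s hs a ha => by
    have : (⨆ d ∈ T, 𝓜 d).toAddSubgroup ≤
        (⨆ d ∈ U, 𝓜 d).toAddSubgroup.comap (DistribSMul.toAddMonoidHom M a) := by
      intro y hy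
      change y ∈ ⨆ d ∈ T, 𝓜 d at hy
      change a • y ∈ ⨆ d ∈ U, 𝓜 d
      induction hy using Submodule.iSup_induction' with
      | mem d y hy =>
        induction hy using Submodule.iSup_induction' with
        | mem hd y hy =>
          exact Submodule.mem_iSup_of_mem (s + d) (Submodule.mem_iSup_of_mem (hS s hs d hd)
            (h _ _ _ _ ha hy))
        | zero => simp
        | add y z _ _ hy hz => rw [smul_add]; exact add_mem hy hz
      | zero => simp
      | add y z _ _ hy hz => rw [smul_add]; exact add_mem hy hz
    exact this hx
  induction ha using Submodule.iSup_induction' with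
  | mem d a ha =>
    induction ha using Submodule.iSup_induction' with
    | mem hd a ha => exact h1 d hd a ha
    | zero => simp
    | add y z _ _ hy hz => rw [add_smul]; exact add_mem hy hz
  | zero => simp
  | add y z _ _ hy hz => rw [add_smul]; exact add_mem hy hz

theorem BiStable.totalComp {M : Type*} [AddCommGroup M] [Module K M] [Module R M]
    {𝓜 : ℤ × ℤ → Submodule K M} (h : BiStable 𝓡 𝓜) {i j : ℤ} {a : R} {x : M}
    (ha : a ∈ totalComp 𝓡 i) (hx : x ∈ totalComp 𝓜 j) : a • x ∈ totalComp 𝓜 (i + j) := by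
  rw [totalComp_eq] at ha hx ⊢
  exact h.biSup (fun s (hs : _ = _) t (ht : _ = _) => by simp [hs, ht]) ha hx

theorem IsBigraded.biStable (h : IsBigraded 𝓡) : BiStable 𝓡 𝓡 := h.mul_mem

/-- The ideal of the elements without components of `ℓ`-degree `0`. -/
def IsBigraded.posIdeal (h : IsBigraded 𝓡) (ℓ : ℤ × ℤ →+ ℤ) (hℓ : ∀ d, 0 ≤ d → 0 ≤ ℓ d) :
    Ideal R :=
  { (⨆ d ∈ {d | ℓ d ≠ 0}, 𝓡 d).toAddSubmonoid with
    smul_mem' := by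
      intro r x hx
      change x ∈ ⨆ d ∈ {d | ℓ d ≠ 0}, 𝓡 d at hx
      change r • x ∈ ⨆ d ∈ {d | ℓ d ≠ 0}, 𝓡 d
      have hr : r ∈ ⨆ d, 𝓡 d := by rw [h.iSup_eq_top]; trivial
      induction hr using Submodule.iSup_induction' with
      | mem d r hr =>
        induction hx using Submodule.iSup_induction' with
        | mem e x hx =>
          induction hx using Submodule.iSup_induction' with
          | mem he x hx =>
            by_cases hr0 : r = 0
            · simp [hr0]
            by_cases hx0 : x = 0
            · simp [hx0]
            refine Submodule.mem_iSup_of_mem (d + e) (Submodule.mem_iSup_of_mem ?_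
              (h.mul_mem _ _ _ _ hr hx))
            have h1 := hℓ d (h.nonneg d r hr hr0)
            have h2 := hℓ e (h.nonneg e x hx hx0)
            have h3 : ℓ e ≠ 0 := he
            simp only [Set.mem_ofPred_eq, map_add]
            omega
          | zero => simp
          | add y z _ _ hy hz => rw [smul_add]; exact add_mem hy hz
        | zero => simp
        | add y z _ _ hy hz => rw [smul_add]; exact add_mem hy hz
      | zero => simp
      | add y z _ _ hy hz => rw [add_smul]; exact add_mem hy hz }

section posIdeal
variable (h : IsBigraded 𝓡) (ℓ : ℤ × ℤ →+ ℤ) (hℓ : ∀ d, 0 ≤ d → 0 ≤ ℓ d)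

theorem IsBigraded.mem_posIdeal {x : R} :
    x ∈ h.posIdeal ℓ hℓ ↔ x ∈ ⨆ d ∈ {d | ℓ d ≠ 0}, 𝓡 d := Iff.rfl

theorem IsBigraded.mem_posIdeal_of_mem {d : ℤ × ℤ} (hd : ℓ d ≠ 0) {x : R} (hx : x ∈ 𝓡 d) :
    x ∈ h.posIdeal ℓ hℓ :=
  Submodule.mem_iSup_of_mem d (Submodule.mem_iSup_of_mem hd hx)

theorem IsBigraded.eq_zero_of_mem_posIdeal {x : R} (hx : x ∈ ⨆ d ∈ {d | ℓ d = 0}, 𝓡 d)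
    (hx' : x ∈ h.posIdeal ℓ hℓ) : x = 0 := by
  refine Submodule.disjoint_def.1 (h.indep.disjoint_biSup_biSup (s := {d | ℓ d = 0})
    (t := {d | ℓ d ≠ 0}) ?_) x hx hx'
  exact Set.disjoint_left.2 fun d h1 h2 => h2 h1

theorem IsBigraded.exists_sub_mem_posIdeal (x : R) :
    ∃ y ∈ ⨆ d ∈ {d | ℓ d = 0}, 𝓡 d, x - y ∈ h.posIdeal ℓ hℓ := by
  have hle : (⊤ : Submodule K R) ≤ (⨆ d ∈ {d | ℓ d = 0}, 𝓡 d) ⊔ ⨆ d ∈ {d | ℓ d ≠ 0}, 𝓡 d := by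
    rw [← h.iSup_eq_top]
    refine iSup_le fun d => ?_
    by_cases hd : ℓ d = 0
    · exact le_sup_of_le_left (le_biSup 𝓡 (show d ∈ {d | ℓ d = 0} from hd))
    · exact le_sup_of_le_right (le_biSup 𝓡 (show d ∈ {d | ℓ d ≠ 0} from hd))
  obtain ⟨y, hy, z, hz, rfl⟩ := Submodule.mem_sup.1 (hle (Submodule.mem_top (x := x)))
  exact ⟨y, hy, by rw [add_sub_cancel_left]; exact hz⟩

theorem IsBigraded.one_notMem_posIdeal [Nontrivial R] : (1 : R) ∉ h.posIdeal ℓ hℓ := fun h1 =>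
  one_ne_zero (h.eq_zero_of_mem_posIdeal ℓ hℓ
    (Submodule.mem_iSup_of_mem 0 (Submodule.mem_iSup_of_mem (map_zero ℓ) h.one_mem)) h1)

end posIdeal

theorem tdeg_nonneg (d : ℤ × ℤ) (hd : 0 ≤ d) : 0 ≤ tdeg d := add_nonneg hd.1 hd.2

/-- With this, the residue class field is the case `ℓ = tdeg` of the quotients by `posIdeal`. -/
theorem IsBigraded.irrelevant_eq (h : IsBigraded 𝓡) :
    irrelevant (totalComp 𝓡) = h.posIdeal tdeg tdeg_nonneg := by
  refine le_antisymm (Ideal.span_le.2 ?_) fun x hx => ?_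
  · rintro x ⟨j, hj, hx⟩
    rw [totalComp_eq] at hx
    refine (h.mem_posIdeal tdeg tdeg_nonneg).2 (biSup_mono (f := 𝓡)
      (fun d (hd : tdeg d = j) => show tdeg d ≠ 0 from hd ▸ hj.ne') hx)
  · replace hx := (h.mem_posIdeal tdeg tdeg_nonneg).1 hx
    induction hx using Submodule.iSup_induction' with
    | mem d x hx =>
      induction hx using Submodule.iSup_induction' with
      | mem hd x hx =>
        by_cases hx0 : x = 0
        · simp [hx0]
        · exact Ideal.subset_span ⟨tdeg d, lt_of_le_of_ne
            (tdeg_nonneg d (h.nonneg d x hx hx0)) (Ne.symm hd), mem_totalComp hx⟩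
      | zero => simp
      | add y z _ _ hy hz => exact add_mem hy hz
    | zero => simp
    | add y z _ _ hy hz => exact add_mem hy hz

theorem tdeg_eq_zero {d : ℤ × ℤ} (hd : 0 ≤ d) (h : tdeg d = 0) : d = 0 := by
  have h1 : 0 ≤ d.1 := hd.1
  have h2 : 0 ≤ d.2 := hd.2
  rw [tdeg_apply] at h
  ext <;> simp <;> omega

theorem IsBigraded.mem_irrelevant (h : IsBigraded 𝓡) {d : ℤ × ℤ} (hd : d ≠ 0) {x : R}
    (hx : x ∈ 𝓡 d) : x ∈ irrelevant (totalComp 𝓡) := by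
  by_cases hx0 : x = 0
  · simp [hx0]
  · rw [h.irrelevant_eq]
    exact h.mem_posIdeal_of_mem _ _ (fun h0 => hd (tdeg_eq_zero (h.nonneg d x hx hx0) h0)) hx

theorem IsBigraded.one_notMem_irrelevant [Nontrivial R] (h : IsBigraded 𝓡) :
    (1 : R) ∉ irrelevant (totalComp 𝓡) := by
  rw [h.irrelevant_eq]
  exact h.one_notMem_posIdeal _ _

/-- The bigrading of the free module `⨁ R(-deg b)`. -/
def biFree (𝓡 : ℤ × ℤ → Submodule K R) {r : ℕ} (deg : Fin r → ℤ × ℤ) (d : ℤ × ℤ) :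
    Submodule K (Fin r → R) :=
  Submodule.pi Set.univ fun b => 𝓡 (d - deg b)

theorem mem_biFree {r : ℕ} {deg : Fin r → ℤ × ℤ} {d : ℤ × ℤ} {x : Fin r → R} :
    x ∈ biFree 𝓡 deg d ↔ ∀ b, x b ∈ 𝓡 (d - deg b) := by
  simp [biFree]

section
variable {r : ℕ} (deg : Fin r → ℤ × ℤ)

theorem IsBigraded.indep_biFree (h : IsBigraded 𝓡) : iSupIndep (biFree 𝓡 deg) :=
  iSupIndep_pi fun _ => h.indep.comp sub_left_injective

theorem IsBigraded.iSup_biFree (h : IsBigraded 𝓡) : ⨆ d, biFree 𝓡 deg d = ⊤ :=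
  iSup_pi_eq_top fun b => (Equiv.subRight (deg b)).iSup_comp.trans h.iSup_eq_top

theorem IsBigraded.biStable_biFree (h : IsBigraded 𝓡) : BiStable 𝓡 (biFree 𝓡 deg) :=
  fun i j a x ha hx => mem_biFree.2 fun b => by
    have := h.mul_mem _ _ _ _ ha (mem_biFree.1 hx b)
    rwa [← add_sub_assoc] at this

end

section Module
variable {M N : Type*} [AddCommGroup M] [Module K M] [Module R M]
  [AddCommGroup N] [Module K N] [Module R N]

/-- A submodule is homogeneous if its elements are sums of homogeneous elements. -/
def IsHomogeneousSub (𝓜 : ℤ × ℤ → Submodule K M) (Z : Submodule R M) : Prop :=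
  ∀ z ∈ Z, z ∈ Submodule.span R {y | y ∈ Z ∧ ∃ d, y ∈ 𝓜 d}

theorem eq_zero_of_sum_eq_zero {γ : Type*} {𝓜 : γ → Submodule K M} (hind : iSupIndep 𝓜)
    (s : Finset γ) (x : γ → M) (hx : ∀ d, x d ∈ 𝓜 d) (h : ∑ d ∈ s, x d = 0) :
    ∀ d ∈ s, x d = 0 := by
  classical
  intro d hd
  rw [← Finset.add_sum_erase s x hd] at h
  refine Submodule.disjoint_def.1 (hind d) _ (hx d) ?_
  rw [eq_neg_of_add_eq_zero_left h]
  refine neg_mem (sum_mem fun d' hd' => ?_)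
  exact Submodule.mem_iSup_of_mem d' (Submodule.mem_iSup_of_mem (Finset.ne_of_mem_erase hd') (hx d'))

/-- The kernel of a homogeneous map consists of sums of homogeneous elements of the kernel. -/
theorem exists_sum_of_map_eq_zero {𝓜 : ℤ × ℤ → Submodule K M} {𝓝 : ℤ × ℤ → Submodule K N}
    (hM : ⨆ d, 𝓜 d = ⊤) (hN : iSupIndep 𝓝) (f : M →ₗ[R] N) (hf : ∀ d, ∀ x ∈ 𝓜 d, f x ∈ 𝓝 d)
    (z : M) (hz : f z = 0) :
    ∃ (s : Finset (ℤ × ℤ)) (x : ℤ × ℤ → M), (∀ d, x d ∈ 𝓜 d) ∧ (∀ d, f (x d) = 0) ∧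
      ∑ d ∈ s, x d = z := by
  obtain ⟨x, hx, hxz⟩ := (Submodule.mem_iSup_iff_exists_finsupp 𝓜 z).1 (hM ▸ Submodule.mem_top)
  refine ⟨x.support, x, hx, fun d => ?_, hxz⟩
  by_cases hd : d ∈ x.support
  · refine eq_zero_of_sum_eq_zero hN x.support (fun d => f (x d)) (fun d => hf d _ (hx d)) ?_ d hd
    rw [← map_sum, ← hz, ← hxz]
    rfl
  · rw [Finsupp.notMem_support_iff.1 hd, map_zero]

theorem isHomogeneousSub_ker {𝓜 : ℤ × ℤ → Submodule K M} {𝓝 : ℤ × ℤ → Submodule K N}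
    (hM : ⨆ d, 𝓜 d = ⊤) (hN : iSupIndep 𝓝) (f : M →ₗ[R] N) (hf : ∀ d, ∀ x ∈ 𝓜 d, f x ∈ 𝓝 d) :
    IsHomogeneousSub 𝓜 (LinearMap.ker f) := fun z hz => by
  obtain ⟨s, x, hx, hfx, rfl⟩ := exists_sum_of_map_eq_zero hM hN f hf z hz
  exact sum_mem fun d _ => Submodule.subset_span ⟨hfx d, d, hx d⟩

theorem isHomogeneousSub_top {𝓜 : ℤ × ℤ → Submodule K M} (hM : ⨆ d, 𝓜 d = ⊤) :
    IsHomogeneousSub 𝓜 (⊤ : Submodule R M) := fun z _ => by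
  obtain ⟨x, hx, rfl⟩ := (Submodule.mem_iSup_iff_exists_finsupp 𝓜 z).1 (hM ▸ Submodule.mem_top)
  exact sum_mem fun d _ => Submodule.subset_span ⟨trivial, d, hx d⟩

theorem IsHomogeneousSub.exists_generators {𝓜 : ℤ × ℤ → Submodule K M} {Z : Submodule R M}
    (hZ : IsHomogeneousSub 𝓜 Z) (hfg : Z.FG) :
    ∃ (r : ℕ) (deg : Fin r → ℤ × ℤ) (g : Fin r → M), (∀ b, g b ∈ 𝓜 (deg b)) ∧
      Submodule.span R (Set.range g) = Z := by
  have h1 : Submodule.span R {y | y ∈ Z ∧ ∃ d, y ∈ 𝓜 d} = Z :=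
    le_antisymm (Submodule.span_le.2 fun y hy => hy.1) hZ
  rw [← h1, Submodule.fg_span_iff_fg_span_finset_subset] at hfg
  obtain ⟨s, hs, hspan⟩ := hfg
  have h2 : ∀ b : Fin s.card, ∃ d, (s.equivFin.symm b : M) ∈ 𝓜 d := fun b =>
    (hs (s.equivFin.symm b).2).2
  choose deg hdeg using h2
  refine ⟨s.card, deg, fun b => s.equivFin.symm b, hdeg, ?_⟩
  rw [← h1, hspan]
  congr 1
  ext y
  constructor
  · rintro ⟨b, rfl⟩
    exact (s.equivFin.symm b).2
  · intro hy
    exact ⟨s.equivFin ⟨y, hy⟩, by simp⟩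

theorem linearCombination_mem {𝓜 : ℤ × ℤ → Submodule K M} (hst : BiStable 𝓡 𝓜) {r : ℕ}
    {deg : Fin r → ℤ × ℤ} {g : Fin r → M} (hg : ∀ b, g b ∈ 𝓜 (deg b)) (d : ℤ × ℤ)
    (x : Fin r → R) (hx : x ∈ biFree 𝓡 deg d) : Fintype.linearCombination R g x ∈ 𝓜 d := by
  rw [Fintype.linearCombination_apply]
  refine sum_mem fun b _ => ?_
  have := hst _ _ _ _ (mem_biFree.1 hx b) (hg b)
  rwa [sub_add_cancel] at this

theorem linearCombination_mem_total {𝓜 : ℤ × ℤ → Submodule K M} (hst : BiStable 𝓡 𝓜) {r : ℕ}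
    {deg : Fin r → ℤ × ℤ} {g : Fin r → M} (hg : ∀ b, g b ∈ 𝓜 (deg b)) (k : ℤ)
    (x : Fin r → R) (hx : x ∈ freeComp (totalComp 𝓡) (fun b => tdeg (deg b)) k) :
    Fintype.linearCombination R g x ∈ totalComp 𝓜 k := by
  rw [Fintype.linearCombination_apply]
  refine sum_mem fun b _ => ?_
  have := hst.totalComp (hx b trivial) (mem_totalComp (hg b))
  rwa [sub_add_cancel] at this

/-- A finitely generated homogeneous submodule has a minimal system of homogeneous generators. -/
theorem IsHomogeneousSub.exists_minimal_generators [IsScalarTower K R M] (h : IsBigraded 𝓡)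
    {𝓜 : ℤ × ℤ → Submodule K M} (hst : BiStable 𝓡 𝓜) (hind : iSupIndep 𝓜) {Z : Submodule R M}
    (hZ : IsHomogeneousSub 𝓜 Z) (hfg : Z.FG) :
    ∃ (r : ℕ) (deg : Fin r → ℤ × ℤ) (g : Fin r → M), (∀ b, g b ∈ 𝓜 (deg b)) ∧
      LinearMap.range (Fintype.linearCombination R g) = Z ∧
      ∀ c, Fintype.linearCombination R g c = 0 → ∀ b, c b ∈ irrelevant (totalComp 𝓡) := by
  classical
  have hex := hZ.exists_generators hfg
  obtain ⟨deg, g, hg, hspan⟩ := Nat.find_spec hex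
  have hmin : ∀ m < Nat.find hex, _ := fun m hm => Nat.find_min hex hm
  generalize Nat.find hex = r at *
  refine ⟨r, deg, g, hg, by rw [Fintype.range_linearCombination, hspan], fun c hc b => ?_⟩
  by_contra hcb
  -- Some homogeneous component of the relation still has its coefficient at `b` outside `R₊`. That
  -- coefficient has bidegree `0`, so it is a nonzero scalar, and `g b` can be omitted, against the
  -- minimality of `r`.
  obtain ⟨s, x, hx, hfx, rfl⟩ := exists_sum_of_map_eq_zero (h.iSup_biFree deg) hind
    (Fintype.linearCombination R g) (linearCombination_mem hst hg) c hc
  rw [Finset.sum_apply] at hcb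
  obtain ⟨d, hd⟩ : ∃ d, x d b ∉ irrelevant (totalComp 𝓡) := by
    by_contra! hall
    exact hcb (sum_mem fun d _ => hall d)
  have hdb := mem_biFree.1 (hx d) b
  have hd0 : d - deg b = 0 := by
    by_contra h0
    exact hd (h.mem_irrelevant h0 hdb)
  rw [hd0] at hdb
  obtain ⟨c, hc⟩ := h.zero _ hdb
  have hc0 : c ≠ 0 := by
    rintro rfl
    rw [map_zero] at hc
    exact hd (hc ▸ zero_mem _)
  have hsum := hfx d
  rw [Fintype.linearCombination_apply, ← Finset.add_sum_erase _ _ (Finset.mem_univ b), ← hc,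
    algebraMap_smul] at hsum
  have hgb : g b ∈ Submodule.span R (Set.range fun i : {i // i ≠ b} => g i) := by
    have h1 : g b = - ((algebraMap K R c⁻¹) • ∑ i ∈ Finset.univ.erase b, x d i • g i) := by
      rw [← smul_neg, ← eq_neg_of_add_eq_zero_left hsum, algebraMap_smul, inv_smul_smul₀ hc0]
    rw [h1]
    refine neg_mem (Submodule.smul_mem _ _ (sum_mem fun i hi => Submodule.smul_mem _ _ ?_))
    exact Submodule.subset_span ⟨⟨i, Finset.ne_of_mem_erase hi⟩, rfl⟩
  have e : {i // i ≠ b} ≃ Fin (r - 1) := Fintype.equivFinOfCardEq (by simp)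
  have hr : r - 1 < r := by
    have := b.pos
    omega
  refine hmin _ hr ⟨fun i => deg (e.symm i), fun i => g (e.symm i), fun i => hg _, ?_⟩
  rw [← hspan]
  refine le_antisymm (Submodule.span_mono ?_) (Submodule.span_le.2 ?_)
  · rintro _ ⟨i, rfl⟩
    exact ⟨_, rfl⟩
  · have hr : (Set.range fun i => g (e.symm i)) = Set.range fun i : {i // i ≠ b} => g i :=
      e.symm.surjective.range_comp (fun i : {i // i ≠ b} => g i)
    rw [hr]
    rintro _ ⟨i, rfl⟩
    by_cases hi : i = b
    · rw [hi]; exact hgb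
    · exact Submodule.subset_span ⟨⟨i, hi⟩, rfl⟩

end Module

end Bigraded

/-! ### Minimal bigraded resolutions and the nonvanishing Tor groups they exhibit -/

section Chain
variable {K : Type*} {R : Type u} [Field K] [CommRing R] [Algebra K R]

/-- A minimal complex of bigraded free modules that is exact in positive homological degrees,
given by the columns of its matrices. -/
structure MinimalChain (𝓡 : ℤ × ℤ → Submodule K R) where
  rank : ℕ → ℕ
  deg : ∀ i, Fin (rank i) → ℤ × ℤ
  g : ∀ i, Fin (rank (i + 1)) → (Fin (rank i) → R)
  g_mem : ∀ i b, g i b ∈ biFree 𝓡 (deg i) (deg (i + 1) b)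
  exact : ∀ i, LinearMap.ker (Fintype.linearCombination R (g i)) =
    LinearMap.range (Fintype.linearCombination R (g (i + 1)))
  mem_irrelevant : ∀ i b c, g i b c ∈ irrelevant (totalComp 𝓡)

/-- A homogeneous submodule of a graded free module `F` that is contained in `R₊F`. -/
structure SyzygyData (𝓡 : ℤ × ℤ → Submodule K R) where
  r : ℕ
  deg : Fin r → ℤ × ℤ
  Z : Submodule R (Fin r → R)
  hom : IsHomogeneousSub (biFree 𝓡 deg) Z
  mem_irrelevant : ∀ z ∈ Z, ∀ b, z b ∈ irrelevant (totalComp 𝓡)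

variable {𝓡 : ℤ × ℤ → Submodule K R}

theorem SyzygyData.exists_next [IsNoetherianRing R] (h : IsBigraded 𝓡) (s : SyzygyData 𝓡) :
    ∃ (t : SyzygyData 𝓡) (g : Fin t.r → (Fin s.r → R)),
      (∀ b, g b ∈ biFree 𝓡 s.deg (t.deg b)) ∧
      LinearMap.range (Fintype.linearCombination R g) = s.Z ∧
      LinearMap.ker (Fintype.linearCombination R g) = t.Z := by
  obtain ⟨r, deg, g, hg, hr, hi⟩ := s.hom.exists_minimal_generators h
    (h.biStable_biFree s.deg) (h.indep_biFree s.deg) (IsNoetherian.noetherian _)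
  exact ⟨⟨r, deg, LinearMap.ker (Fintype.linearCombination R g),
    isHomogeneousSub_ker (h.iSup_biFree deg) (h.indep_biFree s.deg) _
      (linearCombination_mem (h.biStable_biFree s.deg) hg), hi⟩, g, hg, hr, rfl⟩

theorem linearCombination_single_one {M : Type*} [AddCommGroup M] [Module R M] {r : ℕ}
    (g : Fin r → M) (b : Fin r) :
    Fintype.linearCombination R g (Pi.single b 1) = g b := by
  simp [Fintype.linearCombination_apply_single]

theorem single_mem_freeComp {𝒜 : ℤ → Submodule K R} (h1 : 1 ∈ 𝒜 0) {r : ℕ} (deg : Fin r → ℤ)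
    (b : Fin r) : Pi.single b 1 ∈ freeComp 𝒜 deg (deg b) := fun c _ => by
  by_cases hc : c = b
  · subst hc
    simpa using h1
  · simp [Pi.single_eq_of_ne hc]

section
variable [IsNoetherianRing R] (h : IsBigraded 𝓡) (s : SyzygyData 𝓡)

/-- The module of syzygies. -/
noncomputable def SyzygyData.next : SyzygyData 𝓡 := (s.exists_next h).choose

/-- A minimal system of generators. -/
noncomputable def SyzygyData.gen : Fin (s.next h).r → (Fin s.r → R) :=
  (s.exists_next h).choose_spec.choose

/-- The iterated modules of syzygies. -/
noncomputable def SyzygyData.iter : ℕ → SyzygyData 𝓡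
  | 0 => s
  | i + 1 => (iter i).next h

theorem SyzygyData.gen_mem (b) : s.gen h b ∈ biFree 𝓡 s.deg ((s.next h).deg b) :=
  (s.exists_next h).choose_spec.choose_spec.1 b

theorem SyzygyData.range_gen : LinearMap.range (Fintype.linearCombination R (s.gen h)) = s.Z :=
  (s.exists_next h).choose_spec.choose_spec.2.1

theorem SyzygyData.ker_gen :
    LinearMap.ker (Fintype.linearCombination R (s.gen h)) = (s.next h).Z :=
  (s.exists_next h).choose_spec.choose_spec.2.2

/-- The minimal resolution starting from a submodule of a graded free module. -/
noncomputable def SyzygyData.chain : MinimalChain 𝓡 where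
  rank i := (s.iter h i).r
  deg i := (s.iter h i).deg
  g i := (s.iter h i).gen h
  g_mem i := (s.iter h i).gen_mem h
  exact i := ((s.iter h i).ker_gen h).trans ((s.iter h (i + 1)).range_gen h).symm
  mem_irrelevant i b c := (s.iter h i).mem_irrelevant _ (by
    rw [← (s.iter h i).range_gen h]
    exact ⟨Pi.single b 1, linearCombination_single_one _ b⟩) c

end

theorem exists_minimalChain_of_module [IsNoetherianRing R] (h : IsBigraded 𝓡) {M : Type*}
    [AddCommGroup M] [Module K M] [Module R M] [IsScalarTower K R M] [Module.Finite R M]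
    {𝓜 : ℤ × ℤ → Submodule K M} (hst : BiStable 𝓡 𝓜) (hind : iSupIndep 𝓜)
    (htop : ⨆ d, 𝓜 d = ⊤) :
    ∃ (X : MinimalChain 𝓡) (g : Fin (X.rank 0) → M), (∀ b, g b ∈ 𝓜 (X.deg 0 b)) ∧
      LinearMap.range (Fintype.linearCombination R g) = ⊤ ∧
      LinearMap.ker (Fintype.linearCombination R g) =
        LinearMap.range (Fintype.linearCombination R (X.g 0)) := by
  obtain ⟨r, deg, g, hg, hr, hi⟩ := (isHomogeneousSub_top htop).exists_minimal_generators h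
    hst hind Module.Finite.fg_top
  let s : SyzygyData 𝓡 := ⟨r, deg, LinearMap.ker (Fintype.linearCombination R g),
    isHomogeneousSub_ker (h.iSup_biFree deg) hind _ (linearCombination_mem hst hg), hi⟩
  exact ⟨s.chain h, g, hg, hr, (s.range_gen h).symm⟩

/-- The resolution of `R/I`: the ideal is placed in the free module of rank one on a generator of
degree `0`, and `I ≤ R₊` makes the complex minimal from the first differential on. -/
theorem exists_minimalChain_of_ideal [IsNoetherianRing R] (h : IsBigraded 𝓡) {I : Ideal R}
    (hI : IsHomogeneousSub 𝓡 I) (hi : I ≤ irrelevant (totalComp 𝓡)) :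
    ∃ (X : MinimalChain 𝓡) (b₀ : Fin (X.rank 0)), (∀ b, b = b₀) ∧ X.deg 0 b₀ = 0 ∧
      ∀ z, z ∈ LinearMap.range (Fintype.linearCombination R (X.g 0)) ↔ z b₀ ∈ I := by
  let s : SyzygyData 𝓡 := ⟨1, fun _ => 0, Submodule.comap (LinearMap.proj 0) I, fun z hz => by
    let f : R →ₗ[R] (Fin 1 → R) := LinearMap.pi fun _ : Fin 1 => LinearMap.id
    have h1 := Submodule.mem_map_of_mem (f := f) (hI _ hz)
    rw [Submodule.map_span] at h1
    have h2 : f ((LinearMap.proj 0 : (Fin 1 → R) →ₗ[R] R) z) = z := by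
      ext b
      rw [Subsingleton.elim b 0]
      rfl
    rw [h2] at h1
    refine Submodule.span_mono ?_ h1
    rintro _ ⟨y, ⟨hy, d, hd⟩, rfl⟩
    exact ⟨hy, d, mem_biFree.2 fun _ => by rw [sub_zero]; exact hd⟩,
    fun z hz b => hi (by rw [Subsingleton.elim b 0]; exact hz)⟩
  refine ⟨s.chain h, (0 : Fin 1), fun b => Subsingleton.elim (α := Fin 1) b 0, rfl, fun z => ?_⟩
  change z ∈ LinearMap.range (Fintype.linearCombination R (s.gen h)) ↔ _
  rw [s.range_gen h]
  rfl

theorem IsBigraded.isHomogeneousSub_posIdeal (h : IsBigraded 𝓡) (ℓ : ℤ × ℤ →+ ℤ)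
    (hℓ : ∀ d, 0 ≤ d → 0 ≤ ℓ d) : IsHomogeneousSub 𝓡 (h.posIdeal ℓ hℓ) := fun x hx => by
  have key : ∀ x ∈ ⨆ d ∈ {d | ℓ d ≠ 0}, 𝓡 d,
      x ∈ Submodule.span R {y | y ∈ h.posIdeal ℓ hℓ ∧ ∃ d, y ∈ 𝓡 d} := fun x hx => by
    induction hx using Submodule.iSup_induction' with
    | mem d x hx =>
      induction hx using Submodule.iSup_induction' with
      | mem hd x hx => exact Submodule.subset_span ⟨h.mem_posIdeal_of_mem ℓ hℓ hd hx, d, hx⟩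
      | zero => exact zero_mem _
      | add y z _ _ hy hz => exact add_mem hy hz
    | zero => exact zero_mem _
    | add y z _ _ hy hz => exact add_mem hy hz
  exact key x hx

theorem IsBigraded.posIdeal_le (h : IsBigraded 𝓡) (ℓ : ℤ × ℤ →+ ℤ)
    (hℓ : ∀ d, 0 ≤ d → 0 ≤ ℓ d) : h.posIdeal ℓ hℓ ≤ irrelevant (totalComp 𝓡) := by
  have key : (⨆ d ∈ {d | ℓ d ≠ 0}, 𝓡 d) ≤
      (irrelevant (totalComp 𝓡) : Submodule R R).restrictScalars K :=
    iSup₂_le fun d (hd : ℓ d ≠ 0) x hx => h.mem_irrelevant (fun h0 => hd (by rw [h0, map_zero])) hx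
  exact key

namespace MinimalChain
variable (X : MinimalChain 𝓡)

/-- The differentials. -/
noncomputable def d (i : ℕ) : (Fin (X.rank (i + 1)) → R) →ₗ[R] (Fin (X.rank i) → R) :=
  Fintype.linearCombination R (X.g i)

theorem exact_d (i : ℕ) : Function.Exact (X.d (i + 1)) (X.d i) :=
  LinearMap.exact_iff.2 (X.exact i)

theorem d_mem (h : IsBigraded 𝓡) (i : ℕ) (k : ℤ × ℤ) (x) (hx : x ∈ biFree 𝓡 (X.deg (i + 1)) k) :
    X.d i x ∈ biFree 𝓡 (X.deg i) k :=
  linearCombination_mem (h.biStable_biFree _) (X.g_mem i) k x hx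

theorem totalComp_biFree_le {r : ℕ} (deg : Fin r → ℤ × ℤ) (k : ℤ) :
    totalComp (biFree 𝓡 deg) k ≤ freeComp (totalComp 𝓡) (fun b => tdeg (deg b)) k := by
  rw [totalComp_eq]
  refine iSup₂_le fun d (hd : tdeg d = k) x hx b _ => ?_
  have := mem_totalComp (mem_biFree.1 hx b)
  rwa [map_sub, hd] at this

theorem d_mem_total (h : IsBigraded 𝓡) (i : ℕ) (k : ℤ) (x)
    (hx : x ∈ freeComp (totalComp 𝓡) (fun b => tdeg (X.deg (i + 1) b)) k) :
    X.d i x ∈ freeComp (totalComp 𝓡) (fun b => tdeg (X.deg i b)) k :=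
  totalComp_biFree_le _ _ (linearCombination_mem_total (h.biStable_biFree _) (X.g_mem i) k x hx)

theorem d_apply_mem (i : ℕ) (x b) : X.d i x b ∈ irrelevant (totalComp 𝓡) := by
  rw [d, Fintype.linearCombination_apply, Finset.sum_apply]
  exact sum_mem fun c _ => Ideal.mul_mem_left _ _ (X.mem_irrelevant i c b)

/-- A zero column would make a basis vector a cycle, hence a boundary, whereas boundaries have all
their coordinates in `R₊`. -/
theorem g_ne_zero [Nontrivial R] (h : IsBigraded 𝓡) (i : ℕ) (b) : X.g i b ≠ 0 := fun h0 => by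
  have h1 : X.d i (Pi.single b 1) = 0 := (linearCombination_single_one _ b).trans h0
  obtain ⟨y, hy⟩ := (X.exact_d i _).1 h1
  have := X.d_apply_mem (i + 1) y b
  rw [hy, Pi.single_eq_same] at this
  exact h.one_notMem_irrelevant this

theorem exists_deg_le [Nontrivial R] (h : IsBigraded 𝓡) (i : ℕ) (b) :
    ∃ c, X.g i b c ≠ 0 ∧ X.deg i c ≤ X.deg (i + 1) b := by
  obtain ⟨c, hc⟩ := Function.ne_iff.1 (X.g_ne_zero h i b)
  exact ⟨c, hc, sub_nonneg.1 (h.nonneg _ _ (mem_biFree.1 (X.g_mem i b) c) hc)⟩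

theorem deg_nonneg [Nontrivial R] (h : IsBigraded 𝓡) (h0 : ∀ b, 0 ≤ X.deg 0 b) (i : ℕ) (b) :
    0 ≤ X.deg i b := by
  induction i with
  | zero => exact h0 b
  | succ i ih =>
    obtain ⟨c, _, hc⟩ := X.exists_deg_le h i b
    exact (ih c).trans hc

end MinimalChain

theorem mem_smul_top {r : ℕ} {I : Ideal R} {x : Fin r → R} (hx : ∀ b, x b ∈ I) :
    x ∈ I • (⊤ : Submodule R (Fin r → R)) := by
  rw [pi_eq_sum_univ' x]
  exact sum_mem fun b _ => Submodule.smul_mem_smul (hx b) trivial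

section Module
variable {M : Type*} [AddCommGroup M] [Module K M] [Module R M] {𝓜 : ℤ × ℤ → Submodule K M}

/-- The minimal resolution of a bigraded module, graded by total degree. -/
noncomputable def MinimalChain.toResolution (X : MinimalChain 𝓡) (h : IsBigraded 𝓡)
    (hst : BiStable 𝓡 𝓜)
    (g : Fin (X.rank 0) → M) (hg : ∀ b, g b ∈ 𝓜 (X.deg 0 b))
    (hr : LinearMap.range (Fintype.linearCombination R g) = ⊤)
    (hk : LinearMap.ker (Fintype.linearCombination R g) =
        LinearMap.range (Fintype.linearCombination R (X.g 0))) :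
    GradedFreeResolution (totalComp 𝓡) (totalComp 𝓜) where
  rank := X.rank
  deg i b := tdeg (X.deg i b)
  d := X.d
  aug := Fintype.linearCombination R g
  d_mem := X.d_mem_total h
  aug_mem := linearCombination_mem_total hst hg
  aug_surjective := LinearMap.range_eq_top.1 hr
  exact_zero := LinearMap.exact_iff.2 hk
  exact_succ := X.exact_d

/-- All differentials vanish modulo `R₊`, so each basis vector is a cycle and none is a boundary. -/
theorem MinimalChain.torNeZero [Nontrivial R] (X : MinimalChain 𝓡) (h : IsBigraded 𝓡)
    (hst : BiStable 𝓡 𝓜) (g : Fin (X.rank 0) → M) (hg : ∀ b, g b ∈ 𝓜 (X.deg 0 b))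
    (hr : LinearMap.range (Fintype.linearCombination R g) = ⊤)
    (hk : LinearMap.ker (Fintype.linearCombination R g) =
        LinearMap.range (Fintype.linearCombination R (X.g 0))) (i : ℕ) (b : Fin (X.rank i)) :
    TorNeZero (totalComp 𝓡) (totalComp 𝓜) i (tdeg (X.deg i b)) := by
  refine ⟨X.toResolution h hst g hg hr hk, Pi.single b 1, ?_, ?_, fun hb => ?_⟩
  · exact single_mem_freeComp (mem_totalComp h.one_mem) (fun b => tdeg (X.deg i b)) b
  · cases i with
    | zero => exact Submodule.mem_top
    | succ i => exact mem_smul_top fun c => X.d_apply_mem i _ c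
  · rw [GradedFreeResolution.boundaries, Submodule.mem_sup] at hb
    obtain ⟨y, hy, _, ⟨z, rfl⟩, hyz⟩ := hb
    have h1 := add_mem (mem_of_mem_irrelevant_smul hy b) (X.d_apply_mem i z b)
    have h2 : y b + X.d i z b = 1 := (congr_fun hyz b).trans (Pi.single_eq_same b 1)
    rw [h2] at h1
    exact h.one_notMem_irrelevant h1

end Module

end Chain

/-- Dependent choice with types varying along the sequence. It builds a preimage in the total
complex column by column. -/
theorem exists_dependent_seq {α : ℕ → Type*} (rel : ∀ i, α i → α (i + 1) → Prop) (a₀ : α 0)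
    (h₀ : ∃ b, rel 0 a₀ b) (step : ∀ i a b, rel i a b → ∃ c, rel (i + 1) b c) :
    ∃ u : ∀ i, α i, ∀ i, rel i (u i) (u (i + 1)) := by
  let next : ∀ i, {a : α i // ∃ b, rel i a b} → {a : α (i + 1) // ∃ b, rel (i + 1) a b} :=
    fun i a => ⟨a.2.choose, step i a.1 _ a.2.choose_spec⟩
  let s : ∀ i, {a : α i // ∃ b, rel i a b} := fun i => Nat.rec ⟨a₀, h₀⟩ next i
  exact ⟨fun i => (s i).1, fun i => (s i).2.choose_spec⟩

section Tensor
variable {K : Type*} {R : Type u} [Field K] [CommRing R] [Algebra K R]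
  {𝓡 : ℤ × ℤ → Submodule K R}

/-! ### The part of `ℓ`-degree zero of a resolution -/

/-- The basis elements of `ℓ`-degree `0`. -/
abbrev MinimalChain.Idx (G : MinimalChain 𝓡) (ℓ : ℤ × ℤ →+ ℤ) (j : ℕ) : Type :=
  {b : Fin (G.rank j) // ℓ (G.deg j b) = 0}

/-- The differential between the basis elements of `ℓ`-degree `0`. -/
noncomputable def MinimalChain.dIdx (G : MinimalChain 𝓡) (ℓ : ℤ × ℤ →+ ℤ) (j : ℕ) :
    (G.Idx ℓ (j + 1) → R) →ₗ[R] (G.Idx ℓ j → R) :=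
  Fintype.linearCombination R fun b' b => G.g j b' b

theorem MinimalChain.dIdx_apply (G : MinimalChain 𝓡) (ℓ : ℤ × ℤ →+ ℤ) (j : ℕ)
    (v : G.Idx ℓ (j + 1) → R) (b : G.Idx ℓ j) :
    G.dIdx ℓ j v b = ∑ b', v b' * G.g j b' b := by
  simp [dIdx, Fintype.linearCombination_apply, Finset.sum_apply]

theorem MinimalChain.d_apply (X : MinimalChain 𝓡) (i : ℕ) (v : Fin (X.rank (i + 1)) → R)
    (a : Fin (X.rank i)) : X.d i v a = ∑ a', v a' * X.g i a' a := by
  simp [d, Fintype.linearCombination_apply, Finset.sum_apply]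

section
variable (G : MinimalChain 𝓡)

/-- Matrix entries from a basis element of nonzero `ℓ`-degree to one of `ℓ`-degree zero have nonzero
`ℓ`-degree, so they vanish modulo the ideal. -/
theorem MinimalChain.d_sub_dIdx_mem (h : IsBigraded 𝓡) (ℓ : ℤ × ℤ →+ ℤ) (hℓ : ∀ d, 0 ≤ d → 0 ≤ ℓ d)
    (j : ℕ) (w : Fin (G.rank (j + 1)) → R)
    (b : G.Idx ℓ j) : G.d j w b - G.dIdx ℓ j (fun b' => w b') b ∈ h.posIdeal ℓ hℓ := by
  classical
  rw [d_apply, dIdx_apply, ← Fintype.sum_subtype_add_sum_subtype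
    (fun b' => ℓ (G.deg (j + 1) b') = 0), add_sub_cancel_left]
  refine sum_mem fun b' _ => Ideal.mul_mem_left _ _ (h.mem_posIdeal_of_mem ℓ hℓ ?_
    (mem_biFree.1 (G.g_mem j b') b))
  rw [map_sub, b.2, sub_zero]
  exact b'.2

/-- Such an entry would have negative `ℓ`-degree. Hence the basis elements of `ℓ`-degree zero span a
subcomplex. -/
theorem MinimalChain.g_eq_zero (h : IsBigraded 𝓡) (ℓ : ℤ × ℤ →+ ℤ) (hℓ : ∀ d, 0 ≤ d → 0 ≤ ℓ d)
    (hG : ∀ i b, 0 ≤ G.deg i b) (j : ℕ) (b' : G.Idx ℓ (j + 1))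
    (b : Fin (G.rank j)) (hb : ℓ (G.deg j b) ≠ 0) : G.g j b' b = 0 := by
  by_contra h0
  have h1 := hℓ _ (h.nonneg _ _ (mem_biFree.1 (G.g_mem j b') b) h0)
  rw [map_sub, b'.2] at h1
  have h2 := hℓ _ (hG j b)
  omega

theorem MinimalChain.d_extend (h : IsBigraded 𝓡) (ℓ : ℤ × ℤ →+ ℤ) (hℓ : ∀ d, 0 ≤ d → 0 ≤ ℓ d)
    (hG : ∀ i b, 0 ≤ G.deg i b) (j : ℕ) (v : G.Idx ℓ (j + 1) → R)
    (w : Fin (G.rank (j + 1)) → R) (hw : ∀ b : G.Idx ℓ (j + 1), w b = v b)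
    (hw' : ∀ b, ℓ (G.deg (j + 1) b) ≠ 0 → w b = 0) :
    (∀ b : G.Idx ℓ j, G.d j w b = G.dIdx ℓ j v b) ∧
      ∀ b, ℓ (G.deg j b) ≠ 0 → G.d j w b = 0 := by
  classical
  have key : ∀ b, G.d j w b = ∑ b' : G.Idx ℓ (j + 1), v b' * G.g j b' b := fun b => by
    rw [d_apply, ← Fintype.sum_subtype_add_sum_subtype (fun b' => ℓ (G.deg (j + 1) b') = 0)]
    simp only [hw]
    rw [add_eq_left]
    exact Finset.sum_eq_zero fun b' _ => by rw [hw' _ b'.2, zero_mul]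
  refine ⟨fun b => by rw [key, dIdx_apply], fun b hb => ?_⟩
  rw [key]
  exact Finset.sum_eq_zero fun b' _ => by rw [G.g_eq_zero h ℓ hℓ hG j b' b hb, mul_zero]

theorem exists_extend (ℓ : ℤ × ℤ →+ ℤ) (j : ℕ) (v : G.Idx ℓ j → R) :
    ∃ w : Fin (G.rank j) → R, (∀ b : G.Idx ℓ j, w b = v b) ∧
      ∀ b, ℓ (G.deg j b) ≠ 0 → w b = 0 := by
  classical
  exact ⟨fun b => if hb : ℓ (G.deg j b) = 0 then v ⟨b, hb⟩ else 0, fun b => by simp [b.2],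
    fun b hb => by simp [hb]⟩

theorem MinimalChain.dIdx_dIdx (h : IsBigraded 𝓡) (ℓ : ℤ × ℤ →+ ℤ) (hℓ : ∀ d, 0 ≤ d → 0 ≤ ℓ d)
    (hG : ∀ i b, 0 ≤ G.deg i b) (j : ℕ) (v : G.Idx ℓ (j + 2) → R) :
    G.dIdx ℓ j (G.dIdx ℓ (j + 1) v) = 0 := by
  obtain ⟨w, hw, hw'⟩ := exists_extend G ℓ _ v
  have h1 := G.d_extend h ℓ hℓ hG _ v w hw hw'
  have h2 := G.d_extend h ℓ hℓ hG _ _ _ h1.1 h1.2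
  ext b
  rw [← h2.1, (G.exact_d j).apply_apply_eq_zero]
  rfl

/-- Exactness of `Y` modulo the ideal, in positive homological degrees. The `ℓ`-degree zero part of
`v` is a genuine cycle, because its differential has `ℓ`-degree zero and lies in the ideal. Extended
by zero it bounds in `G`, and the coordinates of `ℓ`-degree zero of the preimage suffice modulo the
ideal. -/
theorem MinimalChain.exists_dIdx_sub_mem (h : IsBigraded 𝓡) (ℓ : ℤ × ℤ →+ ℤ) (hℓ : ∀ d, 0 ≤ d → 0 ≤ ℓ d)
    (hG : ∀ i b, 0 ≤ G.deg i b) (j : ℕ)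
    (v : G.Idx ℓ (j + 1) → R) (hv : ∀ b, G.dIdx ℓ j v b ∈ h.posIdeal ℓ hℓ) :
    ∃ w, ∀ b, v b - G.dIdx ℓ (j + 1) w b ∈ h.posIdeal ℓ hℓ := by
  choose v₀ hv₀ hv₀' using fun b => h.exists_sub_mem_posIdeal ℓ hℓ (v b)
  have h1 : G.dIdx ℓ j v₀ = 0 := by
    ext b
    refine h.eq_zero_of_mem_posIdeal ℓ hℓ ?_ ?_
    · rw [dIdx_apply]
      refine sum_mem fun b' _ => h.biStable.biSup (S := {d | ℓ d = 0}) (T := {d | ℓ d = 0})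
        (fun s (hs : ℓ s = 0) t (ht : ℓ t = 0) => ?_) (hv₀ b') ?_
      · change ℓ (s + t) = 0
        rw [map_add, hs, ht, add_zero]
      · refine Submodule.mem_iSup_of_mem _ (Submodule.mem_iSup_of_mem ?_
          (mem_biFree.1 (G.g_mem j b') b))
        change ℓ _ = 0
        rw [map_sub, b.2, b'.2, sub_zero]
    · have h2 := sub_mem (hv b) (show G.dIdx ℓ j (v - v₀) b ∈ h.posIdeal ℓ hℓ from ?_)
      · rwa [map_sub, Pi.sub_apply, sub_sub_cancel] at h2
      · rw [dIdx_apply]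
        exact sum_mem fun b' _ => Ideal.mul_mem_right _ _ (hv₀' b')
  obtain ⟨w, hw, hw'⟩ := exists_extend G ℓ _ v₀
  have h2 := G.d_extend h ℓ hℓ hG _ v₀ w hw hw'
  have h3 : G.d j w = 0 := by
    ext b
    by_cases hb : ℓ (G.deg j b) = 0
    · rw [h2.1 ⟨b, hb⟩, h1]
      rfl
    · exact h2.2 b hb
  obtain ⟨u, rfl⟩ := (G.exact_d j _).1 h3
  refine ⟨fun b => u b, fun b => ?_⟩
  have h4 := add_mem (hv₀' b) (G.d_sub_dIdx_mem h ℓ hℓ (j + 1) u b)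
  rwa [hw, sub_add_sub_cancel] at h4

end

/-! ### The tensor product of two resolutions -/

section
variable (X G : MinimalChain 𝓡) (ℓ : ℤ × ℤ →+ ℤ)

/-- The differential in the direction of `X`. -/
noncomputable def dX (i j : ℕ) :
    (Fin (X.rank (i + 1)) → G.Idx ℓ j → R) →ₗ[R] (Fin (X.rank i) → G.Idx ℓ j → R) where
  toFun c a b := X.d i (fun a' => c a' b) a
  map_add' c c' := by
    ext a b
    exact congr_fun (map_add (X.d i) (fun a' => c a' b) fun a' => c' a' b) a
  map_smul' r c := by
    ext a b
    exact congr_fun (map_smul (X.d i) r fun a' => c a' b) a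

/-- The differential in the direction of the part of `ℓ`-degree zero of `G`. -/
noncomputable def dY (i j : ℕ) :
    (Fin (X.rank i) → G.Idx ℓ (j + 1) → R) →ₗ[R] (Fin (X.rank i) → G.Idx ℓ j → R) :=
  (G.dIdx ℓ j).compLeft _

theorem dX_apply (i j : ℕ) (c : Fin (X.rank (i + 1)) → G.Idx ℓ j → R) (a b) :
    dX X G ℓ i j c a b = ∑ a', c a' b * X.g i a' a := X.d_apply i _ a

theorem dY_apply (i j : ℕ) (c : Fin (X.rank i) → G.Idx ℓ (j + 1) → R) (a b) :
    dY X G ℓ i j c a b = ∑ b', c a b' * G.g j b' b := G.dIdx_apply ℓ j _ b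

theorem dX_dY (i j : ℕ) (c : Fin (X.rank (i + 1)) → G.Idx ℓ (j + 1) → R) :
    dX X G ℓ i j (dY X G ℓ (i + 1) j c) = dY X G ℓ i j (dX X G ℓ i (j + 1) c) := by
  ext a b
  simp only [dX_apply, dY_apply, Finset.sum_mul]
  rw [Finset.sum_comm]
  exact Finset.sum_congr rfl fun _ _ => Finset.sum_congr rfl fun _ _ => mul_right_comm _ _ _

theorem dX_dX (i j : ℕ) (c : Fin (X.rank (i + 2)) → G.Idx ℓ j → R) :
    dX X G ℓ i j (dX X G ℓ (i + 1) j c) = 0 := by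
  ext a b
  exact congr_fun ((X.exact_d i).apply_apply_eq_zero _) a

theorem exists_dX_eq (i j : ℕ) (c : Fin (X.rank (i + 1)) → G.Idx ℓ j → R)
    (hc : dX X G ℓ i j c = 0) : ∃ w, dX X G ℓ (i + 1) j w = c := by
  have h1 : ∀ b, ∃ w, X.d (i + 1) w = fun a => c a b := fun b =>
    (X.exact_d i _).1 (funext fun a => congr_fun (congr_fun hc a) b)
  choose w hw using h1
  exact ⟨fun a b => w b a, funext fun a => funext fun b => congr_fun (hw b) a⟩

/-- Families of elements of all the modules `X_i ⊗ Y_j`. -/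
abbrev Fam : Type u := ∀ i j, Fin (X.rank i) → G.Idx ℓ j → R

/-- The differential of the total complex. -/
noncomputable def totalD : Fam X G ℓ →ₗ[R] Fam X G ℓ :=
  LinearMap.pi fun i => LinearMap.pi fun j =>
    dX X G ℓ i j ∘ₗ LinearMap.proj j ∘ₗ LinearMap.proj (i + 1) +
      (-1 : R) ^ i • (dY X G ℓ i j ∘ₗ LinearMap.proj (j + 1) ∘ₗ LinearMap.proj i)

theorem totalD_apply (c : Fam X G ℓ) (i j : ℕ) :
    totalD X G ℓ c i j = dX X G ℓ i j (c (i + 1) j) + (-1 : R) ^ i • dY X G ℓ i j (c i (j + 1)) :=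
  rfl

theorem totalD_totalD (h : IsBigraded 𝓡) (hℓ : ∀ d, 0 ≤ d → 0 ≤ ℓ d)
    (hG : ∀ i b, 0 ≤ G.deg i b) (c : Fam X G ℓ) :
    totalD X G ℓ (totalD X G ℓ c) = 0 := by
  have hY : ∀ i j c, dY X G ℓ i j (dY X G ℓ i (j + 1) c) = 0 := fun i j c =>
    funext fun a => G.dIdx_dIdx h ℓ hℓ hG j (c a)
  funext i j
  rw [totalD_apply, totalD_apply, totalD_apply]
  simp only [map_add, map_smul, dX_dX, hY, dX_dY, smul_zero, add_zero, zero_add]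
  rw [← add_smul, pow_succ]
  simp

/-- The total complex is exact. -/
theorem exists_totalD_eq (h : IsBigraded 𝓡) (hℓ : ∀ d, 0 ≤ d → 0 ≤ ℓ d)
    (hG : ∀ i b, 0 ≤ G.deg i b) {b₀ : Fin (X.rank 0)}
    (hX : ∀ z, z ∈ LinearMap.range (Fintype.linearCombination R (X.g 0)) ↔
      z b₀ ∈ h.posIdeal ℓ hℓ) {c₀ : Fin (G.rank 0)} (hc₀ : ∀ b, b = c₀)
    (hG' : ∀ z, z ∈ LinearMap.range (Fintype.linearCombination R (G.g 0)) ↔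
      z c₀ ∈ irrelevant (totalComp 𝓡)) (c : Fam X G ℓ) (hc : totalD X G ℓ c = 0)
    (hc' : ∀ b, c 0 0 b₀ b ∈ irrelevant (totalComp 𝓡)) :
    ∃ w, totalD X G ℓ w = c := by
  -- In column `0` the equation is first solved modulo the ideal. For `j = 0` this uses that `G`
  -- resolves the residue field; for `j > 0` the cycle condition says that `dY` of the entry lies in
  -- the image of `dX`, hence in the ideal.
  have hstart : ∀ j, ∃ w : G.Idx ℓ (j + 1) → R,
      ∀ b, c 0 j b₀ b - G.dIdx ℓ j w b ∈ h.posIdeal ℓ hℓ := fun j => by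
    cases j with
    | zero =>
      by_cases hℓ0 : ℓ (G.deg 0 c₀) = 0
      · obtain ⟨w, hw⟩ := (hG' fun _ => c 0 0 b₀ ⟨c₀, hℓ0⟩).2 (hc' _)
        refine ⟨fun b => w b, fun b => ?_⟩
        have h1 := G.d_sub_dIdx_mem h ℓ hℓ 0 w b
        rw [show G.d 0 w = _ from hw] at h1
        rwa [show b = ⟨c₀, hℓ0⟩ from Subtype.ext (hc₀ _)] at h1 ⊢
      · exact ⟨0, fun b => absurd (by rw [← hc₀ b.1]; exact b.2) hℓ0⟩
    | succ j =>
      refine G.exists_dIdx_sub_mem h ℓ hℓ hG j _ fun b => ?_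
      have h1 := congr_fun (congr_fun (congr_fun (congr_fun hc 0) j) b₀) b
      rw [totalD_apply, pow_zero, one_smul] at h1
      have h2 : dY X G ℓ 0 j (c 0 (j + 1)) b₀ b = - dX X G ℓ 0 j (c 1 j) b₀ b :=
        eq_neg_of_add_eq_zero_right h1
      change dY X G ℓ 0 j (c 0 (j + 1)) b₀ b ∈ _
      rw [h2]
      exact neg_mem ((hX _).1 ⟨_, rfl⟩)
  choose w₀ hw₀ using hstart
  -- The equation in column `i` of the total complex involves only the columns `i` and `i + 1` of
  -- the preimage.
  let rel : ∀ i, (∀ j, Fin (X.rank i) → G.Idx ℓ j → R) →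
      (∀ j, Fin (X.rank (i + 1)) → G.Idx ℓ j → R) → Prop := fun i u u' =>
    ∀ j, dX X G ℓ i j (u' j) + (-1 : R) ^ i • dY X G ℓ i j (u (j + 1)) = c i j
  obtain ⟨u, hu⟩ := exists_dependent_seq rel
    -- The entry at `(0,0)` does not occur in any equation and is set to `0`. The remaining error in
    -- column `0` lies in the ideal, which is the image of the first differential of `X`.
    (fun j => match j with
      | 0 => 0
      | j + 1 => fun _ => w₀ j) (by
    have h1 : ∀ j b, ∃ v, X.d 0 v = fun a => c 0 j a b - G.dIdx ℓ j (w₀ j) b := fun j b =>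
      (hX _).2 (hw₀ j b)
    choose v hv using h1
    refine ⟨fun j a b => v j b a, fun j => ?_⟩
    funext a b
    rw [pow_zero, one_smul]
    change X.d 0 (v j b) a + G.dIdx ℓ j (w₀ j) b = _
    rw [hv, sub_add_cancel]) (fun i u u' huu => by
    -- The part of the next column still to be matched is a `dX`-cycle, by the cycle condition on
    -- `c` and the equation in column `i`; exactness of `X` provides the new column.
    have h1 : ∀ j, dX X G ℓ i j (c (i + 1) j - (-1 : R) ^ (i + 1) •
        dY X G ℓ (i + 1) j (u' (j + 1))) = 0 := fun j => by
      have h2 := congr_fun (congr_fun hc i) j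
      have hY : dY X G ℓ i j (dY X G ℓ i (j + 1) (u (j + 2))) = 0 :=
        funext fun a => G.dIdx_dIdx h ℓ hℓ hG j _
      rw [totalD_apply, ← huu (j + 1), map_add, map_smul, hY, smul_zero, add_zero, ← dX_dY] at h2
      rw [map_sub, map_smul, pow_succ, mul_neg_one, neg_smul, sub_neg_eq_add]
      exact h2
    choose v hv using fun j => exists_dX_eq X G ℓ i j _ (h1 j)
    exact ⟨v, fun j => by rw [hv, sub_add_cancel]⟩)
  exact ⟨u, funext fun i => funext fun j => hu i j⟩

end

end Tensor

/-! ### The total complex as a finite rank minimal resolution of the residue class field -/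

section Tensor
variable {K : Type*} {R : Type u} [Field K] [CommRing R] [Algebra K R]
  {𝓡 : ℤ × ℤ → Submodule K R}

theorem IsBigraded.totalComp_mul (h : IsBigraded 𝓡) {i j : ℤ} {x y : R} (hx : x ∈ totalComp 𝓡 i)
    (hy : y ∈ totalComp 𝓡 j) : x * y ∈ totalComp 𝓡 (i + j) :=
  h.biStable.totalComp hx hy

theorem IsBigraded.totalComp_le (h : IsBigraded 𝓡) {j : ℤ} (hj : j ≠ 0) {x : R}
    (hx : x ∈ totalComp 𝓡 j) : x ∈ irrelevant (totalComp 𝓡) := by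
  rw [totalComp_eq] at hx
  have : (⨆ d ∈ {d | tdeg d = j}, 𝓡 d) ≤
      (irrelevant (totalComp 𝓡) : Submodule R R).restrictScalars K :=
    iSup₂_le fun d (hd : tdeg d = j) x hx => h.mem_irrelevant (fun h0 => hj (by
      rw [← hd, h0, map_zero])) hx
  exact this hx

theorem MinimalChain.g_mem_total (X : MinimalChain 𝓡) (i : ℕ) (b c) :
    X.g i b c ∈ totalComp 𝓡 (tdeg (X.deg (i + 1) b) - tdeg (X.deg i c)) := by
  rw [← map_sub]
  exact mem_totalComp (mem_biFree.1 (X.g_mem i b) c)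

variable (X G : MinimalChain 𝓡) (ℓ : ℤ × ℤ →+ ℤ)

/-- The basis of the total complex in homological degree `k`. -/
abbrev TotIdx (k : ℕ) : Type :=
  Σ p : Finset.HasAntidiagonal.antidiagonal k, Fin (X.rank p.1.1) × G.Idx ℓ p.1.2

/-- The extension of an element of the total complex by zero. -/
def extendFam (k : ℕ) : (TotIdx X G ℓ k → R) →ₗ[R] Fam X G ℓ where
  toFun v i j a b := if hij : i + j = k then v ⟨⟨(i, j), Finset.HasAntidiagonal.mem_antidiagonal.2 hij⟩, a, b⟩ else 0
  map_add' v w := by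
    funext i j a b
    by_cases hij : i + j = k <;> simp [hij]
  map_smul' r v := by
    funext i j a b
    by_cases hij : i + j = k <;> simp [hij]

/-- The component of a family in homological degree `k`. -/
def restrictFam (k : ℕ) : Fam X G ℓ →ₗ[R] (TotIdx X G ℓ k → R) where
  toFun c t := c t.1.1.1 t.1.1.2 t.2.1 t.2.2
  map_add' _ _ := rfl
  map_smul' _ _ := rfl

theorem restrictFam_extendFam (k : ℕ) (v : TotIdx X G ℓ k → R) :
    restrictFam X G ℓ k (extendFam X G ℓ k v) = v := by
  funext ⟨⟨⟨i, j⟩, hij⟩, a, b⟩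
  simp [restrictFam, extendFam, Finset.HasAntidiagonal.mem_antidiagonal.1 hij]

theorem extendFam_restrictFam_apply (k : ℕ) (c : Fam X G ℓ) {i j : ℕ} (hij : i + j = k) :
    extendFam X G ℓ k (restrictFam X G ℓ k c) i j = c i j := by
  funext a b
  simp [restrictFam, extendFam, hij]

theorem extendFam_apply_of_ne (k : ℕ) (v : TotIdx X G ℓ k → R) {i j : ℕ} (hij : i + j ≠ k) :
    extendFam X G ℓ k v i j = 0 := by
  funext a b
  simp [extendFam, hij]

theorem totalD_extendFam_restrictFam (k : ℕ) (c : Fam X G ℓ) :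
    totalD X G ℓ (extendFam X G ℓ (k + 1) (restrictFam X G ℓ (k + 1) c)) =
      extendFam X G ℓ k (restrictFam X G ℓ k (totalD X G ℓ c)) := by
  funext i j
  by_cases hij : i + j = k
  · rw [extendFam_restrictFam_apply _ _ _ _ _ hij, totalD_apply, totalD_apply,
      extendFam_restrictFam_apply _ _ _ _ _ (by omega),
      extendFam_restrictFam_apply _ _ _ _ _ (by omega)]
  · rw [extendFam_apply_of_ne _ _ _ _ _ hij, totalD_apply,
      extendFam_apply_of_ne _ _ _ _ _ (by omega), extendFam_apply_of_ne _ _ _ _ _ (by omega),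
      map_zero, map_zero, smul_zero, add_zero]

/-- The differential of the total complex in homological degree `k`. -/
noncomputable def totD (k : ℕ) : (TotIdx X G ℓ (k + 1) → R) →ₗ[R] (TotIdx X G ℓ k → R) :=
  restrictFam X G ℓ k ∘ₗ totalD X G ℓ ∘ₗ extendFam X G ℓ (k + 1)

theorem extendFam_totD (k : ℕ) (v : TotIdx X G ℓ (k + 1) → R) :
    extendFam X G ℓ k (totD X G ℓ k v) = totalD X G ℓ (extendFam X G ℓ (k + 1) v) := by
  have := totalD_extendFam_restrictFam X G ℓ k (extendFam X G ℓ (k + 1) v)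
  rw [restrictFam_extendFam] at this
  exact this.symm

/-- The total degree of a basis element of the total complex. -/
def totDeg (k : ℕ) (t : TotIdx X G ℓ k) : ℤ :=
  tdeg (X.deg _ t.2.1) + tdeg (G.deg _ t.2.2.1)

theorem totalD_mem (h : IsBigraded 𝓡) (n : ℤ) (c : Fam X G ℓ)
    (hc : ∀ i j a b, c i j a b ∈ totalComp 𝓡 (n - (tdeg (X.deg i a) + tdeg (G.deg j b.1))))
    (i j : ℕ) (a) (b) : totalD X G ℓ c i j a b ∈
      totalComp 𝓡 (n - (tdeg (X.deg i a) + tdeg (G.deg j b.1))) := by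
  rw [totalD_apply]
  have hs : ∀ x ∈ totalComp 𝓡 (n - (tdeg (X.deg i a) + tdeg (G.deg j b.1))),
      (-1 : R) ^ i * x ∈ totalComp 𝓡 (n - (tdeg (X.deg i a) + tdeg (G.deg j b.1))) :=
    fun x hx => by
      rcases neg_one_pow_eq_or R i with h1 | h1 <;> simpa [h1] using hx
  refine add_mem ?_ (hs _ ?_)
  · rw [dX_apply]
    refine sum_mem fun a' _ => ?_
    have := h.totalComp_mul (hc (i + 1) j a' b) (X.g_mem_total i a' a)
    convert! this using 2
    ring
  · rw [dY_apply]
    refine sum_mem fun b' _ => ?_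
    have := h.totalComp_mul (hc i (j + 1) a b') (G.g_mem_total j b' b)
    convert! this using 2
    ring

theorem totalD_mem_irrelevant (c : Fam X G ℓ) (i j : ℕ) (a b) :
    totalD X G ℓ c i j a b ∈ irrelevant (totalComp 𝓡) := by
  rw [totalD_apply]
  refine add_mem ?_ (Ideal.mul_mem_left _ _ ?_)
  · rw [dX_apply]
    exact sum_mem fun a' _ => Ideal.mul_mem_left _ _ (X.mem_irrelevant _ _ _)
  · rw [dY_apply]
    exact sum_mem fun a' _ => Ideal.mul_mem_left _ _ (G.mem_irrelevant _ _ _)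

/-- The conditions under which `X` resolves the residue class ring of the ideal of elements
without components of `ℓ`-degree `0` and `G` resolves the residue class field. -/
structure IsTensorPair (h : IsBigraded 𝓡) (hℓ : ∀ d, 0 ≤ d → 0 ≤ ℓ d) (b₀ : Fin (X.rank 0))
    (c₀ : Fin (G.rank 0)) : Prop where
  eq_b₀ : ∀ b, b = b₀
  deg_b₀ : X.deg 0 b₀ = 0
  range_X : ∀ z, z ∈ LinearMap.range (Fintype.linearCombination R (X.g 0)) ↔
    z b₀ ∈ h.posIdeal ℓ hℓ
  eq_c₀ : ∀ b, b = c₀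
  deg_c₀ : G.deg 0 c₀ = 0
  range_G : ∀ z, z ∈ LinearMap.range (Fintype.linearCombination R (G.g 0)) ↔
    z c₀ ∈ irrelevant (totalComp 𝓡)

variable {X G ℓ} {h : IsBigraded 𝓡} {hℓ : ∀ d, 0 ≤ d → 0 ≤ ℓ d} {b₀ : Fin (X.rank 0)}
    {c₀ : Fin (G.rank 0)}

namespace IsTensorPair
variable [Nontrivial R]

theorem deg_nonneg (p : IsTensorPair X G ℓ h hℓ b₀ c₀) (i b) : 0 ≤ G.deg i b :=
  G.deg_nonneg h (fun b => by rw [p.eq_c₀ b, p.deg_c₀]) i b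

theorem deg_c₀_eq (p : IsTensorPair X G ℓ h hℓ b₀ c₀) : ℓ (G.deg 0 c₀) = 0 := by
  rw [p.deg_c₀, map_zero]

/-- The basis element of homological degree `0`. -/
def pt (p : IsTensorPair X G ℓ h hℓ b₀ c₀) : TotIdx X G ℓ 0 :=
  ⟨⟨(0, 0), by simp⟩, b₀, ⟨c₀, p.deg_c₀_eq⟩⟩

theorem eq_pt (p : IsTensorPair X G ℓ h hℓ b₀ c₀) (t : TotIdx X G ℓ 0) : t = p.pt := by
  obtain ⟨⟨⟨i, j⟩, hij⟩, a, b, hb⟩ := t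
  have hij' := Finset.HasAntidiagonal.mem_antidiagonal.1 hij
  simp only at hij'
  obtain rfl : i = 0 := by omega
  obtain rfl : j = 0 := by omega
  simp only [pt]
  congr
  · exact p.eq_b₀ a
  · exact p.eq_c₀ b

theorem totDeg_pt (p : IsTensorPair X G ℓ h hℓ b₀ c₀) : totDeg X G ℓ 0 p.pt = 0 := by
  change tdeg (X.deg 0 b₀) + tdeg (G.deg 0 c₀) = 0
  rw [p.deg_b₀, p.deg_c₀, map_zero, add_zero]

/-- A cycle of homological degree `k + 1` has a preimage among families by `exists_totalD_eq`, where
the condition at `(0,0)` is empty; cutting that family down to degree `k + 2` is harmless because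
the differential is homogeneous. -/
theorem exact_totD (p : IsTensorPair X G ℓ h hℓ b₀ c₀) (k : ℕ) :
    Function.Exact (totD X G ℓ (k + 1)) (totD X G ℓ k) := by
  intro v
  constructor
  · intro hv
    have h1 : totalD X G ℓ (extendFam X G ℓ (k + 1) v) = 0 := by
      rw [← extendFam_totD, hv, map_zero]
    obtain ⟨w, hw⟩ := exists_totalD_eq X G ℓ h hℓ p.deg_nonneg p.range_X p.eq_c₀ p.range_G _ h1
      (fun b => by
        rw [extendFam_apply_of_ne _ _ _ _ _ (by omega)]
        exact zero_mem _)
    refine ⟨restrictFam X G ℓ (k + 2) w, ?_⟩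
    rw [totD, LinearMap.comp_apply, LinearMap.comp_apply, totalD_extendFam_restrictFam,
      restrictFam_extendFam, hw, restrictFam_extendFam]
  · rintro ⟨w, rfl⟩
    rw [totD, LinearMap.comp_apply, LinearMap.comp_apply, extendFam_totD,
      totalD_totalD X G ℓ h hℓ p.deg_nonneg, map_zero]

theorem totD_zero_eq (p : IsTensorPair X G ℓ h hℓ b₀ c₀) (v : TotIdx X G ℓ 0 → R)
    (hv : v p.pt ∈ irrelevant (totalComp 𝓡)) :
    ∃ w, totD X G ℓ 0 w = v := by
  have h1 : totalD X G ℓ (extendFam X G ℓ 0 v) = 0 := by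
    funext i j
    rw [totalD_apply, extendFam_apply_of_ne _ _ _ _ _ (by omega),
      extendFam_apply_of_ne _ _ _ _ _ (by omega), map_zero, map_zero, smul_zero, add_zero]
    rfl
  obtain ⟨w, hw⟩ := exists_totalD_eq X G ℓ h hℓ p.deg_nonneg p.range_X p.eq_c₀ p.range_G _ h1
      (fun b => by
        have : extendFam X G ℓ 0 v 0 0 b₀ b = v ⟨⟨(0, 0), by simp⟩, b₀, b⟩ := by simp [extendFam]
        rw [this, p.eq_pt ⟨⟨(0, 0), by simp⟩, b₀, b⟩]
        exact hv)
  refine ⟨restrictFam X G ℓ 1 w, ?_⟩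
  rw [totD, LinearMap.comp_apply, LinearMap.comp_apply, totalD_extendFam_restrictFam,
    restrictFam_extendFam, hw, restrictFam_extendFam]

theorem totD_apply_mem (k : ℕ) (v : TotIdx X G ℓ (k + 1) → R) (t) :
    totD X G ℓ k v t ∈ irrelevant (totalComp 𝓡) :=
  totalD_mem_irrelevant _ _ _ _ _ _ _ _

end IsTensorPair

variable (X G ℓ) in
/-- Coordinates with respect to an enumeration of the basis of the total complex. -/
noncomputable def totEquiv (k : ℕ) :
    (Fin (Fintype.card (TotIdx X G ℓ k)) → R) ≃ₗ[R] (TotIdx X G ℓ k → R) :=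
  LinearEquiv.funCongrLeft R R (Fintype.equivFin (TotIdx X G ℓ k))

/-- The total complex resolves the residue class field. -/
noncomputable def IsTensorPair.toResolution [Nontrivial R] (p : IsTensorPair X G ℓ h hℓ b₀ c₀) :
    GradedFreeResolution (totalComp 𝓡) (residueGrading (totalComp 𝓡)) where
  rank k := Fintype.card (TotIdx X G ℓ k)
  deg k b := totDeg X G ℓ k ((Fintype.equivFin _).symm b)
  d k := (totEquiv X G ℓ k).symm.toLinearMap ∘ₗ totD X G ℓ k ∘ₗ
    (totEquiv X G ℓ (k + 1)).toLinearMap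
  aug := (irrelevant (totalComp 𝓡)).mkQ ∘ₗ LinearMap.proj p.pt ∘ₗ (totEquiv X G ℓ 0).toLinearMap
  d_mem k n x hx b _ := by
    refine totalD_mem X G ℓ h n _ (fun i j a b => ?_) _ _ _ _
    by_cases hij : i + j = k + 1
    · simp only [extendFam, LinearMap.coe_mk, AddHom.coe_mk, hij, dif_pos]
      have := mem_freeFam.1 hx (Fintype.equivFin _
        (⟨⟨(i, j), Finset.HasAntidiagonal.mem_antidiagonal.2 hij⟩, a, b⟩ : TotIdx X G ℓ (k + 1)))
      simp only [Equiv.symm_apply_apply] at this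
      exact this
    · rw [extendFam_apply_of_ne _ _ _ _ _ hij]
      exact zero_mem _
  aug_mem n x hx := by
    unfold residueGrading
    split_ifs with hn
    · trivial
    · have h1 := mem_freeFam.1 hx (Fintype.equivFin _ p.pt)
      simp only [Equiv.symm_apply_apply, p.totDeg_pt, sub_zero] at h1
      rw [Submodule.mem_bot]
      exact (Submodule.Quotient.mk_eq_zero _).2 (h.totalComp_le hn h1)
  aug_surjective := by
    intro y
    obtain ⟨r, rfl⟩ := Submodule.mkQ_surjective _ y
    exact ⟨fun _ => r, rfl⟩
  exact_zero := by
    intro v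
    constructor
    · intro hv
      have h1 := (Submodule.Quotient.mk_eq_zero _).1 hv
      obtain ⟨w, hw⟩ := p.totD_zero_eq (totEquiv X G ℓ 0 v) h1
      refine ⟨(totEquiv X G ℓ 1).symm w, ?_⟩
      simp [hw]
    · rintro ⟨w, rfl⟩
      simp only [LinearMap.comp_apply, LinearEquiv.coe_coe, LinearEquiv.apply_symm_apply]
      exact (Submodule.Quotient.mk_eq_zero _).2 (IsTensorPair.totD_apply_mem _ _ _)
  exact_succ k := by
    intro v
    constructor
    · intro hv
      simp only [LinearMap.comp_apply, LinearEquiv.coe_coe, LinearEquiv.map_eq_zero_iff] at hv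
      obtain ⟨w, hw⟩ := (p.exact_totD k _).1 hv
      refine ⟨(totEquiv X G ℓ (k + 2)).symm w, ?_⟩
      simp [hw]
    · rintro ⟨w, rfl⟩
      simp [(p.exact_totD k).apply_apply_eq_zero]

/-- The basis of `X k` appears in the minimal resolution `X ⊗ Y` of the residue field as the basis
of `X k ⊗ Y 0`. -/
theorem IsTensorPair.torNeZero [Nontrivial R] (p : IsTensorPair X G ℓ h hℓ b₀ c₀) (k : ℕ)
    (a : Fin (X.rank k)) :
    TorNeZero (totalComp 𝓡) (residueGrading (totalComp 𝓡)) k (tdeg (X.deg k a)) := by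
  let t : TotIdx X G ℓ k := ⟨⟨(k, 0), by simp⟩, a, ⟨c₀, p.deg_c₀_eq⟩⟩
  have ht : totDeg X G ℓ k t = tdeg (X.deg k a) := by
    change tdeg (X.deg k a) + tdeg (G.deg 0 c₀) = _
    rw [p.deg_c₀, map_zero, add_zero]
  let b : Fin (p.toResolution.rank k) := Fintype.equivFin _ t
  have hb : p.toResolution.deg k b = tdeg (X.deg k a) := by
    rw [← ht]
    exact congrArg (totDeg X G ℓ k) (Equiv.symm_apply_apply _ _)
  have hd : ∀ i x c, p.toResolution.d i x c ∈ irrelevant (totalComp 𝓡) :=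
    fun i x c => IsTensorPair.totD_apply_mem _ _ _
  refine ⟨p.toResolution, Pi.single b 1, ?_, ?_, fun hb => ?_⟩
  · rw [← hb]
    exact single_mem_freeComp (mem_totalComp h.one_mem) _ b
  · cases k with
    | zero => exact Submodule.mem_top
    | succ k => exact mem_smul_top fun c => hd _ _ c
  · rw [GradedFreeResolution.boundaries, Submodule.mem_sup] at hb
    obtain ⟨y, hy, _, ⟨z, rfl⟩, hyz⟩ := hb
    have h1 := add_mem (mem_of_mem_irrelevant_smul hy b) (hd k z b)
    have h2 : y b + p.toResolution.d k z b = 1 :=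
      (congr_fun hyz b).trans (Pi.single_eq_same b 1)
    rw [h2] at h1
    exact h.one_notMem_irrelevant h1

end Tensor

/-! ### Linear resolutions over Koszul algebras -/

section Koszul
variable {K : Type*} {R : Type u} [Field K] [CommRing R] [Algebra K R]

theorem TorNeZero.le_reg {N : Type*} [AddCommGroup N] [Module K N] [Module R N]
    {𝒜 : ℤ → Submodule K R} {𝒩 : ℤ → Submodule K N} {i : ℕ} {j : ℤ} (ht : TorNeZero 𝒜 𝒩 i j) :
    (((j - i : ℤ) : ℝ) : EReal) ≤ reg 𝒜 𝒩 := by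
  refine le_trans ?_ (le_iSup (fun i : ℕ => topDegree 𝒜 𝒩 i - (i : EReal)) i)
  have h1 : ((j : ℝ) : EReal) ≤ topDegree 𝒜 𝒩 i := le_sSup ⟨j, ht, rfl⟩
  have h2 : (((j - i : ℤ) : ℝ) : EReal) = ((j : ℝ) : EReal) - (i : EReal) := by
    push_cast
    rfl
  rw [h2]
  exact EReal.sub_le_sub h1 le_rfl

variable {𝓡 : ℤ × ℤ → Submodule K R}

/-- Over a Koszul bigraded algebra the residue class ring modulo the elements of positive
`ℓ`-degree has a linear resolution, in which the syzygies have positive `ℓ`-degree. -/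
theorem IsKoszul.exists_minimalChain [IsNoetherianRing R] [Nontrivial R] (h : IsBigraded 𝓡)
    (hK : IsKoszul (totalComp 𝓡)) (ℓ : ℤ × ℤ →+ ℤ) (hℓ : ∀ d, 0 ≤ d → 0 ≤ ℓ d) :
    ∃ (X : MinimalChain 𝓡) (b₀ : Fin (X.rank 0)), (∀ b, b = b₀) ∧ X.deg 0 b₀ = 0 ∧
      (∀ z, z ∈ LinearMap.range (X.d 0) ↔ z b₀ ∈ h.posIdeal ℓ hℓ) ∧
      (∀ i b, 0 ≤ X.deg i b) ∧ (∀ i b, tdeg (X.deg i b) ≤ i) ∧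
      ∀ i b, 0 < ℓ (X.deg (i + 1) b) := by
  obtain ⟨X, b₀, hb₀, hdb₀, hX⟩ := exists_minimalChain_of_ideal h
    (h.isHomogeneousSub_posIdeal ℓ hℓ) (h.posIdeal_le ℓ hℓ)
  obtain ⟨G, c₀, hc₀, hdc₀, hG⟩ := exists_minimalChain_of_ideal h
    (I := irrelevant (totalComp 𝓡))
    (by rw [h.irrelevant_eq]; exact h.isHomogeneousSub_posIdeal tdeg tdeg_nonneg) le_rfl
  have p : IsTensorPair X G ℓ h hℓ b₀ c₀ := ⟨hb₀, hdb₀, hX, hc₀, hdc₀, hG⟩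
  have hnn : ∀ i b, 0 ≤ X.deg i b := X.deg_nonneg h (fun b => by rw [hb₀ b, hdb₀])
  refine ⟨X, b₀, hb₀, hdb₀, hX, hnn, fun i b => ?_, fun i => ?_⟩
  -- The degrees in `X` occur in Tor of the residue field, where Koszulness bounds them.
  · have h1 := (p.torNeZero i b).le_reg
    rw [hK] at h1
    have h2 : ((tdeg (X.deg i b) - i : ℤ) : ℝ) ≤ 0 := by exact_mod_cast h1
    have h3 : tdeg (X.deg i b) - i ≤ 0 := by exact_mod_cast h2
    linarith
  · induction i with
    | zero =>
      intro b
      -- A generator of `ℓ`-degree zero would map to an element of `ℓ`-degree zero in the ideal,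
      -- which is zero, against `g_ne_zero`. Further along the resolution the `ℓ`-degree is bounded
      -- below by that of an earlier basis element.
      refine lt_of_le_of_ne (hℓ _ (hnn 1 b)) fun h0 => X.g_ne_zero h 0 b ?_
      funext c
      rw [hb₀ c]
      refine h.eq_zero_of_mem_posIdeal ℓ hℓ (Submodule.mem_iSup_of_mem _
        (Submodule.mem_iSup_of_mem ?_ (mem_biFree.1 (X.g_mem 0 b) b₀)))
        ((hX _).1 ⟨Pi.single b 1, linearCombination_single_one _ b⟩)
      change ℓ _ = 0
      rw [hdb₀, sub_zero, ← h0]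
    | succ i ih =>
      intro b
      obtain ⟨c, _, hc⟩ := X.exists_deg_le h (i + 1) b
      have h1 := hℓ _ (sub_nonneg.2 hc)
      rw [map_sub] at h1
      exact lt_of_lt_of_le (ih c) (sub_nonneg.1 h1)

end Koszul

/-! ### Strands of bigraded modules -/

/-- The family `k ↦ ⨁_{d ∈ S k} M_d`. -/
def strand {K M : Type*} [Field K] [AddCommGroup M] [Module K M] (𝓜 : ℤ × ℤ → Submodule K M)
    (S : ℤ → Set (ℤ × ℤ)) (k : ℤ) : AddSubgroup M :=
  (⨆ d ∈ S k, 𝓜 d).toAddSubgroup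

theorem mem_strand {K M : Type*} [Field K] [AddCommGroup M] [Module K M]
    {𝓜 : ℤ × ℤ → Submodule K M} {S : ℤ → Set (ℤ × ℤ)} {k : ℤ} {x : M} :
    x ∈ strand 𝓜 S k ↔ x ∈ ⨆ d ∈ S k, 𝓜 d := Iff.rfl

/-- A system of sets of bidegrees that is stable under shifts: `W u v` is the set of bidegrees of
the truncation at nonnegative degrees of a strand starting in bidegree `(u, v)`; the relation
`Q u v p q s` means that after passing to `R(-p,-q)` the strand `W u v` starts in degree `s`. -/
structure Weights where
  W : ℕ → ℕ → ℤ → Set (ℤ × ℤ)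
  Q : ℕ → ℕ → ℕ → ℕ → ℕ → Prop
  ge : ∀ u v k d, d ∈ W u v k → ((u : ℤ), (v : ℤ)) ≤ d
  add : ∀ u v i j d d', d ∈ W 0 0 i → d' ∈ W u v j → d + d' ∈ W u v (i + j)
  shift : ∀ u v p q : ℕ, (∀ k d, 0 ≤ d → d + ((p : ℤ), (q : ℤ)) ∉ W u v k) ∨
    ∃ u' v' s, Q u v p q s ∧
      ∀ k d, 0 ≤ d → (d + ((p : ℤ), (q : ℤ)) ∈ W u v k ↔ d ∈ W u' v' (k - (s : ℤ)))
  shift_of_le : ∀ u v p q : ℕ, p ≤ u → q ≤ v → ∀ k d, 0 ≤ d →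
    (d + ((p : ℤ), (q : ℤ)) ∈ W u v k ↔ d ∈ W (u - p) (v - q) k)
  le : ∀ u v p q s : ℕ, Q u v p q s → s ≤ (p - u) + (q - v)

section
variable {K : Type*} {R : Type u} [Field K] [CommRing R] [Algebra K R]
  {𝓡 : ℤ × ℤ → Submodule K R} {A : Type u} [CommRing A] [Algebra K A] [Algebra A R]
  {𝒜 : ℤ → Submodule K A} {P : BigResolution 𝒜}

theorem BiStable.stable_strand {w : Weights} {M : Type*} [AddCommGroup M] [Module K M]
    [Module R M] [Module A M] [IsScalarTower A R M]
    (hA : ∀ i, ∀ a ∈ 𝒜 i, algebraMap A R a ∈ strand 𝓡 (w.W 0 0) i) {𝓜 : ℤ × ℤ → Submodule K M}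
    (hst : BiStable 𝓡 𝓜) (u v : ℕ) : Stable 𝒜 (strand 𝓜 (w.W u v)) := fun i j a x ha hx => by
  rw [← algebraMap_smul R a x]
  exact hst.biSup (fun s hs t ht => w.add u v i j s t hs ht) (hA i a ha) hx

/-- The components of `R` outside nonnegative bidegrees vanish, so `S` and `S'` need only correspond
there; this is why `Weights.shift` restricts to `0 ≤ d`. -/
theorem IsBigraded.strand_shift (h : IsBigraded 𝓡) {S S' : Set (ℤ × ℤ)} {c : ℤ × ℤ}
    (hS : ∀ d, 0 ≤ d → (d + c ∈ S ↔ d ∈ S')) : (⨆ d ∈ S, 𝓡 (d - c)) = ⨆ d ∈ S', 𝓡 d := by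
  refine le_antisymm (iSup₂_le fun d hd x hx => ?_) (iSup₂_le fun d hd x hx => ?_)
  · by_cases hx0 : x = 0
    · simp [hx0]
    · refine Submodule.mem_iSup_of_mem (d - c) (Submodule.mem_iSup_of_mem ?_ hx)
      exact (hS _ (h.nonneg _ _ hx hx0)).1 (by rwa [sub_add_cancel])
  · by_cases hx0 : x = 0
    · simp [hx0]
    · refine Submodule.mem_iSup_of_mem (d + c) (Submodule.mem_iSup_of_mem
        ((hS _ (h.nonneg _ _ hx hx0)).2 hd) ?_)
      rwa [add_sub_cancel_right]

theorem strand_biFree {r : ℕ} (deg : Fin r → ℤ × ℤ) (S : ℤ → Set (ℤ × ℤ)) :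
    strand (biFree 𝓡 deg) S =
      piFam fun b k => (⨆ d ∈ S k, 𝓡 (d - deg b)).toAddSubgroup := by
  ext k x
  rw [mem_strand, mem_piFam]
  exact mem_biSup_pi (𝒩 := fun b d => 𝓡 (d - deg b)) (S k) x

variable (w : Weights)

theorem Weights.van_shift (h : IsBigraded 𝓡) {u v p q : ℕ} {e : ℤ} {j : ℕ}
    (H : ∀ s u' v', w.Q u v p q s → Van P (strand 𝓡 (w.W u' v')) (e - s) j) :
    Van P (fun k => (⨆ d ∈ w.W u v k, 𝓡 (d - ((p : ℤ), (q : ℤ)))).toAddSubgroup) e j := by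
  rcases w.shift u v p q with h1 | ⟨u', v', s, hs, h1⟩
  · refine Van.of_eq_bot fun k => ?_
    rw [h.strand_shift (S' := ∅) fun d hd => ⟨fun h2 => h1 k d hd h2, fun h2 => h2.elim⟩]
    simp
  · refine Van.congr_shift (𝒞 := strand 𝓡 (w.W u' v')) (s := s) (fun k => ?_) (H s u' v' hs)
    rw [strand, h.strand_shift (h1 k)]

theorem Weights.van_shift_of_le (h : IsBigraded 𝓡) {u v p q : ℕ} (hp : p ≤ u) (hq : q ≤ v)
    {e : ℤ} {j : ℕ} (H : Van P (strand 𝓡 (w.W (u - p) (v - q))) e j) :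
    Van P (fun k => (⨆ d ∈ w.W u v k, 𝓡 (d - ((p : ℤ), (q : ℤ)))).toAddSubgroup) e j := by
  convert! H using 2 with k
  rw [strand, h.strand_shift (w.shift_of_le u v p q hp hq k)]

theorem exists_natCast_eq {d : ℤ × ℤ} (hd : 0 ≤ d) : ∃ p q : ℕ, d = ((p : ℤ), (q : ℤ)) := by
  obtain ⟨p, hp⟩ := Int.eq_ofNat_of_zero_le hd.1
  obtain ⟨q, hq⟩ := Int.eq_ofNat_of_zero_le hd.2
  exact ⟨p, q, Prod.ext hp hq⟩

section
variable {r : ℕ} {deg : Fin r → ℤ × ℤ}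

theorem Weights.van_biFree (h : IsBigraded 𝓡) {u v : ℕ} {e : ℤ} {j : ℕ} (hdeg : ∀ b, 0 ≤ deg b)
    (H : ∀ b (p q s u' v' : ℕ), deg b = ((p : ℤ), (q : ℤ)) → w.Q u v p q s →
      Van P (strand 𝓡 (w.W u' v')) (e - s) j) :
    Van P (strand (biFree 𝓡 deg) (w.W u v)) e j := by
  rw [strand_biFree]
  refine Van.pi fun b => ?_
  obtain ⟨p, q, hb⟩ := exists_natCast_eq (hdeg b)
  simp only [hb]
  exact w.van_shift h fun s u' v' hs => H b p q s u' v' hb hs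

end

namespace MinimalChain
variable (X : MinimalChain 𝓡)

theorem d_mem_strand (h : IsBigraded 𝓡) (i : ℕ) (S : ℤ → Set (ℤ × ℤ)) (k : ℤ)
    (x : Fin (X.rank (i + 1)) → R) (hx : x ∈ strand (biFree 𝓡 (X.deg (i + 1))) S k) :
    X.d i x ∈ strand (biFree 𝓡 (X.deg i)) S k := by
  have : (⨆ d ∈ S k, biFree 𝓡 (X.deg (i + 1)) d) ≤
      (⨆ d ∈ S k, biFree 𝓡 (X.deg i) d).comap ((X.d i).restrictScalars K) :=
    iSup₂_le fun d hd y hy => Submodule.mem_iSup_of_mem d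
      (Submodule.mem_iSup_of_mem hd (X.d_mem h i d y hy))
  exact this hx

theorem exists_d_eq (h : IsBigraded 𝓡) (i : ℕ) (S : ℤ → Set (ℤ × ℤ)) (k : ℤ)
    (x : Fin (X.rank (i + 1)) → R) (hx : x ∈ strand (biFree 𝓡 (X.deg (i + 1))) S k)
    (hx' : X.d i x = 0) : ∃ y ∈ strand (biFree 𝓡 (X.deg (i + 2))) S k, X.d (i + 1) y = x := by
  obtain ⟨y, rfl⟩ := (X.exact_d i x).1 hx'
  exact exists_mem_biSup_of_graded ((X.d (i + 1)).restrictScalars K) (X.d_mem h (i + 1))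
    (h.iSup_biFree _) (h.indep_biFree _) (S k) y hx

end MinimalChain

/-- The induction step for the linearity of the strands of a Koszul algebra. -/
theorem Weights.van_strand_step [IsScalarTower K A R] [IsNoetherianRing R] [Nontrivial R]
    (h : IsBigraded 𝓡)
    (hK : IsKoszul (totalComp 𝓡)) (ℓ : ℤ × ℤ →+ ℤ) (hℓ : ∀ d, 0 ≤ d → 0 ≤ ℓ d)
    (hA : ∀ i, ∀ a ∈ 𝒜 i, algebraMap A R a ∈ strand 𝓡 (w.W 0 0) i)
    {u v : ℕ} {j : ℕ} {e : ℤ} (he : (j : ℤ) < e) (hW : ∀ k, ∀ d ∈ w.W u v k, ℓ d ≠ 0)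
    (h1 : ∀ p q : ℕ, 0 < ℓ (p, q) → p + q ≤ 1 → p ≤ u ∧ q ≤ v ∧ 1 ≤ p + q)
    (h2 : ∀ p q : ℕ, 0 < ℓ (p, q) → (p - u) + (q - v) + 1 ≤ p + q)
    (ih : ∀ j' < j, ∀ u v, ∀ e : ℤ, (j' : ℤ) < e → Van P (strand 𝓡 (w.W u v)) e j')
    (ih' : ∀ u' v', u' + v' < u + v → Van P (strand 𝓡 (w.W u' v')) e j) :
    Van P (strand 𝓡 (w.W u v)) e j := by
  obtain ⟨X, b₀, hb₀, hdb₀, hX, hnn, hlin, hpos⟩ := hK.exists_minimalChain h ℓ hℓ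
  -- The complex is read from `X 1` on, as a resolution of the ideal rather than of its quotient
  -- ring; the term with index `i` is therefore `X (i + 1)`.
  let f : (Fin (X.rank 1) → R) →ₗ[R] R := LinearMap.proj b₀ ∘ₗ X.d 0
  have hf : ∀ d, ∀ x ∈ biFree 𝓡 (X.deg 1) d, f x ∈ 𝓡 d := fun d x hx => by
    have := mem_biFree.1 (X.d_mem h 0 d x hx) b₀
    rwa [hdb₀, sub_zero] at this
  have hf0 : ∀ x, f x = 0 → X.d 0 x = 0 := fun x hx => by
    funext b
    rw [hb₀ b]
    exact hx
  refine Van.of_augmented (fun i => strand (biFree 𝓡 (X.deg (i + 1))) (w.W u v))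
    (fun i => (h.biStable_biFree _).stable_strand hA u v)
    (fun i => (X.d (i + 1)).restrictScalars A) (fun i => X.d_mem_strand h (i + 1) _)
    (fun i x => (X.exact_d (i + 1)).apply_apply_eq_zero x) (fun i => X.exists_d_eq h (i + 1) _)
    (f.restrictScalars A) (fun k x hx => ?_) (fun k x hx => ?_)
    (fun x => congr_fun ((X.exact_d 0).apply_apply_eq_zero x) b₀)
    (fun k x hx hx' => X.exists_d_eq h 0 _ k x hx (hf0 x hx')) j (fun i hi => ?_)
  · have : (⨆ d ∈ w.W u v k, biFree 𝓡 (X.deg 1) d) ≤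
        (⨆ d ∈ w.W u v k, 𝓡 d).comap (f.restrictScalars K) :=
      iSup₂_le fun d hd y hy => Submodule.mem_iSup_of_mem d
        (Submodule.mem_iSup_of_mem hd (hf d y hy))
    exact this hx
  -- All bidegrees of the strand have nonzero `ℓ`-degree, so the strand of `R` is a strand of the
  -- ideal.
  · have hx1 : x ∈ h.posIdeal ℓ hℓ := (h.mem_posIdeal ℓ hℓ).2
      (biSup_mono (f := 𝓡) (fun d hd => hW k d hd) hx)
    obtain ⟨y, hy⟩ := (hX fun _ => x).2 hx1
    have hy' : f y = x := congr_fun hy b₀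
    obtain ⟨z, hz, hz'⟩ := exists_mem_biSup_of_graded (f.restrictScalars K) hf
      (h.iSup_biFree _) h.indep (w.W u v k) y (by
        rw [show f.restrictScalars K y = x from hy']
        exact hx)
    exact ⟨z, hz, hz'.trans hy'⟩
  · cases i with
    | zero =>
      rw [strand_biFree]
      refine Van.pi fun b => ?_
      obtain ⟨p, q, hb⟩ := exists_natCast_eq (hnn 1 b)
      have h3 := hlin 1 b
      have h4 : 0 < ℓ (X.deg 1 b) := hpos 0 b
      rw [hb] at h4
      rw [hb, tdeg_apply] at h3
      -- By linearity the generators of the ideal have total degree one, in the direction in which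
      -- the strand starts away from zero. Subtracting it lowers `u + v` and causes no shift.
      obtain ⟨hp, hq, hpq⟩ := h1 p q h4 (by push_cast at h3; omega)
      have hb' : X.deg (0 + 1) b = _ := hb
      simp only [hb']
      exact w.van_shift_of_le h hp hq (ih' _ _ (by omega))
    | succ i =>
      refine w.van_biFree h (hnn _) fun b p q s u' v' hb hs => ?_
      have h3 := hlin _ b
      have h4 := hpos _ b
      rw [hb] at h4
      rw [hb, tdeg_apply] at h3
      -- Here `s ≤ p + q - 1 ≤ i + 1`, where one is gained because the start of the strand is
      -- positive in a direction in which `(p,q)` is positive too. This is exactly what the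
      -- induction on `j` needs.
      have h5 := h2 p q h4
      have h6 := w.le _ _ _ _ _ hs
      refine ih _ (by omega) _ _ _ ?_
      push_cast at h3 ⊢
      omega

/-- The strands `W u v` of a Koszul bigraded algebra have linear resolutions. -/
theorem Weights.van_strand [IsScalarTower K A R] [IsNoetherianRing R] [Nontrivial R]
    (h : IsBigraded 𝓡)
    (hK : IsKoszul (totalComp 𝓡))
    (hA : ∀ i, ∀ a ∈ 𝒜 i, algebraMap A R a ∈ strand 𝓡 (w.W 0 0) i)
    (h₀ : ∀ (j : ℕ) (e : ℤ), (j : ℤ) < e → Van P (strand 𝓡 (w.W 0 0)) e j)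
    (j : ℕ) (u v : ℕ) (e : ℤ) (he : (j : ℤ) < e) : Van P (strand 𝓡 (w.W u v)) e j := by
  induction j using Nat.strong_induction_on generalizing u v e with
  | _ j ih =>
    induction hn : u + v using Nat.strong_induction_on generalizing u v with
    | _ n ih' =>
      subst hn
      have ih'' : ∀ u' v', u' + v' < u + v → Van P (strand 𝓡 (w.W u' v')) e j :=
        fun u' v' hlt => ih' _ hlt u' v' rfl
      -- The ideal of positive `y`-degree is used if `v > 0`, otherwise that of positive `x`-degree.
      rcases Nat.eq_zero_or_pos v with rfl | hv
      · rcases Nat.eq_zero_or_pos u with rfl | hu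
        · exact h₀ j e he
        · refine w.van_strand_step h hK (AddMonoidHom.fst ℤ ℤ) (fun d hd => hd.1) hA he
            (fun k d hd => ?_) (fun p q hp hpq => ?_) (fun p q hp => ?_) ih ih''
          · have := (w.ge _ _ _ _ hd).1
            simp only [AddMonoidHom.coe_fst] at *
            omega
          · simp only [AddMonoidHom.coe_fst] at hp
            omega
          · simp only [AddMonoidHom.coe_fst] at hp
            omega
      · refine w.van_strand_step h hK (AddMonoidHom.snd ℤ ℤ) (fun d hd => hd.2) hA he
          (fun k d hd => ?_) (fun p q hp hpq => ?_) (fun p q hp => ?_) ih ih''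
        · have := (w.ge _ _ _ _ hd).2
          simp only [AddMonoidHom.coe_snd] at *
          omega
        · simp only [AddMonoidHom.coe_snd] at hp
          omega
        · simp only [AddMonoidHom.coe_snd] at hp
          omega

/-- If `Tor` of a strand of a module does not vanish, this is due to some basis element of the
minimal resolution. -/
theorem Weights.van_module [IsScalarTower K A R] [IsNoetherianRing R] [Nontrivial R]
    (h : IsBigraded 𝓡)
    (hK : IsKoszul (totalComp 𝓡))
    (hA : ∀ i, ∀ a ∈ 𝒜 i, algebraMap A R a ∈ strand 𝓡 (w.W 0 0) i)
    (h₀ : ∀ (j : ℕ) (e : ℤ), (j : ℤ) < e → Van P (strand 𝓡 (w.W 0 0)) e j)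
    {M : Type*} [AddCommGroup M] [Module K M] [Module R M] [IsScalarTower K R M]
    [Module.Finite R M] [Module A M] [IsScalarTower A R M]
    {𝓜 : ℤ × ℤ → Submodule K M} (hst : BiStable 𝓡 𝓜) (hind : iSupIndep 𝓜)
    (htop : ⨆ d, 𝓜 d = ⊤) (hnn : ∀ d x, x ∈ 𝓜 d → x ≠ 0 → 0 ≤ d)
    (u v : ℕ) (e : ℤ) (j : ℕ)
    (H : ∀ i ≤ j, ∀ p q s : ℕ, TorNeZero (totalComp 𝓡) (totalComp 𝓜) i ((p : ℤ) + q) →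
      w.Q u v p q s → (j : ℤ) - i < e - s) :
    Van P (strand 𝓜 (w.W u v)) e j := by
  obtain ⟨X, g, hg, hr, hk⟩ := exists_minimalChain_of_module h hst hind htop
  have hexk := LinearMap.exact_iff.2 hk
  -- Minimality forces the generators to be nonzero, so their bidegrees are nonnegative.
  have hdeg0 : ∀ b, 0 ≤ X.deg 0 b := fun b => hnn _ _ (hg b) fun h0 => by
    obtain ⟨y, hy⟩ := (hexk (Pi.single b 1)).1 ((linearCombination_single_one g b).trans h0)
    have := X.d_apply_mem 0 y b
    rw [show X.d 0 y = _ from hy, Pi.single_eq_same] at this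
    exact h.one_notMem_irrelevant this
  have hgd := linearCombination_mem (𝓡 := 𝓡) hst hg
  refine Van.of_augmented (fun i => strand (biFree 𝓡 (X.deg i)) (w.W u v))
    (fun i => (h.biStable_biFree _).stable_strand hA u v)
    (fun i => (X.d i).restrictScalars A) (fun i => X.d_mem_strand h i _)
    (fun i x => (X.exact_d i).apply_apply_eq_zero x) (fun i => X.exists_d_eq h i _)
    ((Fintype.linearCombination R g).restrictScalars A) (fun k x hx => ?_) (fun k x hx => ?_)
    (fun x => hexk.apply_apply_eq_zero x)
    (fun k x hx hx' => ?_) j (fun i hi => ?_)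
  · have : (⨆ d ∈ w.W u v k, biFree 𝓡 (X.deg 0) d) ≤
        (⨆ d ∈ w.W u v k, 𝓜 d).comap ((Fintype.linearCombination R g).restrictScalars K) :=
      iSup₂_le fun d hd y hy => Submodule.mem_iSup_of_mem d
        (Submodule.mem_iSup_of_mem hd (hgd d y hy))
    exact this hx
  · obtain ⟨y, rfl⟩ := LinearMap.range_eq_top.1 hr x
    exact exists_mem_biSup_of_graded ((Fintype.linearCombination R g).restrictScalars K) hgd
      (h.iSup_biFree _) hind (w.W u v k) y hx
  · obtain ⟨y, rfl⟩ := (hexk x).1 hx'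
    exact exists_mem_biSup_of_graded ((X.d 0).restrictScalars K) (X.d_mem h 0)
      (h.iSup_biFree _) (h.indep_biFree _) (w.W u v k) y hx
  · refine w.van_biFree h (X.deg_nonneg h hdeg0 i) fun b p q s u' v' hb hs => ?_
    have ht := X.torNeZero h hst g hg hr hk i b
    rw [hb, tdeg_apply] at ht
    have := H i hi p q s ht hs
    exact w.van_strand h hK hA h₀ _ _ _ _ (by push_cast [Nat.cast_sub hi]; exact this)

end

/-! ### The weights of diagonals and Veronese subrings -/

/-- The diagonals `{(k a + u, k b + v) : k ≥ 0}`. -/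
def diagWeights (a b : ℕ) (hab : ¬ (a = 0 ∧ b = 0)) : Weights where
  W u v k := {d | ∃ i : ℕ, (i : ℤ) = k ∧ d = ((i * a + u : ℤ), (i * b + v : ℤ))}
  Q u v p q s := (p ≤ s * a + u ∧ q ≤ s * b + v) ∧
    ∀ t < s, ¬ (p ≤ t * a + u ∧ q ≤ t * b + v)
  ge := by
    rintro u v k _ ⟨i, -, rfl⟩
    constructor <;> simp <;> positivity
  add := by
    rintro u v i j _ _ ⟨s, rfl, rfl⟩ ⟨t, rfl, rfl⟩
    exact ⟨s + t, by simp, by ext <;> simp <;> ring⟩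
  shift := by
    classical
    intro u v p q
    -- The alternative without such an `s` arises only when `a = 0` and `p > u`, or `b = 0` and `q >
    -- v`; then the shifted strand misses all nonnegative bidegrees. Otherwise the new start is the
    -- first point of the strand beyond `(p,q)`, measured from `(p,q)`.
    by_cases h : ∃ s : ℕ, p ≤ s * a + u ∧ q ≤ s * b + v
    · refine Or.inr ⟨Nat.find h * a + u - p, Nat.find h * b + v - q, Nat.find h,
        ⟨Nat.find_spec h, fun t ht => Nat.find_min h ht⟩, ?_⟩
      obtain ⟨h1, h2⟩ := Nat.find_spec h
      rintro k ⟨d, d'⟩ hd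
      have hd1 : 0 ≤ d := hd.1
      have hd2 : 0 ≤ d' := hd.2
      simp only [Prod.mk_add_mk, Set.mem_ofPred_eq, Prod.mk.injEq]
      push_cast [Nat.cast_sub h1, Nat.cast_sub h2]
      constructor
      · rintro ⟨i, rfl, h3, h4⟩
        have h5 : Nat.find h ≤ i := Nat.find_le ⟨by zify; omega, by zify; omega⟩
        refine ⟨i - Nat.find h, by push_cast [h5]; ring, ?_, ?_⟩
        · push_cast [h5]
          linarith
        · push_cast [h5]
          linarith
      · rintro ⟨i, h3, rfl, rfl⟩
        exact ⟨i + Nat.find h, by push_cast; linarith, by push_cast; ring, by push_cast; ring⟩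
    · left
      rintro k ⟨d, d'⟩ hd ⟨i, -, h3⟩
      have hd1 : 0 ≤ d := hd.1
      have hd2 : 0 ≤ d' := hd.2
      simp only [Prod.mk_add_mk, Prod.mk.injEq] at h3
      exact h ⟨i, by zify; omega, by zify; omega⟩
  shift_of_le := by
    rintro u v p q hp hq k ⟨d, d'⟩ -
    simp only [Prod.mk_add_mk, Set.mem_ofPred_eq, Prod.mk.injEq]
    push_cast [hp, hq]
    refine exists_congr fun i => and_congr_right fun _ => ?_
    constructor <;> rintro ⟨h1, h2⟩ <;> constructor <;> linarith
  le := by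
    rintro u v p q s ⟨⟨h1, h2⟩, h3⟩
    rcases s with _ | t
    · simp
    · have h4 := h3 t (by omega)
      rw [not_and_or, not_le, not_le] at h4
      rcases h4 with h4 | h4
      · have : t ≤ t * a := by
          rcases Nat.eq_zero_or_pos a with rfl | ha
          · simp at h1 h4
            omega
          · exact Nat.le_mul_of_pos_right t ha
        omega
      · have : t ≤ t * b := by
          rcases Nat.eq_zero_or_pos b with rfl | hb
          · simp at h2 h4
            omega
          · exact Nat.le_mul_of_pos_right t hb
        omega

/-- If `s > i + 1`, then step `i + 1` falls short in one direction, say `(i + 1) a < p`. For `a > 0`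
this gives `p > i + a ≥ p + q`; for `a = 0` no later step could reach `p` either. -/
theorem diagWeights_le {a b : ℕ} {hab : ¬ (a = 0 ∧ b = 0)} {p q s i : ℕ}
    (h : (diagWeights a b hab).Q 0 0 p q s) (ha : 0 < a → p + q ≤ i + a)
    (hb : 0 < b → p + q ≤ i + b) : s ≤ i + 1 := by
  obtain ⟨⟨h1, h2⟩, h3⟩ := h
  by_contra! hs
  have h4 := h3 (i + 1) hs
  rw [not_and_or, not_le, not_le] at h4
  rcases h4 with h4 | h4
  · rcases Nat.eq_zero_or_pos a with rfl | ha'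
    · simp at h1 h4
      omega
    · have := ha ha'
      nlinarith
  · rcases Nat.eq_zero_or_pos b with rfl | hb'
    · simp at h2 h4
      omega
    · have := hb hb'
      nlinarith

/-- The smallest `s` with `p ≤ s a + u`. -/
def IsCeil (a u p s : ℕ) : Prop := p ≤ s * a + u ∧ ∀ t < s, t * a + u < p

theorem exists_isCeil {a : ℕ} (ha : 1 ≤ a) (u p : ℕ) : ∃ s, IsCeil a u p s := by
  classical
  have h : ∃ s, p ≤ s * a + u := ⟨p, by nlinarith⟩
  exact ⟨Nat.find h, Nat.find_spec h, fun t ht => by simpa using Nat.find_min h ht⟩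

theorem IsCeil.le {a u p s : ℕ} (ha : 1 ≤ a) (h : IsCeil a u p s) : s ≤ p - u := by
  rcases s with _ | t
  · simp
  · have := h.2 t (by omega)
    have : t ≤ t * a := Nat.le_mul_of_pos_right t ha
    omega

theorem IsCeil.le_of_eq {a u p s i : ℕ} (h : IsCeil a u p s) {d : ℤ} (hd : 0 ≤ d)
    (hi : d + p = i * a + u) : s ≤ i := by
  by_contra! hs
  have := h.2 i hs
  zify at this
  omega

/-- The sets `{(i a + u, j b + v) : i, j ≥ 0, i + j = k}`. -/
def verWeights (a b : ℕ) (ha : 1 ≤ a) (hb : 1 ≤ b) : Weights where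
  W u v k := {d | ∃ i j : ℕ, (i + j : ℤ) = k ∧ d = ((i * a + u : ℤ), (j * b + v : ℤ))}
  Q u v p q s := ∃ s₁ s₂, s = s₁ + s₂ ∧ IsCeil a u p s₁ ∧ IsCeil b v q s₂
  ge := by
    rintro u v k _ ⟨i, j, -, rfl⟩
    constructor <;> simp <;> positivity
  add := by
    rintro u v _ _ _ _ ⟨s, s', rfl, rfl⟩ ⟨t, t', rfl, rfl⟩
    exact ⟨s + t, s' + t', by push_cast; ring, by ext <;> simp <;> ring⟩
  shift := by
    intro u v p q
    obtain ⟨s, hs⟩ := exists_isCeil ha u p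
    obtain ⟨t, ht⟩ := exists_isCeil hb v q
    refine Or.inr ⟨s * a + u - p, t * b + v - q, s + t, ⟨s, t, rfl, hs, ht⟩, ?_⟩
    rintro k ⟨d, d'⟩ hd
    have hd1 : 0 ≤ d := hd.1
    have hd2 : 0 ≤ d' := hd.2
    simp only [Prod.mk_add_mk, Set.mem_ofPred_eq, Prod.mk.injEq]
    push_cast [Nat.cast_sub hs.1, Nat.cast_sub ht.1]
    constructor
    · rintro ⟨i, j, rfl, h3, h4⟩
      have h5 := hs.le_of_eq hd1 h3
      have h6 := ht.le_of_eq hd2 h4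
      refine ⟨i - s, j - t, by push_cast [h5, h6]; ring, ?_, ?_⟩
      · push_cast [h5]
        linarith
      · push_cast [h6]
        linarith
    · rintro ⟨i, j, h3, rfl, rfl⟩
      exact ⟨i + s, j + t, by push_cast; linarith, by push_cast; ring, by push_cast; ring⟩
  shift_of_le := by
    rintro u v p q hp hq k ⟨d, d'⟩ -
    simp only [Prod.mk_add_mk, Set.mem_ofPred_eq, Prod.mk.injEq]
    push_cast [hp, hq]
    refine exists_congr fun i => exists_congr fun j => and_congr_right fun _ => ?_
    constructor <;> rintro ⟨h1, h2⟩ <;> constructor <;> linarith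
  le := by
    rintro u v p q _ ⟨s, t, rfl, hs, ht⟩
    exact add_le_add (hs.le ha) (ht.le hb)

/-- By minimality `(s - 1) a < p`, and `a` may be replaced by the smaller `μ`. -/
theorem IsCeil.mul_lt {a u p s μ : ℕ} (h : IsCeil a u p s) (hμ : μ ≤ a) (hs : s ≠ 0) :
    s * μ + 1 ≤ p + μ := by
  obtain ⟨t, rfl⟩ := Nat.exists_eq_succ_of_ne_zero hs
  have h1 := h.2 t (by omega)
  have h2 : t * μ ≤ t * a := Nat.mul_le_mul_left t hμ
  rw [Nat.succ_mul]
  omega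

/-- With `μ = min a b`, each nonzero rounded-up quotient costs less than `μ`. If both are nonzero,
`(s + t) μ + 2 ≤ p + q + 2 μ ≤ i + 3 μ`, which excludes `s + t ≥ i + 3` as `i ≤ i μ`; if one is
zero, there is room to spare. -/
theorem verWeights_le {a b : ℕ} {ha : 1 ≤ a} {hb : 1 ≤ b} {u v p q s i : ℕ}
    (h : (verWeights a b ha hb).Q u v p q s) (hpq : p + q ≤ i + min a b) : s ≤ i + 2 := by
  obtain ⟨s, t, rfl, hs, ht⟩ := h
  have h1 : 1 ≤ min a b := le_min ha hb
  generalize hμ : min a b = μ at *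
  have h2 := fun h => hs.mul_lt (μ := μ) (by omega) h
  have h3 := fun h => ht.mul_lt (μ := μ) (by omega) h
  by_contra! hst
  have h4 : (i + 3) * μ ≤ (s + t) * μ := Nat.mul_le_mul_right μ hst
  have h5 : i ≤ i * μ := Nat.le_mul_of_pos_right i h1
  rw [add_mul, add_mul] at h4
  by_cases hs0 : s = 0
  · subst hs0
    have := h3 (by omega)
    omega
  · by_cases ht0 : t = 0
    · subst ht0
      have := h2 hs0
      omega
    · have := h2 hs0
      have := h3 ht0
      omega

/-! ### Regularity bounds -/

section
variable {K A N : Type*} [Field K] [CommRing A] [Algebra K A]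
  [AddCommGroup N] [Module K N] [Module A N]

theorem reg_le_of_forall {𝒜 : ℤ → Submodule K A} {𝒩 : ℤ → Submodule K N} {B : EReal}
    (h : ∀ j e, TorNeZero 𝒜 𝒩 j e → (((e - j : ℤ) : ℝ) : EReal) ≤ B) : reg 𝒜 𝒩 ≤ B := by
  refine iSup_le fun i => EReal.sub_le_of_le_add (sSup_le ?_)
  rintro _ ⟨j, hj, rfl⟩
  have h1 := add_le_add_left (h i j hj) (i : EReal)
  refine le_trans (le_of_eq ?_) h1
  norm_cast
  simp

/-- Over the zero ring the regularity is `-∞` and not `0`. -/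
theorem IsKoszul.nontrivial {𝒜 : ℤ → Submodule K A} (h : IsKoszul 𝒜) : Nontrivial A := by
  by_contra hA
  rw [not_nontrivial_iff_subsingleton] at hA
  have h1 : reg 𝒜 (residueGrading 𝒜) ≤ ⊥ := reg_le_of_forall fun j e ⟨F, z, _, _, hz⟩ => by
    refine (hz ?_).elim
    rw [Subsingleton.elim z 0]
    exact zero_mem _
  rw [h] at h1
  simp at h1

end

/-! ### Bigraded quotients of the polynomial ring -/

section
variable {K : Type u} [Field K] {n m : ℕ}

theorem tdeg_weight (c : Fin n ⊕ Fin m →₀ ℕ) :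
    tdeg (Finsupp.weight (bidegree n m) c) = (c.degree : ℤ) := by
  simp only [Finsupp.weight_apply, Finsupp.degree_apply, Finsupp.sum, Nat.cast_sum, map_sum]
  refine Finset.sum_congr rfl fun i _ => ?_
  rcases i with i | i <;> simp [bidegree, tdeg_apply]

theorem weight_nonneg (c : Fin n ⊕ Fin m →₀ ℕ) : 0 ≤ Finsupp.weight (bidegree n m) c := by
  have h (i) : (0 : ℤ × ℤ) ≤ bidegree n m i := by
    rcases i with i | i <;> simp [bidegree, Prod.le_def]
  rw [Finsupp.weight_apply]
  exact Finset.sum_nonneg fun i _ => nsmul_nonneg (h i) _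

theorem iSup_polyComp : ⨆ d, polyComp K n m d = ⊤ := by
  refine eq_top_iff.2 fun f _ => ?_
  rw [← f.support_sum_monomial_coeff]
  exact sum_mem fun c _ => Submodule.mem_iSup_of_mem _
    (MvPolynomial.isWeightedHomogeneous_monomial _ _ _ rfl)

theorem isBigraded_quotComp (J : Ideal (BiPoly K n m)) (hJ : IsBihomogeneous J) :
    IsBigraded (quotComp J) where
  one_mem := SetLike.GradedOne.one_mem
  mul_mem i j x y hx hy := SetLike.GradedMul.mul_mem hx hy
  indep := by
    intro d
    rw [Submodule.disjoint_def]
    rintro _ ⟨f, hf, rfl⟩ hx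
    simp only [quotComp, ← Submodule.map_iSup] at hx
    obtain ⟨g, hg, hfg⟩ := hx
    -- The polynomial `g` has no component of degree `d`, so the component of `f - g ∈ J` in degree
    -- `d` is `f`, and bihomogeneity of `J` puts `f` into `J`.
    have hg0 : MvPolynomial.weightedHomogeneousComponent (bidegree n m) d g = 0 := by
      have : (⨆ d', ⨆ (_ : d' ≠ d), polyComp K n m d') ≤
          LinearMap.ker (MvPolynomial.weightedHomogeneousComponent (bidegree n m) d) :=
        iSup₂_le fun d' hd' y hy => LinearMap.mem_ker.2
          (MvPolynomial.IsWeightedHomogeneous.weightedHomogeneousComponent_ne d hy hd'.symm)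
      exact this hg
    have h1 : f - g ∈ J := Ideal.Quotient.eq.1 hfg.symm
    have h2 := hJ _ h1 d
    rw [map_sub, hg0, sub_zero,
      MvPolynomial.IsWeightedHomogeneous.weightedHomogeneousComponent_same hf] at h2
    exact Ideal.Quotient.eq_zero_iff_mem.2 h2
  iSup_eq_top := by
    simp only [quotComp, ← Submodule.map_iSup, iSup_polyComp, Submodule.map_top]
    exact LinearMap.range_eq_top.2 (Ideal.Quotient.mkₐ_surjective K J)
  nonneg := by
    rintro d _ ⟨f, hf, rfl⟩ hx
    have hf0 : f ≠ 0 := fun h0 => hx (by simp [h0])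
    obtain ⟨c, hc⟩ := MvPolynomial.ne_zero_iff.1 hf0
    rw [← hf hc]
    exact weight_nonneg c
  zero := by
    rintro _ ⟨f, hf, rfl⟩
    have h1 : f = MvPolynomial.C (f.coeff 0) := by
      ext c
      rw [MvPolynomial.coeff_C]
      split_ifs with hc
      · rw [hc]
      · by_contra h2
        have h3 := tdeg_weight c
        rw [hf h2, map_zero] at h3
        exact hc ((Finsupp.degree_eq_zero_iff c).1 (by exact_mod_cast h3.symm)).symm
    refine ⟨f.coeff 0, ?_⟩
    conv_rhs => rw [h1]
    rfl

end

/-! ### Graded subalgebras -/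

section
variable {K X Y γ : Type*} [Field K] [AddCommGroup X] [Module K X] [AddCommGroup Y] [Module K Y]

theorem iSupIndep_biSup {κ : Type*} {𝓧 : γ → Submodule K X} (h : iSupIndep 𝓧) {S : κ → Set γ}
    (hS : ∀ k l d, d ∈ S k → d ∈ S l → k = l) : iSupIndep fun k => ⨆ d ∈ S k, 𝓧 d := fun k => by
  refine (h.disjoint_biSup_biSup (s := S k) (t := {d | ∃ l, l ≠ k ∧ d ∈ S l}) ?_).mono_right
    (iSup₂_le fun l hl => biSup_mono fun d hd => ⟨l, hl, hd⟩)
  exact Set.disjoint_left.2 fun d h1 ⟨l, hl, h2⟩ => hl (hS l k d h2 h1)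

theorem iSupIndep_comap {𝓧 : γ → Submodule K X} (h : iSupIndep 𝓧) {f : Y →ₗ[K] X}
    (hf : Function.Injective f) : iSupIndep fun d => (𝓧 d).comap f := fun d => by
  rw [Submodule.disjoint_def]
  intro x hx hx'
  refine hf ?_
  rw [map_zero]
  refine Submodule.disjoint_def.1 (h d) _ hx ?_
  have : (⨆ d', ⨆ (_ : d' ≠ d), (𝓧 d').comap f) ≤ (⨆ d', ⨆ (_ : d' ≠ d), 𝓧 d').comap f :=
    iSup₂_le fun d' hd' => Submodule.comap_mono (le_biSup 𝓧 hd')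
  exact this hx'

theorem iSup_comap_eq {𝓧 : γ → Submodule K X} {f : Y →ₗ[K] X} (hf : Function.Injective f)
    (hr : ∀ d, 𝓧 d ≤ LinearMap.range f) : ⨆ d, (𝓧 d).comap f = (⨆ d, 𝓧 d).comap f := by
  refine Submodule.map_injective_of_injective hf ?_
  rw [Submodule.map_iSup, Submodule.map_comap_eq_of_le (iSup_le hr)]
  exact iSup_congr fun d => Submodule.map_comap_eq_of_le (hr d)

theorem biSup_congr_of_nonneg {𝓧 : ℤ × ℤ → Submodule K X}
    (hnn : ∀ d x, x ∈ 𝓧 d → x ≠ 0 → 0 ≤ d) {S T : Set (ℤ × ℤ)} (hS : ∀ d, 0 ≤ d → (d ∈ S ↔ d ∈ T)) :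
    ⨆ d ∈ S, 𝓧 d = ⨆ d ∈ T, 𝓧 d := by
  have key : ∀ S T : Set (ℤ × ℤ), (∀ d, 0 ≤ d → d ∈ S → d ∈ T) →
      ⨆ d ∈ S, 𝓧 d ≤ ⨆ d ∈ T, 𝓧 d := fun S T h => iSup₂_le fun d hd x hx => by
    by_cases hx0 : x = 0
    · simp [hx0]
    · exact Submodule.mem_iSup_of_mem d
        (Submodule.mem_iSup_of_mem (h d (hnn d x hx hx0) hd) hx)
  exact le_antisymm (key _ _ fun d hd => (hS d hd).1) (key _ _ fun d hd => (hS d hd).2)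

end

section
variable {K A C N : Type*} [Field K] [CommRing A] [Algebra K A] {𝒜 : ℤ → Submodule K A}
  {P : BigResolution 𝒜} [AddCommGroup N] [Module A N] [AddCommGroup C] [Module A C]

theorem Van.of_bijective {𝒞 : ℤ → AddSubgroup C} {𝒩 : ℤ → AddSubgroup N}
    (h𝒞 : Stable 𝒜 𝒞) {f : C →ₗ[A] N} (hf : ∀ k, ∀ x ∈ 𝒞 k, f x ∈ 𝒩 k)
    (hf' : ∀ k, ∀ x ∈ 𝒩 k, ∃ y ∈ 𝒞 k, f y = x) (hker : ∀ k, ∀ x ∈ 𝒞 k, f x = 0 → x = 0)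
    {e : ℤ} {j : ℕ} (h : Van P 𝒞 e j) : Van P 𝒩 e j := by
  cases j with
  | zero => exact Van.of_surjective_zero hf hf' h
  | succ j =>
    refine Van.of_surjective_succ h𝒞 hf hf' h (Van.of_eq_bot fun k => ?_)
    exact (AddSubgroup.eq_bot_iff_forall _).2 fun x hx => hker k x hx.1 hx.2

end

/-! ### Regularity of direct sums of strands -/

section
variable {K : Type*} {R : Type u} [Field K] [CommRing R] [Algebra K R]
  {𝓡 : ℤ × ℤ → Submodule K R} {A : Type u} [CommRing A] [Algebra K A] [Algebra A R]
  {𝒜 : ℤ → Submodule K A} {P : BigResolution 𝒜} {M : Type*} [AddCommGroup M] [Module K M]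
  [Module R M] [Module A M] [IsScalarTower A R M] {𝓜 : ℤ × ℤ → Submodule K M}

/-- A bound for the regularity of a module that is a direct sum of strands. -/
theorem Weights.reg_le (w : Weights) [IsScalarTower K A R] [IsNoetherianRing R]
    (h : IsBigraded 𝓡) (hK : IsKoszul (totalComp 𝓡))
    (hA : ∀ i, ∀ a ∈ 𝒜 i, algebraMap A R a ∈ strand 𝓡 (w.W 0 0) i)
    (h₀ : ∀ (P : BigResolution 𝒜) (j : ℕ) (e : ℤ), (j : ℤ) < e →
      Van P (strand 𝓡 (w.W 0 0)) e j)
    (h𝒜 : IsPosGraded 𝒜) [IsScalarTower K R M] [Module.Finite R M]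
    (hst : BiStable 𝓡 𝓜) (hind : iSupIndep 𝓜)
    (htop : ⨆ d, 𝓜 d = ⊤) (hnn : ∀ d x, x ∈ 𝓜 d → x ≠ 0 → 0 ≤ d) {β : Type*} (U V : β → ℕ)
    {N : Type*} [AddCommGroup N] [Module K N] [Module A N]
    [IsScalarTower K A N] {𝒩 : ℤ → Submodule K N} (hN : iSupIndep 𝒩)
    (hV : ∀ (P : BigResolution 𝒜) e j, (∀ b, Van P (strand 𝓜 (w.W (U b) (V b))) e j) →
      Van P (fun k => (𝒩 k).toAddSubgroup) e j) (B : ℕ)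
    (hB : ∀ b (i p q s : ℕ), (((p + q - i : ℤ) : ℝ) : EReal) ≤ reg (totalComp 𝓡) (totalComp 𝓜) →
      w.Q (U b) (V b) p q s → s ≤ i + B) :
    reg 𝒜 𝒩 ≤ min (B : EReal) (reg (totalComp 𝓡) (totalComp 𝓜)) := by
  have := hK.nontrivial
  refine reg_le_of_forall fun j e ht => ?_
  by_contra hcon
  refine not_torNeZero_of_van h𝒜 hN
    (hV (bigResolution 𝒜) e j fun b => w.van_module h hK hA (h₀ _) hst hind htop hnn _ _ _ _
      fun i hi p q s ht' hQ => ?_) ht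
  -- Failure means `e - j ≤ s - i` for some basis degree `(p,q)`. Then `s ≤ i + B` and `s ≤ p + q`
  -- bound `e - j` by both `B` and the regularity of `M`.
  by_contra hlt
  have h1 := ht'.le_reg
  have h2 := hB b i p q s h1 hQ
  have h3 := w.le _ _ _ _ _ hQ
  have h4 : e - j ≤ (B : ℤ) := by omega
  have h5 : e - j ≤ (p + q - i : ℤ) := by omega
  refine hcon (le_min ?_ (le_trans ?_ h1))
  · have h6 : ((e - j : ℤ) : ℝ) ≤ ((B : ℤ) : ℝ) := Int.cast_le.2 h4
    rw [Int.cast_natCast] at h6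
    exact EReal.coe_le_coe_iff.2 h6
  · exact EReal.coe_le_coe_iff.2 (Int.cast_le.2 h5)

/-- The strands have disjoint sets of bidegrees, so summation identifies their product with the
family on the union. -/
theorem Weights.van_biSup (w : Weights)
    (hA : ∀ i, ∀ a ∈ 𝒜 i, algebraMap A R a ∈ strand 𝓡 (w.W 0 0) i)
    (hst : BiStable 𝓡 𝓜) (hind : iSupIndep 𝓜) {β : Type*} [Fintype β]
    (U V : β → ℕ) (hUV : ∀ k d b c, d ∈ w.W (U b) (V b) k → d ∈ w.W (U c) (V c) k → b = c)
    {e : ℤ} {j : ℕ} (hV : ∀ b, Van P (strand 𝓜 (w.W (U b) (V b))) e j) :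
    Van P (strand 𝓜 fun k => {d | ∃ b, d ∈ w.W (U b) (V b) k}) e j := by
  classical
  let f : (β → M) →ₗ[A] M := ∑ b, LinearMap.proj b
  have hf : ∀ x, f x = ∑ b, x b := fun x => by simp [f]
  refine Van.of_bijective (f := f) (fun i j a x ha hx => mem_piFam.2 fun b => ?_)
    (fun k x hx => ?_) (fun k x hx => ?_) (fun k x hx hx0 => ?_) (Van.pi hV)
  · exact hst.stable_strand hA _ _ i j a _ ha (mem_piFam.1 hx b)
  · rw [hf]
    exact sum_mem fun b _ => biSup_mono (f := 𝓜) (fun d hd => ⟨b, hd⟩) (mem_piFam.1 hx b)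
  · have : (⨆ d ∈ {d | ∃ b, d ∈ w.W (U b) (V b) k}, 𝓜 d).toAddSubgroup ≤
        (piFam (fun b => strand 𝓜 (w.W (U b) (V b))) k).map f.toAddMonoidHom := by
      intro x hx
      change x ∈ ⨆ d ∈ {d | ∃ b, d ∈ w.W (U b) (V b) k}, 𝓜 d at hx
      induction hx using Submodule.iSup_induction' with
      | mem d x hx =>
        induction hx using Submodule.iSup_induction' with
        | mem hd x hx =>
          obtain ⟨b, hd⟩ := hd
          refine ⟨Pi.single b x, mem_piFam.2 fun c => ?_, ?_⟩
          · rcases eq_or_ne c b with rfl | hc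
            · rw [Pi.single_eq_same]
              exact le_biSup 𝓜 hd hx
            · rw [Pi.single_eq_of_ne hc]
              exact zero_mem _
          · refine (hf _).trans ?_
            simp
        | zero => exact zero_mem _
        | add y z _ _ hy hz => exact add_mem hy hz
      | zero => exact zero_mem _
      | add y z _ _ hy hz => exact add_mem hy hz
    exact this hx
  · rw [hf] at hx0
    funext b
    exact eq_zero_of_sum_eq_zero (iSupIndep_biSup hind fun b c d => hUV k d b c) Finset.univ x
      (fun b => mem_piFam.1 hx b) hx0 b (Finset.mem_univ b)

end

/-- `S k` is the set of bidegrees in `D` that become the degree `k`, and `S k` agrees with `W 0 0 k`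
on nonnegative bidegrees. -/
structure Weights.IsSection (w : Weights) (D : AddSubmonoid (ℤ × ℤ)) (S : ℤ → Set (ℤ × ℤ)) :
    Prop where
  exists_mem : ∀ d ∈ D, ∃ k, d ∈ S k
  mem : ∀ k, ∀ d ∈ S k, d ∈ D
  eq_of_mem : ∀ k l d, d ∈ S k → d ∈ S l → k = l
  zero_mem : 0 ∈ S 0
  add_mem : ∀ k l, ∀ d ∈ S k, ∀ d' ∈ S l, d + d' ∈ S (k + l)
  mem_W : ∀ k d, 0 ≤ d → (d ∈ S k ↔ d ∈ w.W 0 0 k)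
  nonneg : ∀ k d, 0 ≤ d → d ∈ S k → 0 ≤ k
  eq_zero : ∀ d, 0 ≤ d → d ∈ S 0 → d = 0

/-! ### Subrings and submodules supported on a submonoid of bidegrees -/

section
variable {K : Type*} {R : Type u} [Field K] [CommRing R] [Algebra K R] {M : Type*}
  [AddCommGroup M] [Module K M] [Module R M]

/-- The grading of a subalgebra `⨁_{d ∈ D} R_d` with components `⨁_{d ∈ S k} R_d`. -/
def subringComp (𝓡 : ℤ × ℤ → Submodule K R) [SetLike.GradedMonoid 𝓡] (D : AddSubmonoid (ℤ × ℤ))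
    (S : ℤ → Set (ℤ × ℤ)) (k : ℤ) : Submodule K (subring 𝓡 D) :=
  (⨆ d ∈ S k, 𝓡 d).comap (subring 𝓡 D).val.toLinearMap

/-- The grading of the submodule `⨁_{d ∈ D} M_d` with components `⨁_{d ∈ S k} M_d`. -/
def submodComp [IsScalarTower K R M] (𝓡 : ℤ × ℤ → Submodule K R) [SetLike.GradedMonoid 𝓡]
    (𝓜 : ℤ × ℤ → Submodule K M) [SetLike.GradedSMul 𝓡 𝓜] (D : AddSubmonoid (ℤ × ℤ))
    (S : ℤ → Set (ℤ × ℤ)) (k : ℤ) : Submodule K (submod 𝓡 𝓜 D) :=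
  (⨆ d ∈ S k, 𝓜 d).comap ((submod 𝓡 𝓜 D).subtype.restrictScalars K)

variable {𝓡 : ℤ × ℤ → Submodule K R} [SetLike.GradedMonoid 𝓡] {D : AddSubmonoid (ℤ × ℤ)}
  {S : ℤ → Set (ℤ × ℤ)} {w : Weights}

namespace Weights.IsSection

theorem biSup_le {X : Type*} [AddCommGroup X] [Module K X] (hw : w.IsSection D S)
    (𝓧 : ℤ × ℤ → Submodule K X) (k : ℤ) : ⨆ d ∈ S k, 𝓧 d ≤ ⨆ d : D, 𝓧 d :=
  iSup₂_le fun d hd => le_iSup (fun d : D => 𝓧 d) ⟨d, hw.mem k d hd⟩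

theorem iSup_biSup {X : Type*} [AddCommGroup X] [Module K X] (hw : w.IsSection D S)
    (𝓧 : ℤ × ℤ → Submodule K X) : ⨆ k, ⨆ d ∈ S k, 𝓧 d = ⨆ d : D, 𝓧 d := by
  refine le_antisymm (iSup_le fun k => hw.biSup_le 𝓧 k) (iSup_le fun d => ?_)
  obtain ⟨k, hk⟩ := hw.exists_mem d d.2
  exact le_iSup_of_le k (le_biSup 𝓧 hk)

theorem biSup_eq_strand {X : Type*} [AddCommGroup X] [Module K X] (hw : w.IsSection D S)
    {𝓧 : ℤ × ℤ → Submodule K X} (hnn : ∀ d x, x ∈ 𝓧 d → x ≠ 0 → 0 ≤ d) (k : ℤ) :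
    strand 𝓧 (w.W 0 0) k = (⨆ d ∈ S k, 𝓧 d).toAddSubgroup := by
  rw [strand, biSup_congr_of_nonneg hnn (hw.mem_W k)]

theorem isPosGraded (hw : w.IsSection D S) (h : IsBigraded 𝓡) :
    IsPosGraded (subringComp 𝓡 D S) where
  one_mem := Submodule.mem_iSup_of_mem 0 (Submodule.mem_iSup_of_mem hw.zero_mem h.one_mem)
  mul_mem i j x y hx hy := h.biStable.biSup (hw.add_mem i j) hx hy
  indep := iSupIndep_comap (iSupIndep_biSup h.indep hw.eq_of_mem) Subtype.val_injective
  iSup_eq_top := by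
    refine (iSup_comap_eq (f := (subring 𝓡 D).val.toLinearMap)
      (𝓧 := fun k => ⨆ d ∈ S k, 𝓡 d) Subtype.val_injective fun k x hx => ?_).trans ?_
    · exact ⟨⟨x, hw.biSup_le 𝓡 k hx⟩, rfl⟩
    · rw [hw.iSup_biSup]
      exact eq_top_iff.2 fun x _ => x.2
  neg k hk := by
    refine (Submodule.eq_bot_iff _).2 fun x hx => Subtype.ext ?_
    have h1 : (x : R) ∈ ⨆ d ∈ (∅ : Set (ℤ × ℤ)), 𝓡 d := by
      rw [← biSup_congr_of_nonneg (S := S k) h.nonneg fun d hd =>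
        ⟨fun h1 => absurd (hw.nonneg k d hd h1) hk.not_ge, fun h1 => h1.elim⟩]
      exact hx
    simpa using h1
  zero x hx hx' := by
    have h1 : (x : R) ∈ ⨆ d ∈ {d | tdeg d = 0}, 𝓡 d := by
      rw [biSup_congr_of_nonneg (S := {d | tdeg d = 0}) (T := S 0) h.nonneg fun d hd =>
        ⟨fun h1 => tdeg_eq_zero hd h1 ▸ hw.zero_mem, fun h1 => hw.eq_zero d hd h1 ▸ map_zero tdeg⟩]
      exact hx
    -- The generators of the irrelevant ideal of the subring have no component of bidegree `0`, so
    -- in `R` they lie in the ideal of elements of positive total degree, which contains no nonzero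
    -- element of bidegree `0`.
    have h2 : irrelevant (subringComp 𝓡 D S) ≤
        (h.posIdeal tdeg tdeg_nonneg).comap (algebraMap (subring 𝓡 D) R) := by
      refine Ideal.span_le.2 ?_
      rintro y ⟨k, hk, hy⟩
      refine (h.mem_posIdeal tdeg tdeg_nonneg).2 ?_
      have h3 : (y : R) ∈ ⨆ d ∈ {d | 0 ≤ d ∧ d ∈ S k}, 𝓡 d := by
        rw [biSup_congr_of_nonneg (S := {d | 0 ≤ d ∧ d ∈ S k}) (T := S k) h.nonneg fun d hd =>
          ⟨fun h1 => h1.2, fun h1 => ⟨hd, h1⟩⟩]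
        exact hy
      refine biSup_mono (f := 𝓡) (fun d hd h0 => ?_) h3
      rw [tdeg_eq_zero hd.1 h0] at hd
      exact hk.ne (hw.eq_of_mem _ _ _ hw.zero_mem hd.2)
    exact Subtype.ext (h.eq_zero_of_mem_posIdeal tdeg tdeg_nonneg h1 (h2 hx'))

theorem algebraMap_mem (hw : w.IsSection D S) (h : IsBigraded 𝓡) (k : ℤ) (x : subring 𝓡 D)
    (hx : x ∈ subringComp 𝓡 D S k) : algebraMap (subring 𝓡 D) R x ∈ strand 𝓡 (w.W 0 0) k := by
  rw [hw.biSup_eq_strand h.nonneg]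
  exact hx

variable {P : BigResolution (subringComp 𝓡 D S)}

/-- The strand of `R` at `(0,0)` is a copy of the subring itself, free of rank one. This is the base
case of the induction in `Weights.van_strand`. -/
theorem van_strand_zero (hw : w.IsSection D S) (h : IsBigraded 𝓡) (j : ℕ) (e : ℤ)
    (he : (j : ℤ) < e) : Van P (strand 𝓡 (w.W 0 0)) e j := by
  have h1 := hw.isPosGraded h
  have : SetLike.GradedOne (subringComp 𝓡 D S) := ⟨h1.one_mem⟩
  refine Van.of_bijective (f := Algebra.linearMap (subring 𝓡 D) R)
    (𝒞 := fun k => (subringComp 𝓡 D S k).toAddSubgroup)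
    (fun i j a x ha hx => h1.mul_mem i j a x ha hx)
    (fun k x hx => hw.algebraMap_mem h k x hx) (fun k x hx => ?_)
    (fun k x _ hx0 => Subtype.ext hx0) (Van.ring fun hj => by omega)
  rw [hw.biSup_eq_strand h.nonneg] at hx
  exact ⟨⟨x, hw.biSup_le 𝓡 k hx⟩, hx, rfl⟩

theorem reg_submodComp_le (hw : w.IsSection D S) (h : IsBigraded 𝓡) [IsNoetherianRing R]
    (hK : IsKoszul (totalComp 𝓡)) [IsScalarTower K R M] [Module.Finite R M]
    (𝓜 : ℤ × ℤ → Submodule K M) [SetLike.GradedSMul 𝓡 𝓜] (hind : iSupIndep 𝓜)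
    (htop : ⨆ d, 𝓜 d = ⊤) (hnn : ∀ d x, x ∈ 𝓜 d → x ≠ 0 → 0 ≤ d) (B : ℕ)
    (hB : ∀ i p q s : ℕ, (((p + q - i : ℤ) : ℝ) : EReal) ≤ reg (totalComp 𝓡) (totalComp 𝓜) →
      w.Q 0 0 p q s → s ≤ i + B) :
    reg (subringComp 𝓡 D S) (submodComp 𝓡 𝓜 D S) ≤
      min (B : EReal) (reg (totalComp 𝓡) (totalComp 𝓜)) := by
  have hst : BiStable 𝓡 𝓜 := fun i j a x ha hx => SetLike.GradedSMul.smul_mem ha hx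
  have hN : iSupIndep (submodComp 𝓡 𝓜 D S) :=
    iSupIndep_comap (iSupIndep_biSup hind hw.eq_of_mem) Subtype.val_injective
  have h1 := w.reg_le (A := subring 𝓡 D) (𝒜 := subringComp 𝓡 D S) (𝓜 := 𝓜) h hK
    (hw.algebraMap_mem h)
  refine h1 (fun P => hw.van_strand_zero h) (hw.isPosGraded h) hst hind htop hnn (β := Unit)
    (fun _ => 0) (fun _ => 0) (𝒩 := submodComp 𝓡 𝓜 D S) hN (fun P e j hV => ?_) B fun _ => hB
  refine Van.of_injective (f := (submod 𝓡 𝓜 D).subtype) (𝒩 := strand 𝓜 (w.W 0 0))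
    Subtype.val_injective (fun k => ?_) (hV ())
  rw [hw.biSup_eq_strand hnn]
  ext x
  constructor
  · intro hx
    exact ⟨⟨x, hw.biSup_le 𝓜 k hx⟩, hx, rfl⟩
  · rintro ⟨y, hy, rfl⟩
    exact hy

/-- The regularity of a module that is the direct sum of finitely many strands. -/
theorem reg_biSup_le (hw : w.IsSection D S) (h : IsBigraded 𝓡) [IsNoetherianRing R]
    (hK : IsKoszul (totalComp 𝓡)) [IsScalarTower K R M] [Module.Finite R M]
    (𝓜 : ℤ × ℤ → Submodule K M) [SetLike.GradedSMul 𝓡 𝓜] (hind : iSupIndep 𝓜)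
    (htop : ⨆ d, 𝓜 d = ⊤) (hnn : ∀ d x, x ∈ 𝓜 d → x ≠ 0 → 0 ≤ d) {β : Type*} [Fintype β]
    (U V : β → ℕ) {T : ℤ → Set (ℤ × ℤ)} (hT : ∀ k l d, d ∈ T k → d ∈ T l → k = l)
    (hT' : ∀ k d, 0 ≤ d → (d ∈ T k ↔ ∃ b, d ∈ w.W (U b) (V b) k))
    (hUV : ∀ k d b c, d ∈ w.W (U b) (V b) k → d ∈ w.W (U c) (V c) k → b = c) (B : ℕ)
    (hB : ∀ b (i p q s : ℕ), (((p + q - i : ℤ) : ℝ) : EReal) ≤ reg (totalComp 𝓡) (totalComp 𝓜) →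
      w.Q (U b) (V b) p q s → s ≤ i + B) :
    reg (subringComp 𝓡 D S) (fun k => ⨆ d ∈ T k, 𝓜 d) ≤
      min (B : EReal) (reg (totalComp 𝓡) (totalComp 𝓜)) := by
  have hst : BiStable 𝓡 𝓜 := fun i j a x ha hx => SetLike.GradedSMul.smul_mem ha hx
  have h1 := w.reg_le (A := subring 𝓡 D) (𝒜 := subringComp 𝓡 D S) (𝓜 := 𝓜) h hK
    (hw.algebraMap_mem h)
  refine h1 (fun P => hw.van_strand_zero h) (hw.isPosGraded h) hst hind htop hnn U V
    (𝒩 := fun k => ⨆ d ∈ T k, 𝓜 d) (iSupIndep_biSup hind hT) (fun P e j hV => ?_) B hB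
  have hk : (fun k => (⨆ d ∈ T k, 𝓜 d).toAddSubgroup) =
      strand 𝓜 fun k => {d | ∃ b, d ∈ w.W (U b) (V b) k} :=
    funext fun k => by rw [strand, biSup_congr_of_nonneg
      (T := {d | ∃ b, d ∈ w.W (U b) (V b) k}) hnn (hT' k)]
  rw [hk]
  exact w.van_biSup (A := subring 𝓡 D) (𝓜 := 𝓜) (hw.algebraMap_mem h) hst hind U V hUV hV

end Weights.IsSection

end

/-! ### Diagonals and Veronese subrings -/

/-- The bidegree that becomes the degree `k` in the diagonal. -/
def diagSection (a b : ℕ) (k : ℤ) : Set (ℤ × ℤ) := {((k * a : ℤ), (k * b : ℤ))}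

/-- The bidegrees that become the total degree `k` in the Veronese subring. -/
def verSection (a b : ℕ) (k : ℤ) : Set (ℤ × ℤ) :=
  {d | ∃ i j : ℤ, i + j = k ∧ d = (i * a, j * b)}

theorem nonneg_of_mul_natCast {k : ℤ} {a : ℕ} (ha : a ≠ 0) (h : 0 ≤ k * a) : 0 ≤ k :=
  nonneg_of_mul_nonneg_left h (by positivity)

theorem eq_of_mul_natCast_eq {k l : ℤ} {a : ℕ} (ha : a ≠ 0) (h : k * a = l * a) : k = l :=
  mul_right_cancel₀ (by exact_mod_cast ha) h

theorem isSection_diagSection (a b : ℕ) (hab : ¬ (a = 0 ∧ b = 0)) :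
    (diagWeights a b hab).IsSection (diagonal a b) (diagSection a b) := by
  have hab' : a ≠ 0 ∨ b ≠ 0 := by tauto
  have hnn : ∀ k : ℤ, 0 ≤ ((k * a : ℤ), (k * b : ℤ)) → 0 ≤ k := fun k hk =>
    hab'.elim (fun h => nonneg_of_mul_natCast h hk.1) (fun h => nonneg_of_mul_natCast h hk.2)
  have hinj : ∀ k l : ℤ, ((k * a : ℤ), (k * b : ℤ)) = (l * a, l * b) → k = l := fun k l hkl =>
    hab'.elim (fun h => eq_of_mul_natCast_eq h (Prod.ext_iff.1 hkl).1)
      (fun h => eq_of_mul_natCast_eq h (Prod.ext_iff.1 hkl).2)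
  refine ⟨?_, ?_, ?_, ?_, ?_, ?_, ?_, ?_⟩
  · rintro _ ⟨k, rfl⟩
    exact ⟨k, rfl⟩
  · rintro k _ rfl
    exact ⟨k, rfl⟩
  · rintro k l _ rfl h
    exact hinj k l h
  · change (0 : ℤ × ℤ) = _
    ext <;> simp
  · rintro k l _ rfl _ rfl
    change _ = _
    ext <;> simp [add_mul]
  · rintro k d hd
    constructor
    · rintro rfl
      obtain ⟨i, rfl⟩ := Int.eq_ofNat_of_zero_le (hnn k hd)
      exact ⟨i, rfl, by simp⟩
    · rintro ⟨i, rfl, rfl⟩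
      change _ = _
      simp
  · rintro k _ hd rfl
    exact hnn k hd
  · rintro _ - rfl
    ext <;> simp

theorem isSection_verSection (a b : ℕ) (ha : 1 ≤ a) (hb : 1 ≤ b) :
    (verWeights a b ha hb).IsSection (veronese a b) (verSection a b) := by
  have ha' : a ≠ 0 := by omega
  have hb' : b ≠ 0 := by omega
  refine ⟨?_, ?_, ?_, ?_, ?_, ?_, ?_, ?_⟩
  · rintro _ ⟨i, j, rfl⟩
    exact ⟨i + j, i, j, rfl, rfl⟩
  · rintro k _ ⟨i, j, -, rfl⟩
    exact ⟨i, j, rfl⟩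
  · rintro k l _ ⟨i, j, rfl, rfl⟩ ⟨i', j', rfl, h⟩
    rw [eq_of_mul_natCast_eq ha' (Prod.ext_iff.1 h).1, eq_of_mul_natCast_eq hb' (Prod.ext_iff.1 h).2]
  · exact ⟨0, 0, by simp, by ext <;> simp⟩
  · rintro k l _ ⟨i, j, rfl, rfl⟩ _ ⟨i', j', rfl, rfl⟩
    exact ⟨i + i', j + j', by ring, by ext <;> simp [add_mul]⟩
  · rintro k d hd
    constructor
    · rintro ⟨i, j, rfl, rfl⟩
      obtain ⟨i, rfl⟩ := Int.eq_ofNat_of_zero_le (nonneg_of_mul_natCast ha' hd.1)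
      obtain ⟨j, rfl⟩ := Int.eq_ofNat_of_zero_le (nonneg_of_mul_natCast hb' hd.2)
      exact ⟨i, j, rfl, by simp⟩
    · rintro ⟨i, j, rfl, rfl⟩
      exact ⟨i, j, rfl, by simp⟩
  · rintro k _ hd ⟨i, j, rfl, rfl⟩
    exact add_nonneg (nonneg_of_mul_natCast ha' hd.1) (nonneg_of_mul_natCast hb' hd.2)
  · rintro _ hd ⟨i, j, hij, rfl⟩
    have hi := nonneg_of_mul_natCast ha' hd.1
    have hj := nonneg_of_mul_natCast hb' hd.2
    obtain rfl : i = 0 := by omega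
    obtain rfl : j = 0 := by omega
    ext <;> simp

theorem iSup_verSection {K X : Type*} [Field K] [AddCommGroup X] [Module K X] (a b : ℕ)
    (𝓧 : ℤ × ℤ → Submodule K X) (k : ℤ) :
    ⨆ i : ℤ, 𝓧 (i * a, (k - i) * b) = ⨆ d ∈ verSection a b k, 𝓧 d := by
  refine le_antisymm (iSup_le fun i => ?_) (iSup₂_le ?_)
  · exact le_biSup 𝓧 (show (i * a, (k - i) * b) ∈ verSection a b k from ⟨i, k - i, by ring, rfl⟩)
  · rintro _ ⟨i, j, rfl, rfl⟩
    refine le_iSup_of_le i (le_of_eq ?_)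
    simp

/-- The bidegrees that become the total degree `k` in the bigrading over the Veronese subring. -/
def fullSection (a b : ℕ) (k : ℤ) : Set (ℤ × ℤ) :=
  {d | ∃ (i j : ℤ) (p : Fin a × Fin b), i + j = k ∧
    d = (i * a + (p.1 : ℕ), j * b + (p.2 : ℕ))}

theorem iSup_fullSection {K X : Type*} [Field K] [AddCommGroup X] [Module K X] (a b : ℕ)
    (𝓧 : ℤ × ℤ → Submodule K X) (k : ℤ) :
    totalComp (fullModComp 𝓧 a b) k = ⨆ d ∈ fullSection a b k, 𝓧 d := by
  refine le_antisymm (iSup_le fun i => iSup_le fun p => iSup_le fun q => ?_) (iSup₂_le ?_)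
  · exact le_biSup 𝓧 (show _ ∈ fullSection a b k from ⟨i, k - i, (p, q), by ring, rfl⟩)
  · rintro _ ⟨i, j, p, rfl, rfl⟩
    refine le_iSup_of_le i (le_iSup_of_le p.1 (le_iSup_of_le p.2 (le_of_eq ?_)))
    simp

theorem eq_of_mul_add_eq {a : ℕ} {i i' : ℤ} {p p' : Fin a}
    (h : i * a + (p : ℕ) = i' * a + (p' : ℕ)) : i = i' ∧ p = p' := by
  have hp : ((p : ℕ) : ℤ) < a := by exact_mod_cast p.2
  have hp' : ((p' : ℕ) : ℤ) < a := by exact_mod_cast p'.2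
  have hi : i = i' := by
    rcases lt_trichotomy i i' with hlt | heq | hlt
    · nlinarith
    · exact heq
    · nlinarith
  subst hi
  exact ⟨rfl, Fin.ext (by omega)⟩

theorem nonneg_of_mul_add {a : ℕ} {i : ℤ} {p : Fin a} (h : 0 ≤ i * a + (p : ℕ)) : 0 ≤ i := by
  have hp : ((p : ℕ) : ℤ) < a := by exact_mod_cast p.2
  by_contra! hi
  nlinarith

/-- Division by `a` and `b` with remainder `p` splits `M` into `a * b` strands starting at the
remainders; in nonnegative bidegrees the quotients are nonnegative, so truncation loses nothing. -/
theorem mem_fullSection_iff {a b : ℕ} {ha : 1 ≤ a} {hb : 1 ≤ b} (k : ℤ) (d : ℤ × ℤ) (hd : 0 ≤ d) :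
    d ∈ fullSection a b k ↔ ∃ p : Fin a × Fin b, d ∈ (verWeights a b ha hb).W p.1 p.2 k := by
  constructor
  · rintro ⟨i, j, p, rfl, rfl⟩
    obtain ⟨i, rfl⟩ := Int.eq_ofNat_of_zero_le (nonneg_of_mul_add hd.1)
    obtain ⟨j, rfl⟩ := Int.eq_ofNat_of_zero_le (nonneg_of_mul_add hd.2)
    exact ⟨p, i, j, rfl, rfl⟩
  · rintro ⟨p, i, j, rfl, rfl⟩
    exact ⟨i, j, p, rfl, rfl⟩

/-! ### Identification of the gradings in the statement with sums over sections -/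

section
variable {K : Type*} {R : Type u} [Field K] [CommRing R] [Algebra K R] {M : Type*}
  [AddCommGroup M] [Module K M] [Module R M] (𝓡 : ℤ × ℤ → Submodule K R)
  [SetLike.GradedMonoid 𝓡]

theorem diagRingComp_eq (a b : ℕ) :
    diagRingComp 𝓡 a b = subringComp 𝓡 (diagonal a b) (diagSection a b) := by
  funext k
  rw [diagRingComp, subringComp, diagSection, iSup_singleton]

theorem diagModComp_eq [IsScalarTower K R M] (𝓜 : ℤ × ℤ → Submodule K M) [SetLike.GradedSMul 𝓡 𝓜]
    (a b : ℕ) : diagModComp 𝓡 𝓜 a b = submodComp 𝓡 𝓜 (diagonal a b) (diagSection a b) := by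
  funext k
  rw [diagModComp, submodComp, diagSection, iSup_singleton]

theorem totalComp_verRingComp_eq (a b : ℕ) :
    totalComp (verRingComp 𝓡 a b) = subringComp 𝓡 (veronese a b) (verSection a b) := by
  funext k
  rw [subringComp, ← iSup_verSection]
  refine iSup_comap_eq Subtype.val_injective fun i x hx => ⟨⟨x, ?_⟩, rfl⟩
  exact Submodule.mem_iSup_of_mem (⟨_, i, k - i, rfl⟩ : veronese a b) hx

theorem totalComp_verModComp_eq [IsScalarTower K R M] (𝓜 : ℤ × ℤ → Submodule K M)
    [SetLike.GradedSMul 𝓡 𝓜] (a b : ℕ) :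
    totalComp (verModComp 𝓡 𝓜 a b) = submodComp 𝓡 𝓜 (veronese a b) (verSection a b) := by
  funext k
  rw [submodComp, ← iSup_verSection]
  refine iSup_comap_eq (f := (submod 𝓡 𝓜 (veronese a b)).subtype.restrictScalars K)
    Subtype.val_injective fun i x hx => ⟨⟨x, ?_⟩, rfl⟩
  exact Submodule.mem_iSup_of_mem (⟨_, i, k - i, rfl⟩ : veronese a b) hx

end

theorem le_add_of_coe_le {p q i c : ℕ} {r : EReal} (h : (((p + q - i : ℤ) : ℝ) : EReal) ≤ r)
    (hr : r ≤ (c : EReal)) : p + q ≤ i + c := by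
  have h1 : (((p + q - i : ℤ) : ℝ) : EReal) ≤ ((c : ℝ) : EReal) := h.trans hr
  have h2 : ((p + q - i : ℤ) : ℝ) ≤ (((c : ℕ) : ℤ) : ℝ) := by
    rw [Int.cast_natCast]
    exact EReal.coe_le_coe_iff.1 h1
  have h3 := Int.cast_le.1 h2
  omega

end DiagReg

open DiagReg in
theorem corollary2p7 {K : Type*} [Field K] (n m : ℕ) (J : Ideal (BiPoly K n m))
    (hJ : IsBihomogeneous J)
    (hR : IsKoszul (totalComp (quotComp J)))
    {M : Type*} [AddCommGroup M] [Module K M] [Module (BiPoly K n m ⧸ J) M]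
    [IsScalarTower K (BiPoly K n m ⧸ J) M] [Module.Finite (BiPoly K n m ⧸ J) M]
    (𝓜 : ℤ × ℤ → Submodule K M) (hM : DirectSum.IsInternal 𝓜)
    [SetLike.GradedSMul (quotComp J) 𝓜]
    (hpos : ∀ i j : ℤ, ¬ (0 ≤ i ∧ 0 ≤ j) → 𝓜 (i, j) = ⊥)
    (a b : ℕ) (hab : ¬ (a = 0 ∧ b = 0)) :
    ((0 < a → reg (totalComp (quotComp J)) (totalComp 𝓜) ≤ (a : EReal)) →
      (0 < b → reg (totalComp (quotComp J)) (totalComp 𝓜) ≤ (b : EReal)) →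
      reg (diagRingComp (quotComp J) a b) (diagModComp (quotComp J) 𝓜 a b) ≤
        min 1 (reg (totalComp (quotComp J)) (totalComp 𝓜))) ∧
    (1 ≤ a → 1 ≤ b →
      reg (totalComp (quotComp J)) (totalComp 𝓜) ≤ min (a : EReal) (b : EReal) →
      reg (totalComp (verRingComp (quotComp J) a b)) (totalComp (verModComp (quotComp J) 𝓜 a b)) ≤
          min 2 (reg (totalComp (quotComp J)) (totalComp 𝓜)) ∧
        reg (totalComp (verRingComp (quotComp J) a b)) (totalComp (fullModComp 𝓜 a b)) ≤
          min 2 (reg (totalComp (quotComp J)) (totalComp 𝓜))) := by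
  have h := isBigraded_quotComp J hJ
  have hind := hM.submodule_iSupIndep
  have htop := hM.submodule_iSup_eq_top
  have hnn : ∀ d x, x ∈ 𝓜 d → x ≠ 0 → 0 ≤ d := fun d x hx hx0 => by
    by_contra hd
    rw [show d = (d.1, d.2) from rfl, hpos d.1 d.2 hd] at hx
    exact hx0 hx
  refine ⟨fun ha hb => ?_, fun ha hb hr => ?_⟩
  · rw [diagRingComp_eq, diagModComp_eq]
    have h1 := (isSection_diagSection a b hab).reg_submodComp_le h hR 𝓜 hind htop hnn 1
      fun i p q s hs hQ => diagWeights_le hQ (fun h0 => le_add_of_coe_le hs (ha h0))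
        fun h0 => le_add_of_coe_le hs (hb h0)
    rwa [Nat.cast_one] at h1
  · have hle : ∀ i p q : ℕ, (((p + q - i : ℤ) : ℝ) : EReal) ≤
        reg (totalComp (quotComp J)) (totalComp 𝓜) → p + q ≤ i + min a b := fun i p q hs => by
      have h1 := le_add_of_coe_le hs (hr.trans (min_le_left _ _))
      have h2 := le_add_of_coe_le hs (hr.trans (min_le_right _ _))
      omega
    rw [totalComp_verRingComp_eq, totalComp_verModComp_eq,
      show totalComp (fullModComp 𝓜 a b) = _ from funext (iSup_fullSection a b 𝓜)]
    constructor
    · have h1 := (isSection_verSection a b ha hb).reg_submodComp_le h hR 𝓜 hind htop hnn 2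
        fun i p q s hs hQ => verWeights_le hQ (hle i p q hs)
      rwa [Nat.cast_ofNat] at h1
    -- All `a * b` strands obey the same bound, since `verWeights_le` holds for every start `(u,v)`.
    · have h1 := (isSection_verSection a b ha hb).reg_biSup_le h hR 𝓜 hind htop hnn
        (β := Fin a × Fin b) (fun p => p.1) (fun p => p.2) (T := fullSection a b)
        (by
          rintro k l _ ⟨i, j, p, rfl, rfl⟩ ⟨i', j', p', rfl, h'⟩
          rw [(eq_of_mul_add_eq (Prod.ext_iff.1 h').1).1, (eq_of_mul_add_eq (Prod.ext_iff.1 h').2).1])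
        mem_fullSection_iff
        (by
          rintro k _ p p' ⟨i, j, -, rfl⟩ ⟨i', j', -, h'⟩
          exact Prod.ext (eq_of_mul_add_eq (Prod.ext_iff.1 h').1).2
            (eq_of_mul_add_eq (Prod.ext_iff.1 h').2).2) 2
        fun p i p q s hs hQ => verWeights_le hQ (hle i p q hs)
      rwa [Nat.cast_ofNat] at h1
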